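/- **Setting.** Let $\mathcal A$ be a finite alphabet with $d\ge 2$ letters. A generalized interval exchange map (g.i.e.m.) with domain $I=[0,\ell)$ is a bijection $f:I\to I$ with a partition of $I$ into intervals $I_\alpha$ ($\alpha\in\mathcal A$), closed on the left and open on the right, such that each $f|_{I_\alpha}$ is an orientation-preserving homeomorphism onto an interval. Its combinatorial data is $\pi=(\pi_0,\pi_1)$, where $\pi_0,\pi_1:\mathcal A\to\{1,\dots,d\}$ give the order of the $I_\alpha$ and of the $f(I_\alpha)$; its partition vector is $(|I_\alpha|)_\alpha$. It is affine with slope vector $\omega$ if $f(x)=e^{\omega_\alpha}x+\delta_\alpha$ on $I_\alpha$. Let $\alpha(\varepsilon)$ be the last letter of $\pi_\varepsilon$. If $|I_{\alpha(0)}|>|f(I_{\alpha(1)})|$ the type is $\varepsilon=0$, if $<$ it is $\varepsilon=1$; $R(f)$ is the first return map to $I^1=I\setminus f(I_{\alpha(1)})$, resp. $I^1=I\setminus I_{\alpha(0)}$, with the Rauzy–Veech labelling of its intervals and combinatorial data $r_\varepsilon(\pi)$. The combinatorics of an infinitely renormalizable $f$ is the sequence $(\pi^n,\varepsilon^n)$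 of combinatorial data and types of $R^n(f)$; $\alpha^n(\varepsilon^n)$ and $\alpha^n(1-\varepsilon^n)$ are the winner and loser at time $n$. It is $k$-bounded if for all $n,\beta,\gamma$ there are $n_1,p\ge0$ with $|n-n_1|<k$, $|n-n_1-p|<k$, $\alpha^{n_1}(\varepsilon^{n_1})=\beta$, $\alpha^{n_1+p}(1-\varepsilon^{n_1+p})=\gamma$ and $\alpha^{n_1+i}(1-\varepsilon^{n_1+p})=\alpha^{n_1+i+1}(\varepsilon^{n_1+i})$ for $0\le i<p$. Let $f$ be a g.i.e.m. with domain $[0,1)$ and irreducible combinatorial data which extends to each $\overline{I_\alpha}$ as an orientation-preserving diffeomorphism of class $C^{2+\nu}$, $\nu>0$ (second derivative $\nu$-Hölder), has $k$-bounded combinatorics $(\pi^n,\varepsilon^n)$, at most two discontinuities (genus one) and no connections, and satisfies $\int_0^1 D^2f/Df=0$. **Cocycle.** Let $\Theta_n=\mathbb I+E_{\alpha^n(1-\varepsilon^n)\,\alpha^n(\varepsilon^n)}$ on $\mathbb R^{\mathcal A}$. Let $\Omega_\pi$ be the antisymmetric matrix with $(\Omega_\pi)_{\alpha\beta}=1$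 if $\pi_1(\alpha)>\pi_1(\beta)$ and $\pi_0(\alpha)<\pi_0(\beta)$, $-1$ if both inequalities are reversed, and $0$ otherwise. Put $C^s_\pi=\Omega_\pi\mathbb R_+^{\mathcal A}$ and $C^u_\pi=-\Omega_\pi T^+_\pi$, where $T^+_\pi$ is the set of $\tau$ with $\sum_{\pi_0(\alpha)\le s}\tau_\alpha>0>\sum_{\pi_1(\alpha)\le s}\tau_\alpha$ for $1\le s\le d-1$. Let $E^s_j$ be the line spanned by $\bigcap_{n\ge0}\Theta_j^{-1}\cdots\Theta_{j+n}^{-1}C^s_{\pi^{j+n+1}}$ and $E^u_j$ the line spanned by $\Theta_{j-1}\cdots\Theta_0u_0$, for a fixed $u_0\in C^u_{\pi^0}$. The central spaces $E^c_{j,\infty}$ are obtained as follows: for every $n$ choose a periodic admissible combinatorics, of period $p_n\ge n$, which agrees with $(\pi^i,\varepsilon^i)$ for $i\le n$, all of them $K$-bounded for one constant $K$; with $M$ the product of its matrices $\Theta$ over the $p_n$ times from $j$ on, let $\Psi_{j,p_n}(v)=(M-\mathrm{Id})^{-1}(v-Mv)\in\operatorname{Im}\Omega$ for $v\in\ker\Omega$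 (inverse taken on $\operatorname{Im}\Omega$); along a subsequence $\Psi_{j,p_n}\to\Psi_{j,\infty}$ for every $j$, and $E^c_{j,\infty}=\{v+\Psi_{j,\infty}(v):v\in\ker\Omega_{\pi^j}\}$. Let $L_n=\big(\frac1{|I^n_\alpha|}\int_{I^n_\alpha}\ln D(R^nf)\big)_{\alpha}$, let $L_n^c$ be its component in $E^c_{n,\infty}$ with respect to $\mathbb R^{\mathcal A}=E^s_n\oplus E^c_{n,\infty}\oplus E^u_n$, and let $\omega_0=\lim_n\Theta_0^{-1}\cdots\Theta_{n-1}^{-1}L_n^c$. Let $\omega=\omega_0+v$ with $v\in E^s_0$ (in particular $\omega=\omega_0$ is allowed), and $\omega^n=\Theta_{n-1}\cdots\Theta_0\,\omega$. **Partition operators.** Let $\tilde T_n$ be the matrix with entries $1$ at $(i,i)$ for $i\ne\alpha^n(1-\varepsilon^n)$, $\exp(\varepsilon^n\omega^n_{\alpha^n(1)})$ at $(i,i)$ for $i=\alpha^n(1-\varepsilon^n)$, $\exp((1-\varepsilon^n)\omega^n_{\alpha^n(1)})$ at $(\alpha^n(\varepsilon^n),\alpha^n(1-\varepsilon^n))$,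 and $0$ elsewhere; let $\tilde T^{\rm nor}_n\zeta=\tilde T_n\zeta/|\tilde T_n\zeta|_1$ on the open simplex $\Delta_{\mathcal A}=\{\zeta:\zeta_\alpha>0,\ \sum_\alpha\zeta_\alpha=1\}$. **Proposition.** There is a unique affine g.i.e.m. $f_A$ with domain $[0,1)$, combinatorics $(\pi^n,\varepsilon^n)_{n\ge0}$ and slope vector $\omega$. Its partition vector is the unique point of the nested intersection $\bigcap_{n\ge0}\tilde T^{\rm nor}_0\cdots\tilde T^{\rm nor}_n\Delta_{\mathcal A}$; for every $j$ the sets $\tilde T^{\rm nor}_j\cdots\tilde T^{\rm nor}_{j+n}\Delta_{\mathcal A}$ decrease with $n$. Moreover there are $N\ge1$ and $\kappa\in[0,1)$ such that for every $j$ the map $\tilde T^{\rm nor}_j\cdots\tilde T^{\rm nor}_{j+N-1}$ contracts the projective metric $d_p(x,y)=\log\sup_{\alpha,\beta}\frac{x_\alpha y_\beta}{y_\alpha x_\beta}$ on $\Delta_{\mathcal A}$ by the factor $\kappa$. -/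

import Mathlib

open Set Filter Topology MeasureTheory Matrix
open scoped NNReal

namespace RauzyVeech

variable {A : Type*} [Fintype A] [DecidableEq A]

/-! ### Combinatorial data and the Rauzy moves -/

/-- Combinatorial data `π = (π₀, π₁)`: `row 0` and `row 1` are the bijections `π₀`, `π₁` from the
alphabet onto the set of positions, numbered `0, …, d - 1`. -/
@[ext]
structure CombData (A : Type*) [Fintype A] where
  row : Fin 2 → (A ≃ Fin (Fintype.card A))

/-- `π₁ ∘ π₀⁻¹` does not preserve the first `s` positions, for `1 ≤ s ≤ d - 1`. -/
def CombData.Irreducible (π : CombData A) : Prop :=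
  ∀ s : ℕ, 1 ≤ s → s + 1 ≤ Fintype.card A →
    {α : A | (π.row 0 α : ℕ) < s} ≠ {α : A | (π.row 1 α : ℕ) < s}

/-- The last letter `α(ε)` of the row `ε`. -/
def CombData.last [Nonempty A] (π : CombData A) (ε : Fin 2) : A :=
  (π.row ε).symm ⟨Fintype.card A - 1, Nat.sub_lt Fintype.card_pos Nat.one_pos⟩

/-- `π' = r_ε(π)`: the row `ε` of the winner `α(ε)` is kept, and in the other row the loser
`α(1 - ε)` is moved from the last place to the place just after the winner. -/
def IsRauzyMove [Nonempty A] (π : CombData A) (ε : Fin 2) (π' : CombData A) : Prop :=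
  π'.row ε = π.row ε ∧
  ∀ α, (π'.row (1 - ε) α : ℕ) =
    if π.row (1 - ε) α ≤ π.row (1 - ε) (π.last ε) then (π.row (1 - ε) α : ℕ)
    else if α = π.last (1 - ε) then (π.row (1 - ε) (π.last ε) : ℕ) + 1
    else (π.row (1 - ε) α : ℕ) + 1

/-- A sequence `(πⁿ, εⁿ)` of combinatorial data and types. -/
structure CombSeq (A : Type*) [Fintype A] where
  π : ℕ → CombData A
  ε : ℕ → Fin 2

namespace CombSeq

variable [Nonempty A]

/-- The winner `αⁿ(εⁿ)`. -/
def winner (c : CombSeq A) (n : ℕ) : A := (c.π n).last (c.ε n)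

/-- The loser `αⁿ(1 - εⁿ)`. -/
def loser (c : CombSeq A) (n : ℕ) : A := (c.π n).last (1 - c.ε n)

/-- `r_{εⁿ}(πⁿ) = πⁿ⁺¹` for every `n`. -/
def Admissible (c : CombSeq A) : Prop :=
  ∀ n, IsRauzyMove (c.π n) (c.ε n) (c.π (n + 1))

/-- `k`-bounded combinatorics. -/
def IsBounded (k : ℕ) (c : CombSeq A) : Prop :=
  ∀ (n : ℕ) (β γ : A), ∃ n₁ p : ℕ,
    |(n : ℤ) - n₁| < k ∧ |(n : ℤ) - n₁ - p| < k ∧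
    (c.π n₁).last (c.ε n₁) = β ∧
    (c.π (n₁ + p)).last (1 - c.ε (n₁ + p)) = γ ∧
    ∀ i < p, (c.π (n₁ + i)).last (1 - c.ε (n₁ + p)) = (c.π (n₁ + i + 1)).last (c.ε (n₁ + i))

end CombSeq

/-! ### Generalized interval exchange maps -/

/-- A generalized interval exchange map on `[0, ℓ)`, `ℓ = ∑ α, len α`.  The interval `I_α` has
length `len α`, its image has length `imLen α`, and the two families of intervals are ordered from
left to right by `π₀` and by `π₁`.  On each `I_α` the map is an increasing bijection onto the
interval `f(I_α)`, that is, an orientation-preserving homeomorphism.  So that equal maps are equal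
as functions `ℝ → ℝ`, the map is extended by the identity outside `[0, ℓ)`. -/
@[ext]
structure GIET (A : Type*) [Fintype A] where
  comb : CombData A
  len : A → ℝ
  imLen : A → ℝ
  toFun : ℝ → ℝ
  len_pos : ∀ α, 0 < len α
  imLen_pos : ∀ α, 0 < imLen α
  sum_imLen : ∑ α, imLen α = ∑ α, len α
  strictMonoOn : ∀ α, StrictMonoOn toFun
    (Ico (∑ β with comb.row 0 β < comb.row 0 α, len β)
      ((∑ β with comb.row 0 β < comb.row 0 α, len β) + len α))
  image_eq : ∀ α, toFun ''
    (Ico (∑ β with comb.row 0 β < comb.row 0 α, len β)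
      ((∑ β with comb.row 0 β < comb.row 0 α, len β) + len α)) =
    Ico (∑ β with comb.row 1 β < comb.row 1 α, imLen β)
      ((∑ β with comb.row 1 β < comb.row 1 α, imLen β) + imLen α)
  eq_self : ∀ x, x ∉ Ico 0 (∑ α, len α) → toFun x = x

namespace GIET

/-- The length of the domain. -/
def total (f : GIET A) : ℝ := ∑ α, f.len α

/-- The left endpoint `∂I_α`. -/
def left (f : GIET A) (α : A) : ℝ := ∑ β with f.comb.row 0 β < f.comb.row 0 α, f.len β

/-- The interval `I_α`. -/
def interval (f : GIET A) (α : A) : Set ℝ := Ico (f.left α) (f.left α + f.len α)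

/-- `y` is the first return of `x` to `S` under `T`. -/
def IsFirstReturn (T : ℝ → ℝ) (S : Set ℝ) (x y : ℝ) : Prop :=
  ∃ m : ℕ, 0 < m ∧ T^[m] x ∈ S ∧ (∀ i, 0 < i → i < m → T^[i] x ∉ S) ∧ y = T^[m] x

/-- `g = R(f)` is the Rauzy–Veech renormalization of `f`, and `f` has type `ε`. -/
structure IsRauzyStep [Nonempty A] (f : GIET A) (ε : Fin 2) (g : GIET A) : Prop where
  type_zero : ε = 0 → f.imLen (f.comb.last 1) < f.len (f.comb.last 0)
  type_one : ε = 1 → f.len (f.comb.last 0) < f.imLen (f.comb.last 1)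
  comb_eq : IsRauzyMove f.comb ε g.comb
  total_eq : g.total = f.total - min (f.len (f.comb.last 0)) (f.imLen (f.comb.last 1))
  interval_zero : ε = 0 → ∀ α, g.interval α = f.interval α ∩ Ico 0 g.total
  interval_one : ε = 1 → ∀ α, g.interval α =
    if α = f.comb.last 0 then
      {x ∈ f.interval (f.comb.last 1) | f.toFun x ∈ f.interval (f.comb.last 0)}
    else if α = f.comb.last 1 then
      {x ∈ f.interval (f.comb.last 1) | f.toFun x ∉ f.interval (f.comb.last 0)}
    else f.interval α
  firstReturn : ∀ x ∈ Ico 0 g.total, IsFirstReturn f.toFun (Ico 0 g.total) x (g.toFun x)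

/-- `f` is infinitely renormalizable with combinatorics `c`, and `F n = Rⁿ(f)`. -/
structure IsRenormalization [Nonempty A] (f : GIET A) (c : CombSeq A) (F : ℕ → GIET A) :
    Prop where
  zero : F 0 = f
  step : ∀ n, IsRauzyStep (F n) (c.ε n) (F (n + 1))
  comb : ∀ n, (F n).comb = c.π n

/-- `f` is infinitely renormalizable with combinatorics `c`. -/
def HasCombinatorics [Nonempty A] (f : GIET A) (c : CombSeq A) : Prop :=
  ∃ F, IsRenormalization f c F

/-- On each `I_α` the map is `x ↦ exp (ω α) * x + δ α`: it is affine with slope vector `ω`. -/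
def IsAffineWithSlope (f : GIET A) (ω : A → ℝ) : Prop :=
  ∃ δ : A → ℝ, ∀ α, ∀ x ∈ f.interval α, f.toFun x = Real.exp (ω α) * x + δ α

/-- For every `α` the map extends from `I_α` to its closure as an orientation-preserving
diffeomorphism of class `C^{2+ν}`: the extension has a positive derivative and a `ν`-Hölder
second derivative. -/
def IsPiecewiseC2Holder (f : GIET A) (ν : ℝ≥0) : Prop :=
  ∀ α, ∃ h : ℝ → ℝ, EqOn h f.toFun (f.interval α) ∧
    ContDiffOn ℝ 2 h (Icc (f.left α) (f.left α + f.len α)) ∧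
    (∀ x ∈ Icc (f.left α) (f.left α + f.len α),
      0 < derivWithin h (Icc (f.left α) (f.left α + f.len α)) x) ∧
    ∃ C : ℝ≥0, HolderOnWith C ν
      (iteratedDerivWithin 2 h (Icc (f.left α) (f.left α + f.len α)))
      (Icc (f.left α) (f.left α + f.len α))

/-- Genus one: at most two discontinuities. -/
def IsGenusOne (f : GIET A) : Prop :=
  {x ∈ Ico 0 f.total | ¬ ContinuousWithinAt f.toFun (Ico 0 f.total) x}.encard ≤ 2

/-- No connections: no endpoint `∂I_α` is mapped by a positive iterate to an endpoint `∂I_β` in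
the interior of the domain. -/
def NoConnections (f : GIET A) : Prop :=
  ∀ (α β : A) (m : ℕ), 0 < m → (f.comb.row 0 β : ℕ) ≠ 0 → f.toFun^[m] (f.left α) ≠ f.left β

/-- `f` belongs to the class `𝓑_k^{2+ν}` (with domain `[0, 1)`), and `c` is its combinatorics. -/
structure InClassB [Nonempty A] (k : ℕ) (ν : ℝ≥0) (f : GIET A) (c : CombSeq A) : Prop where
  total_eq : f.total = 1
  irreducible : f.comb.Irreducible
  smooth : f.IsPiecewiseC2Holder ν
  combinatorics : f.HasCombinatorics c
  bounded : c.IsBounded k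
  genusOne : f.IsGenusOne
  noConnections : f.NoConnections

/-- The mean of `ln Df` on each interval: `L_α = |I_α|⁻¹ ∫_{I_α} ln Df`. -/
noncomputable def meanLogDeriv (f : GIET A) (α : A) : ℝ :=
  (f.len α)⁻¹ * ∫ x in f.interval α, Real.log (deriv f.toFun x)

end GIET

/-! ### The Rauzy–Veech cocycle and its invariant directions -/

/-- The antisymmetric matrix `Ω_π`. -/
noncomputable def Omega (π : CombData A) : Matrix A A ℝ := Matrix.of fun α β =>
  if π.row 1 β < π.row 1 α ∧ π.row 0 α < π.row 0 β then 1
  else if π.row 1 α < π.row 1 β ∧ π.row 0 β < π.row 0 α then -1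
  else 0

/-- The open positive cone. -/
def posCone (A : Type*) : Set (A → ℝ) := {x | ∀ α, 0 < x α}

/-- The cone `C^s_π = Ω_π ℝ₊^A`. -/
def stableCone (π : CombData A) : Set (A → ℝ) := (Omega π).mulVec '' posCone A

/-- The cone `T⁺_π`. -/
def tauCone (π : CombData A) : Set (A → ℝ) :=
  {τ | ∀ s : ℕ, 1 ≤ s → s + 1 ≤ Fintype.card A →
    0 < ∑ α with (π.row 0 α : ℕ) < s, τ α ∧ ∑ α with (π.row 1 α : ℕ) < s, τ α < 0}

/-- The cone `C^u_π = -Ω_π T⁺_π`. -/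
def unstableCone (π : CombData A) : Set (A → ℝ) := (fun τ => -((Omega π).mulVec τ)) '' tauCone π

namespace CombSeq

variable [Nonempty A]

/-- The matrix `Θ_n = 𝕀 + E_{loser, winner}`. -/
noncomputable def theta (c : CombSeq A) (n : ℕ) : Matrix A A ℝ :=
  1 + Matrix.single (c.loser n) (c.winner n) 1

/-- The product `Θ_{j+n-1} ⋯ Θ_{j+1} Θ_j` of `n` matrices. -/
noncomputable def thetaProd (c : CombSeq A) (j : ℕ) : ℕ → Matrix A A ℝ
  | 0 => 1
  | n + 1 => c.theta (j + n) * thetaProd c j n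

/-- The stable direction `E^s_j`: the line spanned by
`⋂ n, Θ_j⁻¹ ⋯ Θ_{j+n}⁻¹ (C^s_{π^{j+n+1}})`. -/
def stableSpace (c : CombSeq A) (j : ℕ) : Submodule ℝ (A → ℝ) :=
  Submodule.span ℝ
    (⋂ n : ℕ, (c.thetaProd j (n + 1))⁻¹.mulVec '' stableCone (c.π (j + n + 1)))

/-- The unstable direction `E^u_j`, spanned by the image `u_j` of `u` under the cocycle. -/
def unstableSpace (c : CombSeq A) (u : A → ℝ) (j : ℕ) : Submodule ℝ (A → ℝ) :=
  Submodule.span ℝ {(c.thetaProd 0 j).mulVec u}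

/-- For a combinatorics of period `p`, the map `Ψ_{j,p} : ker Ω → Im Ω`,
`Ψ_{j,p}(v) = (M - Id)⁻¹ (v - M v)` with `M = Θ_{j+p-1} ⋯ Θ_j`, where the inverse is that of the
restriction of `M - Id` to `Im Ω_{π^j}`. -/
noncomputable def psi (c : CombSeq A) (p j : ℕ) (v : A → ℝ) : A → ℝ :=
  Function.invFunOn (fun w : A → ℝ => (c.thetaProd j p).mulVec w - w)
    (range (Omega (c.π j)).mulVec) (v - (c.thetaProd j p).mulVec v)

/-- `γ 0, γ 1, …` are periodic combinatorics approximating `c`: `γ n` agrees with `c` up to time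
`n`, has period `p n ≥ n`, and all of them are bounded by the same constant `K`. -/
structure IsPeriodicApprox (c : CombSeq A) (K : ℕ) (γ : ℕ → CombSeq A) (p : ℕ → ℕ) : Prop where
  agree : ∀ n, ∀ i ≤ n, (γ n).π i = c.π i ∧ (γ n).ε i = c.ε i
  period_pos : ∀ n, 0 < p n
  le_period : ∀ n, n ≤ p n
  periodic : ∀ n i, (γ n).π (i + p n) = (γ n).π i ∧ (γ n).ε (i + p n) = (γ n).ε i
  admissible : ∀ n, (γ n).Admissible
  bounded : ∀ n, (γ n).IsBounded K

/-- `E 0, E 1, …` are central directions `E^c_{0,∞}, E^c_{1,∞}, …` of `c`: along a subsequence of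
some periodic approximations of `c` the maps `Ψ_{j,p_n}` converge on `ker Ω_{π^j}`, for every `j`,
and `E j` is the graph of the limit. -/
def IsCentralDirection (c : CombSeq A) (E : ℕ → Set (A → ℝ)) : Prop :=
  ∃ (K : ℕ) (γ : ℕ → CombSeq A) (p φ : ℕ → ℕ) (ψ : ℕ → (A → ℝ) → (A → ℝ)),
    c.IsPeriodicApprox K γ p ∧ StrictMono φ ∧
    (∀ j, ∀ v, (Omega (c.π j)).mulVec v = 0 →
      Tendsto (fun m => (γ (φ m)).psi (p (φ m)) j v) atTop (𝓝 (ψ j v))) ∧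
    ∀ j, E j = {w | ∃ v, (Omega (c.π j)).mulVec v = 0 ∧ w = v + ψ j v}

/-- `ω` is the limit of the vectors `Θ_0⁻¹ Θ_1⁻¹ ⋯ Θ_{n-1}⁻¹ (L_n^c)`, where `L_n^c` is the central
component of `L_n` in the decomposition `E^s_n ⊕ E^c_n ⊕ E^u_n`. -/
def IsCentralLimit (c : CombSeq A) (L : ℕ → A → ℝ) (ω : A → ℝ) : Prop :=
  ∃ (E : ℕ → Set (A → ℝ)) (u : A → ℝ) (Ls Lc Lu : ℕ → A → ℝ),
    c.IsCentralDirection E ∧ u ∈ unstableCone (c.π 0) ∧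
    (∀ n, L n = Ls n + Lc n + Lu n ∧
      Ls n ∈ c.stableSpace n ∧ Lc n ∈ E n ∧ Lu n ∈ c.unstableSpace u n) ∧
    Tendsto (fun n => (c.thetaProd 0 n)⁻¹.mulVec (Lc n)) atTop (𝓝 ω)

/-! ### The projective operators on partition vectors -/

/-- The matrix `T̃_n` attached to the slope vector `ω`, with `ωⁿ = Θ_{n-1} ⋯ Θ_0 ω`. -/
noncomputable def partitionMatrix (c : CombSeq A) (ω : A → ℝ) (n : ℕ) : Matrix A A ℝ :=
  Matrix.of fun i j =>
    if i = j ∧ i ≠ c.loser n then 1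
    else if i = j then
      Real.exp (((c.ε n : ℕ) : ℝ) * (c.thetaProd 0 n).mulVec ω ((c.π n).last 1))
    else if i = c.winner n ∧ j = c.loser n then
      Real.exp ((1 - ((c.ε n : ℕ) : ℝ)) * (c.thetaProd 0 n).mulVec ω ((c.π n).last 1))
    else 0

/-- The projectivization `T̃_n^nor`. -/
noncomputable def partitionMap (c : CombSeq A) (ω : A → ℝ) (n : ℕ) (ζ : A → ℝ) : A → ℝ :=
  (∑ α, (c.partitionMatrix ω n).mulVec ζ α)⁻¹ • (c.partitionMatrix ω n).mulVec ζ

/-- The composition `T̃_j^nor ∘ T̃_{j+1}^nor ∘ ⋯ ∘ T̃_{j+m-1}^nor` of `m` maps. -/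
noncomputable def partitionComp (c : CombSeq A) (ω : A → ℝ) (j : ℕ) : ℕ → (A → ℝ) → (A → ℝ)
  | 0 => id
  | m + 1 => partitionComp c ω j m ∘ c.partitionMap ω (j + m)

end CombSeq

/-- The open simplex `Δ_A`. -/
def simplex (A : Type*) [Fintype A] : Set (A → ℝ) := {x | (∀ α, 0 < x α) ∧ ∑ α, x α = 1}

/-- The projective (Hilbert) metric of the positive cone. -/
noncomputable def projDist (x y : A → ℝ) : ℝ :=
  Real.log (⨆ q : A × A, (x q.1 * y q.2) / (y q.1 * x q.2))

end RauzyVeech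

open RauzyVeech

set_option linter.unusedSectionVars false

namespace RauzyVeech

variable {A : Type*} [Fintype A] [DecidableEq A]

/-! The affine map is encoded by its partition vectors. For an affine map of slope vector `ω` and
combinatorics `c`, the renormalizations are affine with slopes `ωⁿ = Θ_{n-1} ⋯ Θ_0 ω`, and their
lengths satisfy `l_n = T̃_n l_{n+1}` (`exists_orbit_of_affine`). Conversely, a positive orbit of the
`T̃_n` for which image lengths and lengths have the same sum produces such a map
(`exists_affine_of_orbit`). Existence and uniqueness thus reduce to the positive orbits of a
sequence of non-negative matrices.

Bounded combinatorics makes every pair of distinct letters occur as (winner, loser) in each window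
of length `2k` (`exists_winner_loser`). If moreover the `ωⁿ` are bounded, the entries of the
products of `T̃_n` over windows lie between two positive constants, so these products contract the
projective metric uniformly (`exists_uniformlyPositive`, `projDist_mulVec_le`). The nested images of
the simplex then shrink to one point, and a positive orbit exists by compactness and is unique up to
scale. The condition on the sums comes for free: the difference of the two sums does not depend on
`n`, and both sums tend to zero (`sum_exp_orbit_eq`).

What remains is the boundedness of `ωⁿ`, which uses genus one. The two rows are then words `XYZ` and
`ZYX` (`exists_isRotationType`), a form kept by Rauzy moves, and `Im Ω` is a plane cut out by the
vanishing of certain jumps, which the cocycle preserves. Let `l` be a length orbit of standard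
interval exchanges, i.e. a positive orbit of the `Θ_nᵀ`. A vector killed by `l 0` stays at bounded
distance from multiples of `Ω l_n`; these multiples are controlled by the geometric decay of `l_n`,
so its orbit is bounded (`exists_bound_of_dotProduct_eq_zero`). Finally `l 0` kills `ω₀ + v`: on the
stable line because `Ω` is antisymmetric, and on the central spaces because for periodic
combinatorics they consist of fixed vectors of the period matrix, while `l` is scaled by a factor
less than one. -/

/-! ### The projective metric -/

lemma log_le_projDist {x y : A → ℝ} (hx : ∀ α, 0 < x α) (hy : ∀ α, 0 < y α) (α β : A) :
    Real.log (x α) - Real.log (y α) - (Real.log (x β) - Real.log (y β)) ≤ projDist x y := by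
  have h1 : (x α * y β) / (y α * x β) ≤ ⨆ q : A × A, (x q.1 * y q.2) / (y q.1 * x q.2) :=
    le_ciSup (f := fun q : A × A => (x q.1 * y q.2) / (y q.1 * x q.2))
      (Set.finite_range _).bddAbove (α, β)
  have h0 : 0 < (x α * y β) / (y α * x β) :=
    div_pos (mul_pos (hx _) (hy _)) (mul_pos (hy _) (hx _))
  refine le_trans (le_of_eq ?_) (Real.log_le_log h0 h1)
  rw [Real.log_div (mul_pos (hx _) (hy _)).ne' (mul_pos (hy _) (hx _)).ne',
    Real.log_mul (hx _).ne' (hy _).ne', Real.log_mul (hy _).ne' (hx _).ne']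
  ring

lemma projDist_le [Nonempty A] {x y : A → ℝ} (hx : ∀ α, 0 < x α) (hy : ∀ α, 0 < y α) {D : ℝ}
    (h : ∀ α β, Real.log (x α) - Real.log (y α) - (Real.log (x β) - Real.log (y β)) ≤ D) :
    projDist x y ≤ D := by
  have hpos : ∀ q : A × A, 0 < (x q.1 * y q.2) / (y q.1 * x q.2) := fun q =>
    div_pos (mul_pos (hx _) (hy _)) (mul_pos (hy _) (hx _))
  have h1 : (⨆ q : A × A, (x q.1 * y q.2) / (y q.1 * x q.2)) ≤ Real.exp D := by
    refine ciSup_le fun q => ?_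
    rw [← Real.log_le_iff_le_exp (hpos q)]
    refine le_trans (le_of_eq ?_) (h q.1 q.2)
    rw [Real.log_div (mul_pos (hx _) (hy _)).ne' (mul_pos (hy _) (hx _)).ne',
      Real.log_mul (hx _).ne' (hy _).ne', Real.log_mul (hy _).ne' (hx _).ne']
    ring
  obtain ⟨α⟩ := ‹Nonempty A›
  have h2 : 0 < ⨆ q : A × A, (x q.1 * y q.2) / (y q.1 * x q.2) :=
    lt_of_lt_of_le (hpos (α, α)) (le_ciSup
      (f := fun q : A × A => (x q.1 * y q.2) / (y q.1 * x q.2))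
      (Set.finite_range _).bddAbove (α, α))
  exact (Real.log_le_iff_le_exp h2).2 h1

lemma projDist_nonneg [Nonempty A] {x y : A → ℝ} (hx : ∀ α, 0 < x α) (hy : ∀ α, 0 < y α) :
    0 ≤ projDist x y := by
  obtain ⟨α⟩ := ‹Nonempty A›
  simpa using log_le_projDist hx hy α α

lemma projDist_smul [Nonempty A] {x y : A → ℝ} (hx : ∀ α, 0 < x α) (hy : ∀ α, 0 < y α)
    {a b : ℝ} (ha : 0 < a) (hb : 0 < b) : projDist (a • x) (b • y) = projDist x y := by
  have hax : ∀ α, 0 < (a • x) α := fun α => mul_pos ha (hx α)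
  have hby : ∀ α, 0 < (b • y) α := fun α => mul_pos hb (hy α)
  have key : ∀ α β, Real.log ((a • x) α) - Real.log ((b • y) α) -
      (Real.log ((a • x) β) - Real.log ((b • y) β)) =
      Real.log (x α) - Real.log (y α) - (Real.log (x β) - Real.log (y β)) := by
    intro α β
    simp only [Pi.smul_apply, smul_eq_mul]
    rw [Real.log_mul ha.ne' (hx _).ne', Real.log_mul ha.ne' (hx _).ne',
      Real.log_mul hb.ne' (hy _).ne', Real.log_mul hb.ne' (hy _).ne']
    ring
  refine le_antisymm (projDist_le hax hby fun α β => ?_) (projDist_le hx hy fun α β => ?_)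
  · rw [key]; exact log_le_projDist hx hy α β
  · rw [← key]; exact log_le_projDist hax hby α β

/-- Two vectors with the same sum have a coordinate where `x β ≤ y β`, so all ratios `x α / y α` are
at most `exp` of the distance, and symmetrically. This turns projective contraction into convergence
of coordinates. -/
lemma abs_sub_le_of_projDist {x y : A → ℝ} (hx : x ∈ simplex A)
    (hy : y ∈ simplex A) (α : A) : |x α - y α| ≤ Real.exp (projDist x y) - 1 := by
  have : Nonempty A := ⟨α⟩
  have hle : ∀ {z : A → ℝ}, z ∈ simplex A → z α ≤ 1 := fun {z} hz => by
    rw [← hz.2]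
    exact Finset.single_le_sum (f := z) (fun i _ => (hz.1 i).le) (Finset.mem_univ α)
  have h1 : x α ≤ Real.exp (projDist x y) * y α := by
    obtain ⟨β, -, hβ⟩ : ∃ β ∈ Finset.univ, x β ≤ y β :=
      Finset.exists_le_of_sum_le Finset.univ_nonempty (le_of_eq (hx.2.trans hy.2.symm))
    have := log_le_projDist hx.1 hy.1 α β
    have h2 := Real.log_le_log (hx.1 β) hβ
    rw [← Real.log_le_log_iff (hx.1 α) (mul_pos (Real.exp_pos _) (hy.1 α)),
      Real.log_mul (Real.exp_pos _).ne' (hy.1 α).ne', Real.log_exp]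
    linarith
  have h2 : y α ≤ Real.exp (projDist x y) * x α := by
    obtain ⟨β, -, hβ⟩ : ∃ β ∈ Finset.univ, y β ≤ x β :=
      Finset.exists_le_of_sum_le Finset.univ_nonempty (le_of_eq (hy.2.trans hx.2.symm))
    have := log_le_projDist hx.1 hy.1 β α
    have h2 := Real.log_le_log (hy.1 β) hβ
    rw [← Real.log_le_log_iff (hy.1 α) (mul_pos (Real.exp_pos _) (hx.1 α)),
      Real.log_mul (Real.exp_pos _).ne' (hx.1 α).ne', Real.log_exp]
    linarith
  have he : 0 ≤ Real.exp (projDist x y) - 1 := by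
    have := Real.one_le_exp (projDist_nonneg hx.1 hy.1)
    linarith
  have h3 := mul_le_mul_of_nonneg_left (hle hx) he
  have h4 := mul_le_mul_of_nonneg_left (hle hy) he
  rw [abs_le]
  constructor <;> nlinarith

/-- A matrix with entries between `m > 0` and `M` contracts the projective metric. -/
lemma projDist_mulVec_le [Nonempty A] {S : Matrix A A ℝ} {m M : ℝ} (hm : 0 < m)
    (hS : ∀ i j, m ≤ S i j) (hS' : ∀ i j, S i j ≤ M) {x y : A → ℝ} (hx : ∀ α, 0 < x α)
    (hy : ∀ α, 0 < y α) :
    projDist (S *ᵥ x) (S *ᵥ y) ≤ (1 - (m / M) ^ 2) * projDist x y := by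
  have hpos : ∀ {z : A → ℝ}, (∀ α, 0 < z α) → ∀ i, 0 < (S *ᵥ z) i := fun {z} hz i =>
    Finset.sum_pos (fun j _ => mul_pos (lt_of_lt_of_le hm (hS i j)) (hz j)) Finset.univ_nonempty
  have hM : 0 < M := by
    obtain ⟨α⟩ := ‹Nonempty A›
    exact lt_of_lt_of_le hm ((hS α α).trans (hS' α α))
  have hmM : m ≤ M := by
    obtain ⟨α⟩ := ‹Nonempty A›
    exact (hS α α).trans (hS' α α)
  obtain ⟨p, hp⟩ := Finite.exists_min fun α => x α / y α
  obtain ⟨q, hq⟩ := Finite.exists_max fun α => x α / y α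
  -- The extreme ratios `a ≤ b` satisfy `log b - log a ≤ projDist x y`. The vector `x - a y` is
  -- non-negative, so the entry bounds apply to its image as well as to that of `y`.
  set a := x p / y p with ha
  set b := x q / y q with hb
  have ha0 : 0 < a := div_pos (hx _) (hy _)
  have hlo : ∀ j, a * y j ≤ x j := fun j => (le_div_iff₀ (hy j)).1 (hp j)
  have hhi : ∀ j, x j ≤ b * y j := fun j => (div_le_iff₀ (hy j)).1 (hq j)
  set δ := (m / M) ^ 2 with hδ
  have hδ0 : 0 < δ := by positivity
  have hδ1 : δ ≤ 1 := by
    rw [hδ]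
    exact pow_le_one₀ (by positivity) ((div_le_one hM).2 hmM)
  set U := ∑ j, (x j - a * y j) with hU
  set V := ∑ j, y j with hV
  have hU0 : 0 ≤ U := Finset.sum_nonneg fun j _ => sub_nonneg.2 (hlo j)
  have hV0 : 0 < V := Finset.sum_pos (fun j _ => hy j) Finset.univ_nonempty
  have e1 : ∀ i, (S *ᵥ x) i - a * (S *ᵥ y) i = ∑ j, S i j * (x j - a * y j) := by
    intro i
    simp only [mulVec, dotProduct, Finset.mul_sum, ← Finset.sum_sub_distrib]
    exact Finset.sum_congr rfl fun j _ => by ring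
  have l1 : ∀ i, m * U ≤ (S *ᵥ x) i - a * (S *ᵥ y) i := fun i => by
    rw [e1, hU, Finset.mul_sum]
    exact Finset.sum_le_sum fun j _ => mul_le_mul_of_nonneg_right (hS i j) (sub_nonneg.2 (hlo j))
  have u1 : ∀ i, (S *ᵥ x) i - a * (S *ᵥ y) i ≤ M * U := fun i => by
    rw [e1, hU, Finset.mul_sum]
    exact Finset.sum_le_sum fun j _ => mul_le_mul_of_nonneg_right (hS' i j) (sub_nonneg.2 (hlo j))
  have l2 : ∀ i, m * V ≤ (S *ᵥ y) i := fun i => by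
    rw [hV, Finset.mul_sum]
    exact Finset.sum_le_sum fun j _ => mul_le_mul_of_nonneg_right (hS i j) (hy j).le
  have u2 : ∀ i, (S *ᵥ y) i ≤ M * V := fun i => by
    rw [hV, Finset.mul_sum]
    exact Finset.sum_le_sum fun j _ => mul_le_mul_of_nonneg_right (hS' i j) (hy j).le
  have ub : ∀ i, (S *ᵥ x) i ≤ b * (S *ᵥ y) i := fun i => by
    simp only [mulVec, dotProduct, Finset.mul_sum]
    exact Finset.sum_le_sum fun j _ => by
      nlinarith [mul_le_mul_of_nonneg_left (hhi j) (hm.le.trans (hS i j))]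
  refine projDist_le (hpos hx) (hpos hy) fun i i' => ?_
  set P := (S *ᵥ x) i / (S *ᵥ y) i with hP
  set Q := (S *ᵥ x) i' / (S *ᵥ y) i' with hQ
  have hP0 : 0 < P := div_pos (hpos hx _) (hpos hy _)
  have hQ0 : 0 < Q := div_pos (hpos hx _) (hpos hy _)
  have hPb : P ≤ b := (div_le_iff₀ (hpos hy i)).2 (ub i)
  have hPa : P - a ≤ M * U / (m * V) := by
    have : P - a = ((S *ᵥ x) i - a * (S *ᵥ y) i) / (S *ᵥ y) i := by
      rw [hP, sub_div, mul_div_cancel_right₀ _ (hpos hy i).ne']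
    rw [this]
    exact div_le_div₀ (by positivity) (u1 i) (by positivity) (l2 i)
  have hQa : m * U / (M * V) ≤ Q - a := by
    have : Q - a = ((S *ᵥ x) i' - a * (S *ᵥ y) i') / (S *ᵥ y) i' := by
      rw [hQ, sub_div, mul_div_cancel_right₀ _ (hpos hy i').ne']
    rw [this]
    exact div_le_div₀ (le_trans (by positivity) (l1 i')) (l1 i') (hpos hy i') (u2 i')
  -- The excesses over `a` of any two image ratios agree up to the factor `(M / m) ^ 2`, the inverse
  -- of `δ`. Concavity of the logarithm then gives `log P - log Q ≤ (1 - δ) (log P - log a)`.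
  have hQP : (1 - δ) * a + δ * P ≤ Q := by
    have h1 : δ * (P - a) ≤ δ * (M * U / (m * V)) := mul_le_mul_of_nonneg_left hPa hδ0.le
    have h2 : δ * (M * U / (m * V)) = m * U / (M * V) := by
      rw [hδ]; field_simp
    linarith
  have hconc := strictConcaveOn_log_Ioi.concaveOn.2 (mem_Ioi.2 ha0) (mem_Ioi.2 hP0)
    (sub_nonneg.2 hδ1) hδ0.le (by ring)
  simp only [smul_eq_mul] at hconc
  have hlogQ : Real.log ((1 - δ) * a + δ * P) ≤ Real.log Q := by
    refine Real.log_le_log ?_ hQP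
    have := mul_nonneg (sub_nonneg.2 hδ1) ha0.le
    have := mul_pos hδ0 hP0
    linarith
  have hlogP : Real.log P ≤ Real.log b := Real.log_le_log hP0 hPb
  have hab := log_le_projDist hx hy q p
  have e2 : Real.log a = Real.log (x p) - Real.log (y p) := Real.log_div (hx _).ne' (hy _).ne'
  have e3 : Real.log b = Real.log (x q) - Real.log (y q) := Real.log_div (hx _).ne' (hy _).ne'
  have e4 : Real.log P = Real.log ((S *ᵥ x) i) - Real.log ((S *ᵥ y) i) :=
    Real.log_div (hpos hx i).ne' (hpos hy i).ne'
  have e5 : Real.log Q = Real.log ((S *ᵥ x) i') - Real.log ((S *ᵥ y) i') :=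
    Real.log_div (hpos hx i').ne' (hpos hy i').ne'
  rw [← e4, ← e5]
  rw [← e2, ← e3] at hab
  have h6 : (1 - δ) * (Real.log P - Real.log a) ≤ (1 - δ) * projDist x y :=
    mul_le_mul_of_nonneg_left (by linarith) (sub_nonneg.2 hδ1)
  nlinarith

/-- The image of the positive cone under a matrix with entries between `m > 0` and `M` has
bounded projective diameter. -/
lemma projDist_mulVec_le_log [Nonempty A] {S : Matrix A A ℝ} {m M : ℝ} (hm : 0 < m)
    (hS : ∀ i j, m ≤ S i j) (hS' : ∀ i j, S i j ≤ M) {x y : A → ℝ} (hx : ∀ α, 0 < x α)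
    (hy : ∀ α, 0 < y α) :
    projDist (S *ᵥ x) (S *ᵥ y) ≤ 2 * (Real.log M - Real.log m) := by
  have hpos : ∀ {z : A → ℝ}, (∀ α, 0 < z α) → ∀ i, 0 < (S *ᵥ z) i := fun {z} hz i =>
    Finset.sum_pos (fun j _ => mul_pos (lt_of_lt_of_le hm (hS i j)) (hz j)) Finset.univ_nonempty
  have hM : 0 < M := by
    obtain ⟨α⟩ := ‹Nonempty A›
    exact lt_of_lt_of_le hm ((hS α α).trans (hS' α α))
  have lo : ∀ {z : A → ℝ}, (∀ α, 0 < z α) → ∀ i,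
      Real.log m + Real.log (∑ j, z j) ≤ Real.log ((S *ᵥ z) i) := fun {z} hz i => by
    have hV0 : 0 < ∑ j, z j := Finset.sum_pos (fun j _ => hz j) Finset.univ_nonempty
    rw [← Real.log_mul hm.ne' hV0.ne']
    refine Real.log_le_log (by positivity) ?_
    rw [Finset.mul_sum]
    exact Finset.sum_le_sum fun j _ => mul_le_mul_of_nonneg_right (hS i j) (hz j).le
  have hi : ∀ {z : A → ℝ}, (∀ α, 0 < z α) → ∀ i,
      Real.log ((S *ᵥ z) i) ≤ Real.log M + Real.log (∑ j, z j) := fun {z} hz i => by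
    have hV0 : 0 < ∑ j, z j := Finset.sum_pos (fun j _ => hz j) Finset.univ_nonempty
    rw [← Real.log_mul hM.ne' hV0.ne']
    refine Real.log_le_log (hpos hz i) ?_
    rw [Finset.mul_sum]
    exact Finset.sum_le_sum fun j _ => mul_le_mul_of_nonneg_right (hS' i j) (hz j).le
  refine projDist_le (hpos hx) (hpos hy) fun i i' => ?_
  linarith [lo hx i', hi hx i, lo hy i, hi hy i']

/-! ### Normalization to the simplex -/

/-- The positive multiple of a positive vector which lies in the simplex. -/
noncomputable def normalize (x : A → ℝ) : A → ℝ := (∑ α, x α)⁻¹ • x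

lemma sum_pos_of_pos [Nonempty A] {x : A → ℝ} (hx : ∀ α, 0 < x α) : 0 < ∑ α, x α :=
  Finset.sum_pos (fun j _ => hx j) Finset.univ_nonempty

lemma normalize_mem_simplex [Nonempty A] {x : A → ℝ} (hx : ∀ α, 0 < x α) :
    normalize x ∈ simplex A := by
  have h := sum_pos_of_pos hx
  refine ⟨fun α => mul_pos (inv_pos.2 h) (hx α), ?_⟩
  simp only [normalize, Pi.smul_apply, smul_eq_mul, ← Finset.mul_sum]
  exact inv_mul_cancel₀ h.ne'

lemma normalize_smul {x : A → ℝ} {a : ℝ} (ha : a ≠ 0) : normalize (a • x) = normalize x := by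
  simp only [normalize, Pi.smul_apply, smul_eq_mul, ← Finset.mul_sum, smul_smul, mul_inv]
  congr 1
  field_simp

lemma normalize_of_mem_simplex {x : A → ℝ} (hx : x ∈ simplex A) : normalize x = x := by
  simp [normalize, hx.2]

lemma projDist_normalize [Nonempty A] {x y : A → ℝ} (hx : ∀ α, 0 < x α) (hy : ∀ α, 0 < y α) :
    projDist (normalize x) (normalize y) = projDist x y :=
  projDist_smul hx hy (inv_pos.2 (sum_pos_of_pos hx)) (inv_pos.2 (sum_pos_of_pos hy))

/-! ### Products of non-negative matrices -/

/-- The product `T_j T_{j+1} ⋯ T_{j+n-1}`. -/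
noncomputable def seqProd (T : ℕ → Matrix A A ℝ) (j : ℕ) : ℕ → Matrix A A ℝ
  | 0 => 1
  | n + 1 => seqProd T j n * T (j + n)

lemma seqProd_add (T : ℕ → Matrix A A ℝ) (j n k : ℕ) :
    seqProd T j (n + k) = seqProd T j n * seqProd T (j + n) k := by
  induction k with
  | zero => simp [seqProd]
  | succ k ih => rw [← add_assoc, seqProd, ih, seqProd, mul_assoc, add_assoc]

lemma seqProd_congr {T T' : ℕ → Matrix A A ℝ} {j n : ℕ} (h : ∀ i < n, T (j + i) = T' (j + i)) :
    seqProd T j n = seqProd T' j n := by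
  induction n with
  | zero => rfl
  | succ n ih => rw [seqProd, seqProd, ih fun i hi => h i (by omega), h n (by omega)]

/-- Sequences of non-negative matrices with positive diagonal all of whose products over `N`
consecutive times have entries between `m > 0` and `M`. -/
structure UniformlyPositive (T : ℕ → Matrix A A ℝ) (N : ℕ) (m M : ℝ) : Prop where
  nonneg : ∀ n i j, 0 ≤ T n i j
  diag_pos : ∀ n i, 0 < T n i i
  pos : 0 < m
  lower : ∀ n i j, m ≤ seqProd T n N i j
  upper : ∀ n i j, seqProd T n N i j ≤ M

namespace UniformlyPositive

variable {T : ℕ → Matrix A A ℝ} {N : ℕ} {m M : ℝ}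

/-- Elementary matrices: if the diagonal entries and the entries `(w n, l n)` are at least `δ`,
and every off-diagonal position is some `(w i, l i)` in each window of length `N`, then the
products over windows are uniformly positive. -/
lemma of_window {δ R : ℝ} (hδ : 0 < δ) (w l : ℕ → A)
    (hnn : ∀ n i j, 0 ≤ T n i j)
    (hdiag : ∀ n i, δ ≤ T n i i) (hwl : ∀ n, δ ≤ T n (w n) (l n))
    (hrow : ∀ n i, ∑ j, T n i j ≤ R)
    (hwin : ∀ n i j, i ≠ j → ∃ k < N, w (n + k) = i ∧ l (n + k) = j) :
    UniformlyPositive T N (δ ^ N) (R ^ N) := by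
  have hS : ∀ j n a b, 0 ≤ seqProd T j n a b := by
    intro j n
    induction n with
    | zero => intro a b; simp only [seqProd, Matrix.one_apply]; split_ifs <;> simp
    | succ n ih =>
      intro a b
      exact Finset.sum_nonneg fun k _ => mul_nonneg (ih _ _) (hnn _ _ _)
  -- An entry already bounded below stays so, at the cost of a factor `δ`, because the diagonals are
  -- at least `δ`.
  have hmono : ∀ j n a b, δ ^ n ≤ seqProd T j n a b → δ ^ (n + 1) ≤ seqProd T j (n + 1) a b := by
    intro j n a b h
    calc δ ^ (n + 1) = δ ^ n * δ := pow_succ _ _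
      _ ≤ seqProd T j n a b * T (j + n) b b :=
        mul_le_mul h (hdiag _ _) hδ.le (hS _ _ _ _)
      _ ≤ _ := Finset.single_le_sum (f := fun k => seqProd T j n a k * T (j + n) k b)
        (fun k _ => mul_nonneg (hS _ _ _ _) (hnn _ _ _)) (Finset.mem_univ b)
  have hd : ∀ j n a, δ ^ n ≤ seqProd T j n a a := by
    intro j n a
    induction n with
    | zero => simp [seqProd]
    | succ n ih => exact hmono _ _ _ _ ih
  refine ⟨hnn, fun n i => lt_of_lt_of_le hδ (hdiag n i), by positivity, ?_, ?_⟩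
  · intro j a b
    by_cases hab : a = b
    · subst hab; exact hd _ _ _
    obtain ⟨k, hk, h1, h2⟩ := hwin j a b hab
    have h3 : δ ^ (k + 1) ≤ seqProd T j (k + 1) a b := by
      calc δ ^ (k + 1) = δ ^ k * δ := pow_succ _ _
        _ ≤ seqProd T j k a a * T (j + k) a b := by
          refine mul_le_mul (hd _ _ _) ?_ hδ.le (hS _ _ _ _)
          have := hwl (j + k)
          rwa [h1, h2] at this
        _ ≤ _ := Finset.single_le_sum (f := fun i => seqProd T j k a i * T (j + k) i b)
          (fun i _ => mul_nonneg (hS _ _ _ _) (hnn _ _ _)) (Finset.mem_univ a)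
    have h4 : ∀ r, δ ^ (k + 1 + r) ≤ seqProd T j (k + 1 + r) a b := by
      intro r
      induction r with
      | zero => exact h3
      | succ r ih => exact hmono _ _ _ _ ih
    have := h4 (N - (k + 1))
    rwa [show k + 1 + (N - (k + 1)) = N by omega] at this
  · intro j a b
    have hR : ∀ n, ∑ b, seqProd T j n a b ≤ R ^ n := by
      intro n
      induction n with
      | zero => simp [seqProd, Matrix.one_apply]
      | succ n ih =>
        have e : ∑ b, seqProd T j (n + 1) a b =
            ∑ k, seqProd T j n a k * ∑ b, T (j + n) k b := by
          simp only [seqProd, Matrix.mul_apply, Finset.mul_sum]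
          exact Finset.sum_comm
        rw [e, pow_succ]
        have hR0 : 0 ≤ R := le_trans (Finset.sum_nonneg fun b _ => hnn 0 a b) (hrow 0 a)
        calc _ ≤ ∑ k, seqProd T j n a k * R :=
              Finset.sum_le_sum fun k _ => mul_le_mul_of_nonneg_left (hrow _ _) (hS _ _ _ _)
          _ = (∑ k, seqProd T j n a k) * R := by rw [Finset.sum_mul]
          _ ≤ R ^ n * R := mul_le_mul_of_nonneg_right ih hR0
    exact le_trans (Finset.single_le_sum (f := fun b => seqProd T j N a b)
      (fun b _ => hS _ _ _ _) (Finset.mem_univ b)) (hR N)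

variable (hT : UniformlyPositive T N m M)
include hT

lemma mulVec_pos (n : ℕ) {x : A → ℝ} (hx : ∀ α, 0 < x α) (i : A) : 0 < (T n *ᵥ x) i :=
  Finset.sum_pos' (fun j _ => mul_nonneg (hT.nonneg n i j) (hx j).le)
    ⟨i, Finset.mem_univ _, mul_pos (hT.diag_pos n i) (hx i)⟩

lemma seqProd_mulVec_pos (j n : ℕ) {x : A → ℝ} (hx : ∀ α, 0 < x α) :
    ∀ i, 0 < (seqProd T j n *ᵥ x) i := by
  induction n generalizing x with
  | zero => simpa [seqProd] using hx
  | succ n ih =>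
    rw [seqProd, ← mulVec_mulVec]
    exact ih (hT.mulVec_pos _ hx)

lemma le_upper [Nonempty A] : m ≤ M := by
  obtain ⟨α⟩ := ‹Nonempty A›
  exact (hT.lower 0 α α).trans (hT.upper 0 α α)

/-- The contraction factor over a window. -/
lemma contraction_nonneg [Nonempty A] : 0 ≤ 1 - (m / M) ^ 2 := by
  have := pow_le_one₀ (n := 2) (div_nonneg hT.pos.le (hT.pos.le.trans hT.le_upper))
    ((div_le_one (lt_of_lt_of_le hT.pos hT.le_upper)).2 hT.le_upper)
  linarith

lemma contraction_lt_one [Nonempty A] : 1 - (m / M) ^ 2 < 1 := by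
  have := hT.pos
  have := lt_of_lt_of_le hT.pos hT.le_upper
  have : 0 < (m / M) ^ 2 := by positivity
  linarith

/-- The innermost window brings the whole cone to finite diameter, and each of the `q` further
windows contracts. The bound is therefore uniform in `x` and `y`, although the open simplex has
infinite diameter as soon as there are two letters. -/
lemma projDist_seqProd_le [Nonempty A] (q j : ℕ) {x y : A → ℝ} (hx : ∀ α, 0 < x α)
    (hy : ∀ α, 0 < y α) :
    projDist (seqProd T j (N * (q + 1)) *ᵥ x) (seqProd T j (N * (q + 1)) *ᵥ y) ≤
      (1 - (m / M) ^ 2) ^ q * (2 * (Real.log M - Real.log m)) := by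
  induction q generalizing j with
  | zero =>
    simpa using projDist_mulVec_le_log hT.pos (hT.lower j) (hT.upper j) hx hy
  | succ q ih =>
    rw [show N * (q + 1 + 1) = N + N * (q + 1) by ring, seqProd_add, ← mulVec_mulVec,
      ← mulVec_mulVec]
    refine (projDist_mulVec_le hT.pos (hT.lower j) (hT.upper j)
      (hT.seqProd_mulVec_pos _ _ hx) (hT.seqProd_mulVec_pos _ _ hy)).trans ?_
    rw [pow_succ' (1 - (m / M) ^ 2) q, mul_assoc]
    exact mul_le_mul_of_nonneg_left (ih _) hT.contraction_nonneg

/-- The images of the simplex shrink to a point. -/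
lemma exists_forall_abs_sub_lt (j : ℕ) {ε : ℝ} (hε : 0 < ε) :
    ∃ n₀, ∀ n ≥ n₀, ∀ x y : A → ℝ, (∀ α, 0 < x α) → (∀ α, 0 < y α) → ∀ i,
      |normalize (seqProd T j n *ᵥ x) i - normalize (seqProd T j n *ᵥ y) i| < ε := by
  cases isEmpty_or_nonempty A
  · exact ⟨0, fun _ _ _ _ _ _ i => isEmptyElim i⟩
  have h0 : Tendsto (fun q : ℕ => Real.exp ((1 - (m / M) ^ 2) ^ q *
      (2 * (Real.log M - Real.log m))) - 1) atTop (𝓝 0) := by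
    have := (tendsto_pow_atTop_nhds_zero_of_lt_one hT.contraction_nonneg
      hT.contraction_lt_one).mul_const (2 * (Real.log M - Real.log m))
    have := ((Real.continuous_exp.tendsto _).comp this).sub_const 1
    simpa using this
  obtain ⟨q, hq⟩ := (h0.eventually (gt_mem_nhds hε)).exists
  refine ⟨N * (q + 1), fun n hn x y hx hy i => ?_⟩
  obtain ⟨r, rfl⟩ := Nat.exists_eq_add_of_le hn
  refine lt_of_le_of_lt (abs_sub_le_of_projDist
    (normalize_mem_simplex (hT.seqProd_mulVec_pos _ _ hx))
    (normalize_mem_simplex (hT.seqProd_mulVec_pos _ _ hy)) i) (lt_of_le_of_lt ?_ hq)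
  rw [projDist_normalize (hT.seqProd_mulVec_pos _ _ hx) (hT.seqProd_mulVec_pos _ _ hy),
    seqProd_add, ← mulVec_mulVec, ← mulVec_mulVec]
  have := hT.projDist_seqProd_le q j (hT.seqProd_mulVec_pos (j + N * (q + 1)) r hx)
    (hT.seqProd_mulVec_pos (j + N * (q + 1)) r hy)
  exact sub_le_sub_right (Real.exp_le_exp.2 this) 1

end UniformlyPositive

/-! ### Positive orbits: uniqueness up to scale, comparability of entries, existence -/

/-- `l` is a positive sequence with `l_n = T_n l_{n+1}`. -/
structure IsPositiveOrbit (T : ℕ → Matrix A A ℝ) (l : ℕ → A → ℝ) : Prop where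
  pos : ∀ n α, 0 < l n α
  eq : ∀ n, l n = T n *ᵥ l (n + 1)

namespace IsPositiveOrbit

variable {T : ℕ → Matrix A A ℝ} {N : ℕ} {m M : ℝ} {l l' : ℕ → A → ℝ}

lemma eq_seqProd (hl : IsPositiveOrbit T l) (j n : ℕ) : l j = seqProd T j n *ᵥ l (j + n) := by
  induction n with
  | zero => simp [seqProd]
  | succ n ih => rw [seqProd, ← mulVec_mulVec, add_assoc j n 1 |>.symm, ← hl.eq (j + n), ← ih]

/-- Both vectors at time `j` lie in images of the cone under arbitrarily long products, and these
shrink to a ray. This is a form of unique ergodicity. -/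
lemma normalize_eq (hT : UniformlyPositive T N m M) (hl : IsPositiveOrbit T l)
    (hl' : IsPositiveOrbit T l') (j : ℕ) : normalize (l j) = normalize (l' j) := by
  funext i
  refine eq_of_abs_sub_le_all fun ε hε => ?_
  obtain ⟨n, hn⟩ := hT.exists_forall_abs_sub_lt j hε
  have := hn n le_rfl _ _ (hl.pos (j + n)) (hl'.pos (j + n)) i
  rw [← hl.eq_seqProd, ← hl'.eq_seqProd] at this
  exact this.le

lemma le_mul (hT : UniformlyPositive T N m M) (hl : IsPositiveOrbit T l) (n : ℕ) (α β : A) :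
    m * l n α ≤ M * l n β := by
  rw [hl.eq_seqProd n N]
  have h1 : (seqProd T n N *ᵥ l (n + N)) α ≤ M * ∑ j, l (n + N) j := by
    rw [Finset.mul_sum]
    exact Finset.sum_le_sum fun j _ => mul_le_mul_of_nonneg_right (hT.upper _ _ _) (hl.pos _ _).le
  have h2 : m * ∑ j, l (n + N) j ≤ (seqProd T n N *ᵥ l (n + N)) β := by
    rw [Finset.mul_sum]
    exact Finset.sum_le_sum fun j _ => mul_le_mul_of_nonneg_right (hT.lower _ _ _) (hl.pos _ _).le
  have : Nonempty A := ⟨α⟩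
  have hM : 0 ≤ M := hT.pos.le.trans hT.le_upper
  calc _ ≤ m * (M * ∑ j, l (n + N) j) := mul_le_mul_of_nonneg_left h1 hT.pos.le
    _ = M * (m * ∑ j, l (n + N) j) := by ring
    _ ≤ _ := mul_le_mul_of_nonneg_left h2 hM

/-- All entries of `l_n` are comparable to the sum of the entries. -/
lemma exists_mul_sum_le [Nonempty A] (hT : UniformlyPositive T N m M)
    (hl : IsPositiveOrbit T l) : ∃ c₀ > 0, ∀ n α, c₀ * ∑ β, l n β ≤ l n α := by
  have hm := hT.pos
  have hM : 0 < M := lt_of_lt_of_le hT.pos hT.le_upper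
  have hd : (0 : ℝ) < Fintype.card A := by exact_mod_cast Fintype.card_pos
  refine ⟨m / (Fintype.card A * M), by positivity, fun n α => ?_⟩
  have h1 : m * ∑ β, l n β ≤ Fintype.card A * (M * l n α) := by
    rw [← nsmul_eq_mul, Finset.mul_sum]
    exact Finset.sum_le_card_nsmul _ _ _ fun β _ => hl.le_mul hT n β α
  rw [div_mul_eq_mul_div, div_le_iff₀ (by positivity)]
  linarith

end IsPositiveOrbit

/-- Existence of a positive orbit, by compactness of a product of simplices. -/
lemma UniformlyPositive.exists_orbit [Nonempty A] {T : ℕ → Matrix A A ℝ} {N : ℕ} {m M : ℝ}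
    (hT : UniformlyPositive T N m M) :
    ∃ l, IsPositiveOrbit T l ∧ ∑ α, l 0 α = 1 := by
  set one : A → ℝ := fun _ => 1
  have hone : ∀ α, 0 < one α := fun _ => one_pos
  set K : Set (ℕ → A → ℝ) := Set.pi univ fun _ => stdSimplex ℝ A
  have hK : IsCompact K := isCompact_univ_pi fun _ => isCompact_stdSimplex ℝ A
  -- An approximate orbit: `(1, …, 1)` is placed at time `n` and pulled back. For `j > n` the
  -- truncated subtraction gives the barycentre, which is harmless since each `j` is eventually
  -- below `φ n`.
  set z : ℕ → ℕ → A → ℝ := fun n j => normalize (seqProd T j (n - j) *ᵥ one)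
  have hzpos : ∀ n j, z n j ∈ simplex A := fun n j =>
    normalize_mem_simplex (hT.seqProd_mulVec_pos _ _ hone)
  have hz : ∀ n, z n ∈ K := fun n j _ => ⟨fun α => ((hzpos n j).1 α).le, (hzpos n j).2⟩
  obtain ⟨ζ, hζ, φ, hφ, hlim⟩ := hK.tendsto_subseq hz
  have hζ' : ∀ j, ζ j ∈ stdSimplex ℝ A := fun j => hζ j (mem_univ _)
  -- Written without division, so that it passes to the limit even though `ζ` is so far only known
  -- to lie in the closed simplices.
  have hrel : ∀ j, (∑ α, (T j *ᵥ ζ (j + 1)) α) • ζ j = T j *ᵥ ζ (j + 1) := by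
    intro j
    have hj : ∀ j, Tendsto (fun n => z (φ n) j) atTop (𝓝 (ζ j)) := fun j =>
      (continuous_apply j).continuousAt.tendsto.comp hlim
    have hmv : Tendsto (fun n => T j *ᵥ z (φ n) (j + 1)) atTop (𝓝 (T j *ᵥ ζ (j + 1))) :=
      ((Continuous.matrix_mulVec continuous_const continuous_id).tendsto _).comp (hj (j + 1))
    have hsum : Tendsto (fun n => ∑ α, (T j *ᵥ z (φ n) (j + 1)) α) atTop
        (𝓝 (∑ α, (T j *ᵥ ζ (j + 1)) α)) :=
      tendsto_finsetSum _ fun α _ => (tendsto_pi_nhds.1 hmv) α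
    refine tendsto_nhds_unique ((hsum.smul (hj j)).congr' ?_) hmv
    filter_upwards [eventually_ge_atTop (j + 1)] with n hn
    have hn' : j + 1 ≤ φ n := hn.trans hφ.le_apply
    have e : seqProd T j (φ n - j) = T j * seqProd T (j + 1) (φ n - (j + 1)) := by
      rw [show φ n - j = 1 + (φ n - (j + 1)) by omega, seqProd_add]
      simp [seqProd]
    have h1 : z (φ n) j = normalize (T j *ᵥ z (φ n) (j + 1)) := by
      simp only [z]
      rw [e, ← mulVec_mulVec]
      conv_rhs => rw [normalize.eq_1 (seqProd T (j + 1) _ *ᵥ one), mulVec_smul]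
      rw [normalize_smul]
      exact (inv_pos.2 (sum_pos_of_pos (hT.seqProd_mulVec_pos _ _ hone))).ne'
    rw [h1, normalize, smul_smul, mul_inv_cancel₀, one_smul]
    exact (sum_pos_of_pos (hT.mulVec_pos j (hzpos (φ n) (j + 1)).1)).ne'
  set s : ℕ → ℝ := fun j => ∑ α, (T j *ᵥ ζ (j + 1)) α with hs
  have hs0 : ∀ j, 0 < s j := by
    intro j
    have h1 : ∀ i, T j i i * ζ (j + 1) i ≤ (T j *ᵥ ζ (j + 1)) i := fun i =>
      Finset.single_le_sum (f := fun k => T j i k * ζ (j + 1) k)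
        (fun k _ => mul_nonneg (hT.nonneg _ _ _) ((hζ' _).1 k)) (Finset.mem_univ i)
    have h2 : ∀ i, 0 ≤ T j i i * ζ (j + 1) i := fun i =>
      mul_nonneg (hT.nonneg _ _ _) ((hζ' _).1 i)
    obtain ⟨i, -, hi⟩ : ∃ i ∈ Finset.univ, 0 < ζ (j + 1) i := by
      by_contra! hcon
      have := Finset.sum_nonpos hcon
      rw [(hζ' (j + 1)).2] at this
      linarith
    exact Finset.sum_pos' (fun i _ => (h2 i).trans (h1 i))
      ⟨i, Finset.mem_univ _, lt_of_lt_of_le (mul_pos (hT.diag_pos _ _) hi) (h1 i)⟩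
  -- Scales which turn the projective relation into `l_n = T_n l_{n+1}`.
  let c : ℕ → ℝ := fun n => Nat.rec 1 (fun j cj => cj / s j) n
  have hc : ∀ n, c (n + 1) = c n / s n := fun _ => rfl
  have hc0 : ∀ n, 0 < c n := by
    intro n
    induction n with
    | zero => exact one_pos
    | succ n ih => rw [hc]; exact div_pos ih (hs0 n)
  have heq : ∀ n, c n • ζ n = T n *ᵥ (c (n + 1) • ζ (n + 1)) := by
    intro n
    rw [mulVec_smul, ← hrel n, smul_smul, hc, div_mul_cancel₀]
    exact (hs0 n).ne'
  refine ⟨fun n => c n • ζ n, ⟨fun n α => ?_, heq⟩, ?_⟩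
  -- Strict positivity: the vector is the image of a nonzero non-negative one under a window
  -- product, all of whose entries are at least `m`.
  · have hprod : ∀ j k, c j • ζ j = seqProd T j k *ᵥ (c (j + k) • ζ (j + k)) := by
      intro j k
      induction k with
      | zero => simp [seqProd]
      | succ k ih => rw [seqProd, ← mulVec_mulVec, ← add_assoc, ← heq, ih]
    rw [hprod n N]
    have h1 : m * (c (n + N) * 1) ≤ (seqProd T n N *ᵥ (c (n + N) • ζ (n + N))) α := by
      rw [← (hζ' (n + N)).2, Finset.mul_sum, Finset.mul_sum]
      exact Finset.sum_le_sum fun j _ => mul_le_mul_of_nonneg_right (hT.lower _ _ _)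
        (mul_nonneg (hc0 _).le ((hζ' _).1 j))
    exact lt_of_lt_of_le (mul_pos hT.pos (mul_pos (hc0 _) one_pos)) h1
  · simpa [c] using (hζ' 0).2

/-! ### Rauzy moves -/

section Moves

variable [Nonempty A] {π π' : CombData A} {ε : Fin 2}

lemma fin_two_cases (ε : Fin 2) : ε = 0 ∨ ε = 1 := by
  revert ε; decide

lemma CombData.row_last (π : CombData A) (ε : Fin 2) :
    (π.row ε (π.last ε) : ℕ) = Fintype.card A - 1 := by
  simp [CombData.last]

lemma CombData.eq_last {α : A} (h : (π.row ε α : ℕ) = Fintype.card A - 1) : α = π.last ε := by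
  apply (π.row ε).injective
  ext
  rw [h, π.row_last]

lemma CombData.row_le_last (π : CombData A) (ε : Fin 2) (α : A) :
    (π.row ε α : ℕ) ≤ π.row ε (π.last ε) := by
  rw [π.row_last]
  have := (π.row ε α).2
  omega

lemma CombData.row_lt_last {α : A} (h : α ≠ π.last ε) :
    (π.row ε α : ℕ) < π.row ε (π.last ε) := by
  refine lt_of_le_of_ne (π.row_le_last ε α) fun h' => h ?_
  rw [π.row_last] at h'
  exact CombData.eq_last h'

lemma IsRauzyMove.last_eq (h : IsRauzyMove π ε π') : π'.last ε = π.last ε := by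
  simp [CombData.last, h.1]

/-- A letter which is last in both rows has nothing to its right, so the move is trivial.
`IsRauzyMove` does not forbid this degenerate case. -/
lemma IsRauzyMove.eq_of_last_eq (h : IsRauzyMove π ε π') (hl : π.last (1 - ε) = π.last ε) :
    π' = π := by
  have h2 : π'.row (1 - ε) = π.row (1 - ε) := by
    ext α
    rw [h.2, if_pos]
    rw [← hl]
    exact π.row_le_last _ α
  ext δ : 2
  rcases fin_two_cases ε with rfl | rfl <;> rcases fin_two_cases δ with rfl | rfl
  · exact h.1
  · exact h2
  · exact h2
  · exact h.1

/-! ### Consequences of bounded combinatorics -/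

namespace CombSeq

variable {c : CombSeq A} {k : ℕ}

/-- Otherwise the combinatorial data are constant from time `n` on and a single letter wins forever,
whereas boundedness makes every letter win near time `n + k`. -/
lemma winner_ne_loser [Nontrivial A] (hc : c.Admissible) (hk : c.IsBounded k) (n : ℕ) :
    c.winner n ≠ c.loser n := by
  intro h
  have h01 : ∀ δ, (c.π n).last δ = c.winner n := by
    intro δ
    rcases fin_two_cases δ with rfl | rfl <;>
    rcases fin_two_cases (c.ε n) with h' | h' <;> simp [winner, loser, h'] at h ⊢ <;> simp [h]
  have hst : ∀ m, c.π (n + m) = c.π n := by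
    intro m
    induction m with
    | zero => rfl
    | succ m ih =>
      rw [← add_assoc, (hc (n + m)).eq_of_last_eq, ih]
      rw [ih, h01, h01]
  obtain ⟨β, hβ⟩ := exists_ne (c.winner n)
  obtain ⟨n₁, -, h1, -, h2, -⟩ := hk (n + k) β β
  rw [abs_lt] at h1
  obtain ⟨r, rfl⟩ := Nat.exists_eq_add_of_le (show n ≤ n₁ by push_cast at h1; omega)
  rw [hst, h01] at h2
  exact hβ h2.symm

/-- In the definition of boundedness a chain with `p > 0` can only join a letter to itself: the
winner stays last in its row, so the chain condition forces the same row, and hence the same letter,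
to win at every time before `n₁ + p`, and that letter is the loser at `n₁ + p`. For distinct letters
`p = 0`. -/
lemma exists_winner_loser [Nontrivial A] (hc : c.Admissible) (hk : c.IsBounded k) (n : ℕ)
    {β γ : A} (hβγ : β ≠ γ) : ∃ i < 2 * k, c.winner (n + i) = β ∧ c.loser (n + i) = γ := by
  -- Centring at `n + k` places `n₁` strictly between `n` and `n + 2k`.
  obtain ⟨n₁, p, h1, h2, h3, h4, h5⟩ := hk (n + k) β γ
  rw [abs_lt] at h1
  push_cast at h1
  rcases Nat.eq_zero_or_pos p with rfl | hp
  · obtain ⟨r, rfl⟩ := Nat.exists_eq_add_of_le (show n ≤ n₁ by omega)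
    exact ⟨r, by omega, h3, h4⟩
  · exfalso
    have hε : ∀ i < p, c.ε (n₁ + i) = 1 - c.ε (n₁ + p) := by
      intro i hi
      have h6 := h5 i hi
      rw [(hc (n₁ + i)).last_eq] at h6
      have h7 := winner_ne_loser hc hk (n₁ + i)
      unfold winner loser at h7
      by_contra hne
      have h8 : 1 - c.ε (n₁ + p) = 1 - c.ε (n₁ + i) := by
        revert hne
        generalize c.ε (n₁ + p) = x
        generalize c.ε (n₁ + i) = y
        revert x y; decide
      rw [h8] at h6
      exact h7 h6.symm
    have hw : ∀ i ≤ p, (c.π (n₁ + i)).last (1 - c.ε (n₁ + p)) = β := by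
      intro i
      induction i with
      | zero => intro _; rw [← hε 0 hp]; exact h3
      | succ i ih =>
        intro hi
        rw [← hε i (by omega), ← add_assoc, (hc (n₁ + i)).last_eq, hε i (by omega)]
        exact ih (by omega)
    exact hβγ ((hw p le_rfl).symm.trans h4)

/-! ### The matrices `Θ_n` and `T̃_n` -/

lemma theta_mulVec (c : CombSeq A) (n : ℕ) (x : A → ℝ) (α : A) :
    (c.theta n *ᵥ x) α = x α + if α = c.loser n then x (c.winner n) else 0 := by
  rw [theta, add_mulVec, one_mulVec, Pi.add_apply, single_mulVec]
  simp [Function.update_apply]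

lemma isUnit_det_theta {n : ℕ} (h : c.winner n ≠ c.loser n) : IsUnit (c.theta n).det := by
  have : c.theta n = transvection (c.loser n) (c.winner n) 1 := rfl
  rw [this, det_transvection_of_ne _ _ h.symm]
  exact isUnit_one

lemma isUnit_det_thetaProd (h : ∀ n, c.winner n ≠ c.loser n) (j n : ℕ) :
    IsUnit (c.thetaProd j n).det := by
  induction n with
  | zero => simp [thetaProd]
  | succ n ih => rw [thetaProd, det_mul]; exact (isUnit_det_theta (h _)).mul ih

lemma thetaProd_zero_succ (c : CombSeq A) (n : ℕ) :
    c.thetaProd 0 (n + 1) = c.theta n * c.thetaProd 0 n := by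
  rw [thetaProd, zero_add]

lemma transpose_thetaProd (c : CombSeq A) (j n : ℕ) :
    (c.thetaProd j n)ᵀ = seqProd (fun i => (c.theta i)ᵀ) j n := by
  induction n with
  | zero => simp [thetaProd, seqProd]
  | succ n ih => rw [thetaProd, transpose_mul, ih, seqProd]

lemma partitionMatrix_mulVec {n : ℕ} (h : c.winner n ≠ c.loser n) (ω z : A → ℝ) (i : A) :
    (c.partitionMatrix ω n *ᵥ z) i =
      if i = c.winner n then z i + Real.exp ((1 - ((c.ε n : ℕ) : ℝ)) *
        (c.thetaProd 0 n).mulVec ω ((c.π n).last 1)) * z (c.loser n)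
      else if i = c.loser n then
        Real.exp (((c.ε n : ℕ) : ℝ) * (c.thetaProd 0 n).mulVec ω ((c.π n).last 1)) * z i
      else z i := by
  have e : ∀ j, c.partitionMatrix ω n i j * z j =
      (if j = i then (if i = c.loser n then
        Real.exp (((c.ε n : ℕ) : ℝ) * (c.thetaProd 0 n).mulVec ω ((c.π n).last 1)) else 1) * z i
        else 0) +
      (if j = c.loser n then (if i = c.winner n then Real.exp ((1 - ((c.ε n : ℕ) : ℝ)) *
        (c.thetaProd 0 n).mulVec ω ((c.π n).last 1)) * z (c.loser n) else 0) else 0) := by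
    intro j
    simp only [partitionMatrix, of_apply]
    by_cases h1 : i = j
    · subst h1
      by_cases h2 : i = c.loser n
      · have h3 : ¬ c.loser n = c.winner n := fun h' => h h'.symm
        simp [h2, h3]
      · simp [h2]
    · have h1' : ¬ j = i := fun h' => h1 h'.symm
      by_cases h2 : j = c.loser n
      · by_cases h3 : i = c.winner n
        · have h' : ¬ c.loser n = c.winner n := fun h' => h h'.symm
          simp [h2, h3, h, h']
        · have : ¬ i = c.loser n := fun h' => h1 (h'.trans h2.symm)
          have : ¬ c.loser n = i := fun h' => this h'.symm
          simp [*]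
      · simp [h2, h1, h1']
  simp only [mulVec, dotProduct, e, Finset.sum_add_distrib, Finset.sum_ite_eq', Finset.mem_univ,
    if_true]
  by_cases h1 : i = c.winner n
  · have : ¬ i = c.loser n := fun h' => h (h1.symm.trans h')
    simp [h1, h]
  · by_cases h2 : i = c.loser n <;> simp [h1, h2, h.symm]

/-- Slope vector zero is the case of standard interval exchanges; this yields uniform positivity of
the transposed cocycle from that of the `T̃_n`. -/
lemma partitionMatrix_zero (c : CombSeq A) (n : ℕ) (h : c.winner n ≠ c.loser n) :
    c.partitionMatrix 0 n = (c.theta n)ᵀ := by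
  ext i j
  by_cases hij : i = j
  · subst hij
    have : ¬ (c.loser n = i ∧ c.winner n = i) := fun h' => h (h'.2.trans h'.1.symm)
    by_cases h2 : i = c.loser n <;>
      simp [partitionMatrix, theta, this, h2, h]
  · have hji : ¬ j = i := fun h' => hij h'.symm
    by_cases h2 : i = c.winner n ∧ j = c.loser n
    · simp [partitionMatrix, theta, h2, h, h.symm]
    · have h3 : ¬ (c.loser n = j ∧ c.winner n = i) := fun h' => h2 ⟨h'.2.symm, h'.1.symm⟩
      simp [partitionMatrix, theta, h2, hij, h3, hji]

/-- The operators `T̃_n` are uniformly positive when the slope vectors `ωⁿ` are bounded. -/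
lemma exists_uniformlyPositive [Nontrivial A] (hc : c.Admissible) (hk : c.IsBounded k)
    {ω : A → ℝ} {B : ℝ} (hB : ∀ n α, |(c.thetaProd 0 n *ᵥ ω) α| ≤ B) :
    ∃ N m M, 0 < N ∧ UniformlyPositive (c.partitionMatrix ω) N m M := by
  have hwl := fun n => winner_ne_loser hc hk n
  obtain ⟨α₀⟩ := ‹Nonempty A›
  have hB0 : 0 ≤ B := (abs_nonneg _).trans (hB 0 α₀)
  have hε : ∀ n, ((c.ε n : ℕ) : ℝ) = 0 ∨ ((c.ε n : ℕ) : ℝ) = 1 := fun n => by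
    rcases fin_two_cases (c.ε n) with h | h <;> simp [h]
  have h1 : Real.exp (-B) ≤ 1 := Real.exp_le_one_iff.2 (by linarith)
  have h1' : 1 ≤ Real.exp B := Real.one_le_exp hB0
  have e1 : ∀ n, Real.exp (-B) ≤ Real.exp (((c.ε n : ℕ) : ℝ) *
      (c.thetaProd 0 n).mulVec ω ((c.π n).last 1)) ∧ Real.exp (((c.ε n : ℕ) : ℝ) *
      (c.thetaProd 0 n).mulVec ω ((c.π n).last 1)) ≤ Real.exp B := fun n => by
    have := abs_le.1 (hB n ((c.π n).last 1))
    rw [Real.exp_le_exp, Real.exp_le_exp]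
    rcases hε n with h | h <;> rw [h] <;> constructor <;> linarith
  have e2 : ∀ n, Real.exp (-B) ≤ Real.exp ((1 - ((c.ε n : ℕ) : ℝ)) *
      (c.thetaProd 0 n).mulVec ω ((c.π n).last 1)) ∧ Real.exp ((1 - ((c.ε n : ℕ) : ℝ)) *
      (c.thetaProd 0 n).mulVec ω ((c.π n).last 1)) ≤ Real.exp B := fun n => by
    have := abs_le.1 (hB n ((c.π n).last 1))
    rw [Real.exp_le_exp, Real.exp_le_exp]
    rcases hε n with h | h <;> rw [h] <;> constructor <;> linarith
  have hk0 : 0 < 2 * k := by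
    obtain ⟨β, hβ⟩ := exists_ne α₀
    obtain ⟨i, hi, -⟩ := exists_winner_loser hc hk 0 hβ
    omega
  refine ⟨2 * k, _, _, hk0, UniformlyPositive.of_window (δ := Real.exp (-B))
    (R := ∑ _ : A, Real.exp B) (Real.exp_pos _) c.winner c.loser ?_ ?_ ?_ ?_
    fun n i j hij => exists_winner_loser hc hk n hij⟩
  · intro n i j
    simp only [partitionMatrix, of_apply]
    split_ifs <;> positivity
  · intro n i
    simp only [partitionMatrix, of_apply]
    split_ifs <;> first | exact h1 | exact (e1 n).1
  · intro n
    have := hwl n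
    simp only [partitionMatrix, of_apply, this, false_and, if_false, true_and, if_true]
    exact (e2 n).1
  · intro n i
    refine Finset.sum_le_sum fun j _ => ?_
    simp only [partitionMatrix, of_apply]
    split_ifs
    · exact h1'
    · exact (e1 n).2
    · exact (e2 n).2
    · positivity

lemma exists_uniformlyPositive_transpose_theta [Nontrivial A] (hc : c.Admissible)
    (hk : c.IsBounded k) :
    ∃ N m M, UniformlyPositive (fun n => (c.theta n)ᵀ) N m M := by
  obtain ⟨N, m, M, -, h⟩ := exists_uniformlyPositive hc hk (ω := 0) (B := 0) (by simp)
  refine ⟨N, m, M, ?_⟩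
  convert h using 2 with n
  exact (partitionMatrix_zero c n (winner_ne_loser hc hk n)).symm

end CombSeq

/-! ### The matrices `Ω_π` -/

/-- `Ω` in terms of the two orders of the letters. -/
noncomputable def crossing (r s : A → ℕ) (α β : A) : ℝ :=
  if s β < s α ∧ r α < r β then 1 else if s α < s β ∧ r β < r α then -1 else 0

lemma Omega_apply (π : CombData A) (α β : A) :
    Omega π α β = crossing (fun α => (π.row 0 α : ℕ)) (fun α => (π.row 1 α : ℕ)) α β := by
  simp only [Omega, of_apply, crossing, Fin.lt_def]

/-- Reduces type 1 to type 0 by exchanging the rows. -/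
lemma crossing_swap (r s : A → ℕ) (α β : A) : crossing s r α β = -crossing r s α β := by
  unfold crossing
  split_ifs <;> first | omega | simp

/-- Only pairs containing `l` can change. As `w` is last for `r`, and `l` goes from the last place
of `s` to the place just after `w`, the new crossings of `l` are the old ones plus those of `w`. For
`α = β = l` the two corrections cancel. -/
lemma crossing_move {r s s' : A → ℕ} {w l : A} (hwl : w ≠ l)
    (hri : Function.Injective r)
    (hr : ∀ α, α ≠ w → r α < r w) (hs : ∀ α, α ≠ l → s α < s l)
    (hinj : ∀ α, α ≠ w → s α ≠ s w)
    (hs' : ∀ α, s' α = if s α ≤ s w then s α else if α = l then s w + 1 else s α + 1) (α β : A) :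
    crossing r s' α β = crossing r s α β + (if α = l then crossing r s w β else 0) +
      (if β = l then crossing r s α w else 0) := by
  have hsl := hs w hwl
  have hrl := hr l hwl.symm
  have h1 : s' l = s w + 1 := by rw [hs' l, if_neg (by omega), if_pos rfl]
  have h2 : ∀ α, α ≠ l → s' α = if s α ≤ s w then s α else s α + 1 := fun α h => by
    rw [hs' α, if_neg h]
  by_cases hα : α = l
  · by_cases hβ : β = l
    · subst hα hβ
      have := crossing_swap r s w β
      unfold crossing at this ⊢
      simp only [if_true]
      split_ifs at this ⊢ <;> first | omega | norm_num
    · subst hα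
      have a1 := hs β hβ
      by_cases hβw : β = w
      · subst hβw
        simp only [crossing, h1, h2 β hβ, if_neg hβ]
        split_ifs <;> first | omega | norm_num
      · have a2 := hr β hβw
        have a3 := hinj β hβw
        have a4 := hri.ne hβ
        simp only [crossing, h1, h2 β hβ, if_neg hβ]
        split_ifs <;> first | omega | norm_num
  · have a0 := hs α hα
    by_cases hβ : β = l
    · subst hβ
      by_cases hαw : α = w
      · subst hαw
        simp only [crossing, h1, h2 α hα, if_neg hα]
        split_ifs <;> first | omega | norm_num
      · have a2 := hr α hαw
        have a3 := hinj α hαw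
        have a4 := hri.ne hα
        simp only [crossing, h1, h2 α hα, if_neg hα]
        split_ifs <;> first | omega | norm_num
    · simp only [crossing, h2 α hα, h2 β hβ, if_neg hα, if_neg hβ]
      split_ifs <;> first | omega | norm_num

namespace CombSeq

variable {c : CombSeq A}

/-- Invariance of the antisymmetric form. The product differs from `crossing_move` only by a term in
the entry (loser, loser), namely `Ω` at (winner, winner), which is zero. -/
lemma theta_mul_Omega (hc : c.Admissible) {n : ℕ} (h : c.winner n ≠ c.loser n) :
    c.theta n * Omega (c.π n) * (c.theta n)ᵀ = Omega (c.π (n + 1)) := by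
  have key : ∀ α β, Omega (c.π (n + 1)) α β = Omega (c.π n) α β +
      (if α = c.loser n then Omega (c.π n) (c.winner n) β else 0) +
      (if β = c.loser n then Omega (c.π n) α (c.winner n) else 0) := by
    intro α β
    have hm := hc n
    have hr : ∀ δ, ∀ α, α ≠ (c.π n).last δ →
        ((c.π n).row δ α : ℕ) < (c.π n).row δ ((c.π n).last δ) := fun δ α hα =>
      CombData.row_lt_last hα
    have hinj : ∀ δ, ∀ α, α ≠ c.winner n →
        ((c.π n).row δ α : ℕ) ≠ (c.π n).row δ (c.winner n) := fun δ α hα h' =>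
      hα (((c.π n).row δ).injective (Fin.ext h'))
    have hmv := crossing_move (r := fun α => ((c.π n).row (c.ε n) α : ℕ))
      (s := fun α => ((c.π n).row (1 - c.ε n) α : ℕ))
      (s' := fun α => ((c.π (n + 1)).row (1 - c.ε n) α : ℕ)) h
      (Fin.val_injective.comp ((c.π n).row (c.ε n)).injective) (hr _) (hr _) (hinj _)
      (fun α => by have := hm.2 α; simp only [Fin.le_def] at this; exact this) α β
    have h1 := hm.1
    rcases fin_two_cases (c.ε n) with hε | hε
    · simp only [hε, sub_zero] at h1 hmv
      simp only [Omega_apply, h1]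
      exact hmv
    · simp only [hε, sub_self] at h1 hmv
      simp only [crossing_swap (fun α => (((c.π _).row 0 α : Fin _) : ℕ))] at hmv
      simp only [Omega_apply, h1]
      split_ifs at hmv ⊢ <;> linarith
  ext α β
  have e1 : ∀ (S : Matrix A A ℝ) α β, (c.theta n * S) α β =
      S α β + if α = c.loser n then S (c.winner n) β else 0 := by
    intro S α β
    have := theta_mulVec c n (fun γ => S γ β) α
    simpa [Matrix.mul_apply, mulVec, dotProduct] using this
  have e2 : ∀ (S : Matrix A A ℝ) α β, (S * (c.theta n)ᵀ) α β =
      S α β + if β = c.loser n then S α (c.winner n) else 0 := by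
    intro S α β
    have := e1 Sᵀ β α
    rw [← transpose_apply (S * (c.theta n)ᵀ), transpose_mul, transpose_transpose, this]
    rfl
  have hww : Omega (c.π n) (c.winner n) (c.winner n) = 0 := by
    simp [Omega_apply, crossing]
  rw [e2, e1, e1, key]
  split_ifs <;> simp [hww]

lemma thetaProd_mul_Omega (hc : c.Admissible) (h : ∀ n, c.winner n ≠ c.loser n) (j n : ℕ) :
    c.thetaProd j n * Omega (c.π j) * (c.thetaProd j n)ᵀ = Omega (c.π (j + n)) := by
  induction n with
  | zero => simp [thetaProd]
  | succ n ih =>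
    rw [thetaProd, transpose_mul, ← add_assoc, ← theta_mul_Omega hc (h (j + n)), ← ih]
    simp only [mul_assoc]

end CombSeq

lemma Omega_transpose (π : CombData A) : (Omega π)ᵀ = -Omega π := by
  ext α β
  simp only [transpose_apply, Matrix.neg_apply, Omega_apply, crossing]
  split_ifs <;> first | omega | simp

lemma dotProduct_Omega_self (π : CombData A) (x : A → ℝ) : x ⬝ᵥ (Omega π *ᵥ x) = 0 := by
  have h : x ⬝ᵥ (Omega π *ᵥ x) = -(x ⬝ᵥ (Omega π *ᵥ x)) := by
    conv_lhs => rw [dotProduct_mulVec, ← mulVec_transpose, Omega_transpose, neg_mulVec,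
      neg_dotProduct, dotProduct_comm]
  linarith

end Moves

/-! ### Combinatorial data of rotation type -/

/-- `π` is of rotation type: the two rows are words `XYZ` and `ZYX`, where `X` occupies the
positions `< a`, `Y` the positions in `[a, b)` and `Z` the positions `≥ b` of the first row. -/
structure IsRotationType (π : CombData A) (a b : ℕ) : Prop where
  pos : 0 < a
  le : a ≤ b
  lt : b < Fintype.card A
  row_one : ∀ α, (π.row 1 α : ℕ) =
    if (π.row 0 α : ℕ) < a then (π.row 0 α : ℕ) + (Fintype.card A - a)
    else if (π.row 0 α : ℕ) < b then (π.row 0 α : ℕ) + Fintype.card A - a - b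
    else (π.row 0 α : ℕ) - b

/-- The value of `x` at the letter in position `i` of the first row. -/
noncomputable def valAt (π : CombData A) (x : A → ℝ) (i : ℕ) : ℝ :=
  if h : i < Fintype.card A then x ((π.row 0).symm ⟨i, h⟩) else 0

/-- The jump at the `i`-th marked point of a function on the positions. -/
noncomputable def jumpAt (d a b : ℕ) (X : ℕ → ℝ) (i : ℕ) : ℝ :=
  if a < b then
    if i = a then X a - X (a - 1) - X (d - 1)
    else if i = 0 ∨ i = b then X 0 + X b - X (b - 1)
    else X i - X (i - 1)
  else
    if i = 0 ∨ i = a then X 0 + X a - X (a - 1) - X (d - 1)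
    else X i - X (i - 1)

/-- The jump of `x` at the marked point to the left of the letter `α`. -/
noncomputable def jump (π : CombData A) (a b : ℕ) (x : A → ℝ) (α : A) : ℝ :=
  jumpAt (Fintype.card A) a b (valAt π x) (π.row 0 α)

lemma valAt_row (π : CombData A) (x : A → ℝ) (α : A) : valAt π x (π.row 0 α) = x α := by
  simp [valAt]

lemma exists_row_eq (π : CombData A) (ε : Fin 2) {i : ℕ} (hi : i < Fintype.card A) :
    ∃ α, (π.row ε α : ℕ) = i :=
  ⟨(π.row ε).symm ⟨i, hi⟩, by simp⟩

lemma CombData.eq_of_row_eq {π : CombData A} {ε : Fin 2} {α β : A}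
    (h : (π.row ε α : ℕ) = π.row ε β) : α = β :=
  (π.row ε).injective (Fin.ext h)

lemma jumpAt_sub (d a b : ℕ) (X Y : ℕ → ℝ) (i : ℕ) :
    jumpAt d a b (fun i => X i - Y i) i = jumpAt d a b X i - jumpAt d a b Y i := by
  unfold jumpAt
  split_ifs <;> ring

lemma jump_sub (π : CombData A) (a b : ℕ) (x y : A → ℝ) (α : A) :
    jump π a b (x - y) α = jump π a b x α - jump π a b y α := by
  unfold jump
  rw [← jumpAt_sub]
  congr 1
  funext i
  unfold valAt
  split_ifs <;> simp

/-- The loser is the last letter of `X`, at position `a - 1`, and the winner is at position `d - 1`.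
The loser passes from `X` to `Y`; if it was all of `X`, the new pair of words exchanges the two
blocks `XY` and `Z`, encoded by `a' = b' = b`. -/
lemma jumpAt_type_zero {d a b a' b' : ℕ} (ha : 0 < a) (hab : a ≤ b) (hb : b < d) {X X' : ℕ → ℝ}
    (ha' : a' = if 2 ≤ a then a - 1 else b) (hb' : b' = b)
    (hX : ∀ i < d, X' i = X i + if i = a - 1 then X (d - 1) else 0) {i : ℕ} (hi : i < d) :
    jumpAt d a' b' X' i = jumpAt d a b X i := by
  subst hb'
  have hne : ∀ i < d, i ≠ a - 1 → X' i = X i := fun i hi h => by rw [hX i hi, if_neg h, add_zero]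
  have heq : X' (a - 1) = X (a - 1) + X (d - 1) := by rw [hX _ (by omega), if_pos rfl]
  clear hX
  have hd := hne (d - 1) (by omega) (by omega)
  unfold jumpAt
  by_cases h2 : 2 ≤ a
  · rw [if_pos h2] at ha'
    subst ha'
    have h0 := hne 0 (by omega) (by omega)
    have hb1 := hne b' (by omega) (by omega)
    have ha1 := hne a (by omega) (by omega)
    have ha2 := hne (a - 1 - 1) (by omega) (by omega)
    rw [if_pos (show a - 1 < b' by omega)]
    by_cases hi1 : i = a - 1
    · subst hi1
      grind
    · have hi2 := hne i hi hi1
      by_cases hi3 : i = a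
      · subst hi3
        by_cases hb2 : i < b'
        · grind
        · grind
      · have hi4 := hne (i - 1) (by omega) (by omega)
        by_cases hb2 : a < b'
        · have hb3 := hne (b' - 1) (by omega) (by omega)
          grind
        · grind
  · rw [if_neg h2] at ha'
    obtain rfl : a = 1 := by omega
    subst ha'
    have h0 : X' 0 = X 0 + X (d - 1) := heq
    have hb1 := hne a' (by omega) (by omega)
    rw [if_neg (lt_irrefl a')]
    by_cases hb2 : 1 < a'
    · have hb3 := hne (a' - 1) (by omega) (by omega)
      have h1 := hne 1 (by omega) (by omega)
      rw [if_pos hb2]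
      by_cases hi0 : i = 0
      · grind
      · have hi1 := hne i hi (by omega)
        by_cases hi2 : i = 1
        · grind
        · have hi3 := hne (i - 1) (by omega) (by omega)
          grind
    · obtain rfl : a' = 1 := by omega
      rw [if_neg hb2]
      by_cases hi0 : i = 0 ∨ i = 1
      · grind
      · have hi1 := hne i hi (by omega)
        have hi3 := hne (i - 1) (by omega) (by omega)
        grind

/-- Here the first row changes: the loser leaves the end of `Z` for position `a`, at the head of
`Y`. If it was all of `Z`, two blocks `X` and `ZY` remain, with `a' = b' = a`. The index on the left
is the new position of the letter formerly at `i`. -/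
lemma jumpAt_type_one {d a b a' b' : ℕ} (ha : 0 < a) (hab : a ≤ b) (hb : b < d) {X X' : ℕ → ℝ}
    (ha' : a' = a) (hb' : b' = if b + 1 < d then b + 1 else a)
    (hX : ∀ i < d, X' i = if i < a then X i else if i = a then X (d - 1) + X (a - 1)
      else X (i - 1)) {i : ℕ} (hi : i < d) :
    jumpAt d a' b' X' (if i < a then i else if i = d - 1 then a else i + 1) =
      jumpAt d a b X i := by
  subst ha'
  have hlt : ∀ i < d, i < a' → X' i = X i := fun i hi h => by rw [hX i hi, if_pos h]
  have heq : X' a' = X (d - 1) + X (a' - 1) := by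
    rw [hX _ (by omega), if_neg (lt_irrefl _), if_pos rfl]
  have hgt : ∀ i, i + 1 < d → a' < i + 1 → X' (i + 1) = X i := fun i hi h => by
    rw [hX _ hi, if_neg (by omega), if_neg (by omega), Nat.add_sub_cancel]
  clear hX
  have h0 := hlt 0 (by omega) ha
  have ha1 := hlt (a' - 1) (by omega) (by omega)
  have hd : a' < d - 1 → X' (d - 1) = X (d - 1 - 1) := fun h => by
    have := hgt (d - 1 - 1) (by omega) (by omega)
    rwa [show d - 1 - 1 + 1 = d - 1 by omega] at this
  unfold jumpAt
  by_cases hbd : b + 1 < d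
  · rw [if_pos hbd] at hb'
    subst hb'
    rw [if_pos (show a' < b + 1 by omega)]
    have hb1 := hgt b hbd (by omega)
    have hd' := hd (by omega)
    have hbb : a' < b → X' b = X (b - 1) := fun h => by
      have := hgt (b - 1) (by omega) (by omega)
      rwa [show b - 1 + 1 = b by omega] at this
    by_cases hi1 : i < a'
    · simp only [if_pos hi1]
      have hi2 := hlt i hi hi1
      have hi3 := hlt (i - 1) (by omega) (by omega)
      by_cases hb2 : a' < b
      · have := hbb hb2
        grind
      · obtain rfl : a' = b := by omega
        grind
    · simp only [if_neg hi1]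
      by_cases hi2 : i = d - 1
      · subst hi2
        simp only [if_true]
        grind
      · simp only [if_neg hi2]
        have hi3 := hgt i (by omega) (by omega)
        rw [Nat.add_sub_cancel]
        by_cases hi4 : i = a'
        · subst hi4
          by_cases hb2 : i < b
          · have := hbb hb2
            grind
          · obtain rfl : i = b := by omega
            grind
        · have hi5 := hgt (i - 1) (by omega) (by omega)
          rw [show i - 1 + 1 = i by omega] at hi5
          by_cases hb2 : a' < b
          · have := hbb hb2
            grind
          · obtain rfl : a' = b := by omega
            grind
  · rw [if_neg hbd] at hb'
    subst hb'
    obtain rfl : b = d - 1 := by omega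
    rw [if_neg (lt_irrefl b')]
    by_cases hb2 : b' < d - 1
    · have hd' := hd hb2
      rw [if_pos hb2]
      by_cases hi1 : i < b'
      · simp only [if_pos hi1]
        have hi2 := hlt i hi hi1
        have hi3 := hlt (i - 1) (by omega) (by omega)
        grind
      · simp only [if_neg hi1]
        by_cases hi2 : i = d - 1
        · subst hi2
          simp only [if_true]
          grind
        · simp only [if_neg hi2]
          have hi3 := hgt i (by omega) (by omega)
          rw [Nat.add_sub_cancel]
          by_cases hi4 : i = b'
          · subst hi4
            grind
          · have hi5 := hgt (i - 1) (by omega) (by omega)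
            rw [show i - 1 + 1 = i by omega] at hi5
            grind
    · obtain rfl : b' = d - 1 := by omega
      rw [if_neg hb2]
      by_cases hi1 : i < d - 1
      · simp only [if_pos hi1]
        have hi2 := hlt i hi hi1
        have hi3 := hlt (i - 1) (by omega) (by omega)
        grind
      · obtain rfl : i = d - 1 := by omega
        simp only [lt_irrefl, if_false, if_true]
        grind

/-! ### Rotation type is preserved by Rauzy moves, and so are the jumps -/

namespace IsRotationType

variable {π π' : CombData A} {a b a' b' : ℕ}

/-- The first and last letters of the first row sit at positions `d - a` and `d - 1 - b` of the
second. Uniqueness identifies parameters obtained from separate existence statements, and those one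
period apart. -/
lemma unique (h : IsRotationType π a b) (h' : IsRotationType π a' b') : a = a' ∧ b = b' := by
  have h1 := h.lt
  have h2 := h.le
  have h3 := h.pos
  have h1' := h'.lt
  have h2' := h'.le
  have h3' := h'.pos
  obtain ⟨α, hα⟩ := exists_row_eq π 0 (show 0 < Fintype.card A by omega)
  obtain ⟨β, hβ⟩ := exists_row_eq π 0 (show Fintype.card A - 1 < Fintype.card A by omega)
  have e1 := h.row_one α
  have e2 := h.row_one β
  have e1' := h'.row_one α
  have e2' := h'.row_one β
  rw [hα] at e1 e1'
  rw [hβ] at e2 e2'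
  split_ifs at e1 e1' e2 e2' <;> omega

variable [Nonempty A]

lemma row_zero_last_one (h : IsRotationType π a b) : (π.row 0 (π.last 1) : ℕ) = a - 1 := by
  have h1 := h.lt
  have h2 := h.le
  have h3 := h.pos
  have e := h.row_one (π.last 1)
  have := (π.row 0 (π.last 1)).2
  rw [π.row_last] at e
  split_ifs at e <;> omega

lemma row_one_last_zero (h : IsRotationType π a b) :
    (π.row 1 (π.last 0) : ℕ) = Fintype.card A - 1 - b := by
  have h1 := h.lt
  have h2 := h.le
  have e := h.row_one (π.last 0)
  rw [π.row_last] at e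
  split_ifs at e <;> omega

lemma exists_move_zero (h : IsRotationType π a b) (hm : IsRauzyMove π 0 π') :
    ∃ a' b', IsRotationType π' a' b' ∧ ∀ x x' : A → ℝ,
      (∀ α, x' α = x α + if α = π.last 1 then x (π.last 0) else 0) →
      ∀ α, jump π' a' b' x' α = jump π a b x α := by
  have h1 := h.lt
  have h2 := h.le
  have h3 := h.pos
  have hl := h.row_zero_last_one
  have hw := h.row_one_last_zero
  refine ⟨if 2 ≤ a then a - 1 else b, b, ⟨by split_ifs <;> omega, by split_ifs <;> omega, h1,
    fun α => ?_⟩, fun x x' hx α => ?_⟩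
  · have e := h.row_one α
    have e' := hm.2 α
    simp only [sub_zero, Fin.le_def, hw] at e'
    rw [hm.1, e', e]
    have hα := (π.row 0 α).2
    have hα' : α = π.last 1 ↔ (π.row 0 α : ℕ) = a - 1 :=
      ⟨fun h' => by rw [h', hl], fun h' => CombData.eq_of_row_eq (h'.trans hl.symm)⟩
    simp only [hα']
    split_ifs <;> omega
  · unfold jump
    rw [show π'.row 0 α = π.row 0 α by rw [hm.1]]
    refine jumpAt_type_zero h3 h2 h1 rfl rfl (fun i hi => ?_) (π.row 0 α).2
    obtain ⟨β, rfl⟩ := exists_row_eq π 0 hi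
    have e1 : valAt π' x' (π.row 0 β) = x' β := by
      rw [show π.row 0 β = π'.row 0 β by rw [hm.1], valAt_row]
    have e2 : valAt π x (Fintype.card A - 1) = x (π.last 0) := by
      rw [← π.row_last 0, valAt_row]
    have hβ : β = π.last 1 ↔ (π.row 0 β : ℕ) = a - 1 :=
      ⟨fun h' => by rw [h', hl], fun h' => CombData.eq_of_row_eq (h'.trans hl.symm)⟩
    rw [e1, e2, valAt_row, hx β]
    simp only [hβ]

lemma exists_move_one (h : IsRotationType π a b) (hm : IsRauzyMove π 1 π') :
    ∃ a' b', IsRotationType π' a' b' ∧ ∀ x x' : A → ℝ,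
      (∀ α, x' α = x α + if α = π.last 0 then x (π.last 1) else 0) →
      ∀ α, jump π' a' b' x' α = jump π a b x α := by
  have h1 := h.lt
  have h2 := h.le
  have h3 := h.pos
  have hl := h.row_zero_last_one
  have hw := h.row_one_last_zero
  have hlast : ∀ α, α = π.last 0 ↔ (π.row 0 α : ℕ) = Fintype.card A - 1 := fun α =>
    ⟨fun h' => by rw [h', π.row_last], fun h' => CombData.eq_last h'⟩
  have hrow : ∀ α, (π'.row 0 α : ℕ) = if (π.row 0 α : ℕ) < a then (π.row 0 α : ℕ)
      else if (π.row 0 α : ℕ) = Fintype.card A - 1 then a else (π.row 0 α : ℕ) + 1 := by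
    intro α
    have e' := hm.2 α
    simp only [sub_self, Fin.le_def, hl, hlast] at e'
    rw [e']
    split_ifs <;> omega
  refine ⟨a, if b + 1 < Fintype.card A then b + 1 else a, ⟨h3, by split_ifs <;> omega,
    by split_ifs <;> omega, fun α => ?_⟩, fun x x' hx α => ?_⟩
  · have e := h.row_one α
    rw [hm.1, e, hrow]
    have hα := (π.row 0 α).2
    split_ifs <;> omega
  · unfold jump
    rw [hrow]
    refine jumpAt_type_one h3 h2 h1 rfl rfl (fun i hi => ?_) (π.row 0 α).2
    obtain ⟨β, rfl⟩ := exists_row_eq π' 0 hi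
    have e2 : valAt π x (Fintype.card A - 1) = x (π.last 0) := by
      rw [← π.row_last 0, valAt_row]
    have e3 : valAt π x (a - 1) = x (π.last 1) := by rw [← hl, valAt_row]
    have e4 : valAt π x (π.row 0 β) = x β := valAt_row _ _ _
    rw [valAt_row, hx β, e2, e3]
    simp only [hlast]
    have hβ := hrow β
    have hβ2 := (π.row 0 β).2
    by_cases c1 : (π.row 0 β : ℕ) < a
    · rw [if_pos c1] at hβ
      rw [hβ, if_neg (by omega), if_pos c1, e4, add_zero]
    · by_cases c2 : (π.row 0 β : ℕ) = Fintype.card A - 1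
      · rw [if_neg c1, if_pos c2] at hβ
        rw [hβ, if_pos c2, if_neg (lt_irrefl _), if_pos rfl, (hlast β).2 c2]
      · rw [if_neg c1, if_neg c2] at hβ
        rw [hβ, if_neg c2, if_neg (by omega), if_neg (by omega), Nat.add_sub_cancel, e4, add_zero]

lemma exists_move (h : IsRotationType π a b) {ε : Fin 2} (hm : IsRauzyMove π ε π') :
    ∃ a' b', IsRotationType π' a' b' ∧ ∀ x x' : A → ℝ,
      (∀ α, x' α = x α + if α = π.last (1 - ε) then x (π.last ε) else 0) →
      ∀ α, jump π' a' b' x' α = jump π a b x α := by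
  rcases fin_two_cases ε with rfl | rfl
  · exact h.exists_move_zero hm
  · exact h.exists_move_one hm

end IsRotationType

/-! ### The image of `Ω` for combinatorial data of rotation type -/

/-- The vector with value `s` on `X`, `s + t` on `Y` and `t` on `Z`. -/
noncomputable def planeVec (π : CombData A) (a b : ℕ) (s t : ℝ) : A → ℝ := fun α =>
  (if (π.row 0 α : ℕ) < b then s else 0) + (if a ≤ (π.row 0 α : ℕ) then t else 0)

namespace IsRotationType

variable {π : CombData A} {a b : ℕ}

lemma jump_planeVec (h : IsRotationType π a b) (s t : ℝ) (α : A) :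
    jump π a b (planeVec π a b s t) α = 0 := by
  have h1 := h.lt
  have h2 := h.le
  have h3 := h.pos
  have hv : ∀ i < Fintype.card A, valAt π (planeVec π a b s t) i =
      (if i < b then s else 0) + (if a ≤ i then t else 0) := fun i hi => by
    obtain ⟨β, rfl⟩ := exists_row_eq π 0 hi
    rw [valAt_row, planeVec]
  have hα := (π.row 0 α).2
  unfold jump jumpAt
  generalize (π.row 0 α : ℕ) = i at *
  rw [hv 0 (by omega), hv a (by omega), hv (a - 1) (by omega), hv b (by omega),
    hv (b - 1) (by omega), hv (Fintype.card A - 1) (by omega), hv i hα, hv (i - 1) (by omega)]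
  rw [if_neg (show ¬ a ≤ a - 1 by omega), if_pos (show a - 1 < b by omega),
    if_neg (show ¬ Fintype.card A - 1 < b by omega), if_pos (show a ≤ Fintype.card A - 1 by omega),
    if_pos (show 0 < b by omega), if_neg (show ¬ a ≤ 0 by omega), if_neg (show ¬ b < b by omega),
    if_pos h2, if_pos le_rfl, if_pos (show b - 1 < b by omega)]
  split_ifs <;> first | omega | ring

/-- In rotation type `Ω_{αβ} = 1_{XY}(α) 1_{YZ}(β) - 1_{YZ}(α) 1_{XY}(β)`, a matrix of rank two. -/
lemma Omega_mulVec (h : IsRotationType π a b) (x : A → ℝ) :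
    Omega π *ᵥ x = planeVec π a b (∑ β, if a ≤ (π.row 0 β : ℕ) then x β else 0)
      (-∑ β, if (π.row 0 β : ℕ) < b then x β else 0) := by
  have h1 := h.lt
  have h2 := h.le
  have h3 := h.pos
  funext α
  have e : ∀ β, Omega π α β * x β =
      (if (π.row 0 α : ℕ) < b then (if a ≤ (π.row 0 β : ℕ) then x β else 0) else 0) -
      (if a ≤ (π.row 0 α : ℕ) then (if (π.row 0 β : ℕ) < b then x β else 0) else 0) := by
    intro β
    have : Nonempty A := ⟨α⟩
    rw [Omega_apply, crossing, h.row_one α, h.row_one β]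
    have hα := (π.row 0 α).2
    have hβ := (π.row 0 β).2
    split_ifs <;> first | omega | ring
  simp only [mulVec, dotProduct, e, Finset.sum_sub_distrib, planeVec]
  split_ifs <;> (try simp only [Finset.sum_const_zero]) <;> ring1

/-- If all jumps of `x` are at most `B`, then `x` is close to the image of `Ω`. -/
lemma exists_planeVec (h : IsRotationType π a b) {x : A → ℝ} {B : ℝ}
    (hB : ∀ α, |jump π a b x α| ≤ B) :
    ∃ s t, ∀ α, |x α - planeVec π a b s t α| ≤ Fintype.card A * B := by
  have h1 := h.lt
  have h2 := h.le
  have h3 := h.pos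
  set d := Fintype.card A
  set X := valAt π x with hX
  have hJ : ∀ i < d, |jumpAt d a b X i| ≤ B := fun i hi => by
    obtain ⟨β, rfl⟩ := exists_row_eq π 0 hi
    exact hB β
  have hB0 : 0 ≤ B := (abs_nonneg _).trans (hJ 0 (by omega))
  -- Summing jumps from the left end up to `b`; the jump at `a` brings in the value at the last
  -- letter. Then `c2` sums from the right end down to `b`, so the jump shared by positions `0` and
  -- `b` is not needed.
  have c1 : ∀ i < b, |X i - (X 0 + if a ≤ i then X (d - 1) else 0)| ≤ i * B := by
    intro i
    induction i with
    | zero => intro _; simp [h3.ne']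
    | succ i ih =>
      intro hi
      have h5 := ih (by omega)
      have h4 := hJ (i + 1) (by omega)
      unfold jumpAt at h4
      rw [Nat.add_sub_cancel] at h4
      push_cast
      by_cases hab : a < b
      · rw [if_pos hab] at h4
        by_cases hia : i + 1 = a
        · subst hia
          rw [if_pos rfl, Nat.add_sub_cancel] at h4
          rw [if_neg (by omega)] at h5
          rw [if_pos le_rfl]
          rw [abs_le] at h4 h5 ⊢
          constructor <;> linarith
        · rw [if_neg hia, if_neg (by omega)] at h4
          have : (if a ≤ i + 1 then X (d - 1) else 0) = if a ≤ i then X (d - 1) else 0 := by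
            split_ifs <;> first | rfl | omega
          rw [this]
          rw [abs_le] at h4 h5 ⊢
          constructor <;> linarith
      · rw [if_neg hab, if_neg (by omega)] at h4
        rw [if_neg (by omega)] at h5 ⊢
        rw [abs_le] at h4 h5 ⊢
        constructor <;> linarith
  have c2 : ∀ j, b + j ≤ d - 1 → |X (d - 1 - j) - X (d - 1)| ≤ j * B := by
    intro j
    induction j with
    | zero => simp
    | succ j ih =>
      intro hj
      have h5 := ih (by omega)
      have h4 := hJ (d - 1 - j) (by omega)
      unfold jumpAt at h4
      rw [show d - 1 - j - 1 = d - 1 - (j + 1) by omega] at h4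
      have h6 : |X (d - 1 - j) - X (d - 1 - (j + 1))| ≤ B := by
        split_ifs at h4 <;> first | exact h4 | omega
      push_cast
      rw [abs_le] at h5 h6 ⊢
      constructor <;> linarith
  refine ⟨X 0, X (d - 1), fun α => ?_⟩
  have hα := (π.row 0 α).2
  rw [← valAt_row π x α, planeVec]
  generalize (π.row 0 α : ℕ) = i at *
  by_cases hi : i < b
  · have := c1 i hi
    rw [if_pos hi]
    have h6 : (i : ℝ) ≤ d := by exact_mod_cast hα.le
    exact this.trans (mul_le_mul_of_nonneg_right h6 hB0)
  · have := c2 (d - 1 - i) (by omega)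
    rw [show d - 1 - (d - 1 - i) = i by omega] at this
    rw [if_neg hi, if_pos (by omega), zero_add]
    have h6 : ((d - 1 - i : ℕ) : ℝ) ≤ d := by
      exact_mod_cast (by omega : d - 1 - i ≤ d)
    exact this.trans (mul_le_mul_of_nonneg_right h6 hB0)

/-- The functional `λ` on the plane `Im Ω`. -/
lemma dotProduct_planeVec (x : A → ℝ) (s t : ℝ) : x ⬝ᵥ planeVec π a b s t =
    s * (∑ β, if (π.row 0 β : ℕ) < b then x β else 0) +
      t * ∑ β, if a ≤ (π.row 0 β : ℕ) then x β else 0 := by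
  simp only [dotProduct, planeVec, Finset.mul_sum, ← Finset.sum_add_distrib]
  refine Finset.sum_congr rfl fun β _ => ?_
  split_ifs <;> ring

lemma sum_ge_pos (h : IsRotationType π a b) {x : A → ℝ} {m : ℝ} (hx : ∀ α, 0 < x α)
    (hm : ∀ α, m ≤ x α) : m ≤ ∑ β, if a ≤ (π.row 0 β : ℕ) then x β else 0 := by
  have h1 := h.lt
  have h2 := h.le
  obtain ⟨α, hα⟩ := exists_row_eq π 0 (show Fintype.card A - 1 < Fintype.card A by omega)
  refine (hm α).trans ?_
  have := Finset.single_le_sum (f := fun β => if a ≤ (π.row 0 β : ℕ) then x β else 0)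
    (fun β _ => by split_ifs; exacts [(hx β).le, le_rfl]) (Finset.mem_univ α)
  simpa [hα, show a ≤ Fintype.card A - 1 by omega] using this

lemma mem_range_Omega (h : IsRotationType π a b) (s t : ℝ) :
    planeVec π a b s t ∈ range (Omega π).mulVec := by
  have h1 := h.lt
  have h2 := h.le
  have h3 := h.pos
  obtain ⟨α, hα⟩ := exists_row_eq π 0 (show 0 < Fintype.card A by omega)
  obtain ⟨β, hβ⟩ := exists_row_eq π 0 (show Fintype.card A - 1 < Fintype.card A by omega)
  have hαβ : α ≠ β := fun h' => by rw [h', hβ] at hα; omega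
  -- The first letter lies in `X` and the last in `Z`, so the sums over `YZ` and over `XY` can be
  -- prescribed independently.
  refine ⟨Pi.single α (-t) + Pi.single β s, ?_⟩
  rw [h.Omega_mulVec]
  have e1 : (∑ γ, if a ≤ (π.row 0 γ : ℕ) then
      (Pi.single α (-t) + Pi.single β s : A → ℝ) γ else 0) = s := by
    rw [Finset.sum_eq_single β]
    · rw [if_pos (by omega)]; simp [hαβ.symm]
    · intro γ _ hγ
      by_cases hγα : γ = α
      · rw [hγα, hα, if_neg (by omega)]
      · simp [hγ, hγα]
    · simp
  have e2 : (∑ γ, if (π.row 0 γ : ℕ) < b then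
      (Pi.single α (-t) + Pi.single β s : A → ℝ) γ else 0) = -t := by
    rw [Finset.sum_eq_single α]
    · rw [if_pos (by omega)]; simp [hαβ]
    · intro γ _ hγ
      by_cases hγβ : γ = β
      · rw [hγβ, hβ, if_neg (by omega)]
      · simp [hγ, hγβ]
    · simp
  rw [e1, e2, neg_neg]

/-- The image of `Ω` is the set of vectors without jumps. -/
lemma mem_range_Omega_iff (h : IsRotationType π a b) (x : A → ℝ) :
    x ∈ range (Omega π).mulVec ↔ ∀ α, jump π a b x α = 0 := by
  constructor
  · rintro ⟨y, rfl⟩ α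
    rw [h.Omega_mulVec, h.jump_planeVec]
  · intro hx
    obtain ⟨s, t, hst⟩ := h.exists_planeVec (x := x) (B := 0) (fun α => by simp [hx])
    have : x = planeVec π a b s t := by
      funext α
      have := hst α
      rw [mul_zero] at this
      exact sub_eq_zero.1 (abs_nonpos_iff.1 this)
    rw [this]
    exact h.mem_range_Omega s t

/-- In rotation type, the vectors of `Im Ω` killed by a positive `λ` are multiples of `Ω λ`. -/
lemma exists_smul_of_dotProduct_eq_zero (h : IsRotationType π a b) {x y : A → ℝ}
    (hx : ∀ α, 0 < x α) (hy : y ∈ range (Omega π).mulVec) (hxy : x ⬝ᵥ y = 0) :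
    ∃ τ : ℝ, y = τ • (Omega π *ᵥ x) := by
  have : Nonempty A := Fintype.card_pos_iff.1 (by have := h.lt; omega)
  obtain ⟨z, rfl⟩ := hy
  rw [h.Omega_mulVec] at hxy ⊢
  rw [dotProduct_planeVec] at hxy
  rw [h.Omega_mulVec]
  obtain ⟨p, hp⟩ := Finite.exists_min x
  set q := ∑ β, if a ≤ (π.row 0 β : ℕ) then x β else 0
  set r := ∑ β, if (π.row 0 β : ℕ) < b then x β else 0
  set s := ∑ β, if a ≤ (π.row 0 β : ℕ) then z β else 0
  set t := -∑ β, if (π.row 0 β : ℕ) < b then z β else 0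
  have hq : 0 < q := lt_of_lt_of_le (hx p) (h.sum_ge_pos hx hp)
  refine ⟨s / q, funext fun α => ?_⟩
  have ht : t = -(s / q * r) := by field_simp; linarith
  simp only [planeVec, Pi.smul_apply, smul_eq_mul]
  rw [ht]
  have hs : s / q * q = s := div_mul_cancel₀ _ hq.ne'
  split_ifs <;> simp [mul_add, hs]

end IsRotationType

/-! ### Vectors killed by the limit of the positive cones -/

/-- Each `y i` is orthogonal to a vector of a deep cone, whose direction is within `ε` of that of `l
j`; so `y i` is orthogonal to `l j` up to `ε` times its norm. For the stable line `y` is constant,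
for the central spaces it runs over the periodic approximations. -/
lemma IsPositiveOrbit.dotProduct_eq_zero_of_tendsto {T : ℕ → Matrix A A ℝ} {N : ℕ} {m M : ℝ}
    (hT : UniformlyPositive T N m M) {l : ℕ → A → ℝ} (hl : IsPositiveOrbit T l) {j : ℕ}
    {y : ℕ → A → ℝ} {y' : A → ℝ} (hy : Tendsto y atTop (𝓝 y'))
    (h : ∀ n₀, ∀ᶠ i in atTop, ∃ n ≥ n₀, ∃ z : A → ℝ, (∀ α, 0 < z α) ∧
      (seqProd T j n *ᵥ z) ⬝ᵥ y i = 0) : l j ⬝ᵥ y' = 0 := by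
  cases isEmpty_or_nonempty A
  · simp [dotProduct]
  set w := normalize (l j) with hw
  have hS : Tendsto (fun i => ∑ α, |y i α|) atTop (𝓝 (∑ α, |y' α|)) :=
    tendsto_finsetSum _ fun α _ => ((tendsto_pi_nhds.1 hy) α).abs
  have hD : Tendsto (fun i => w ⬝ᵥ y i) atTop (𝓝 (w ⬝ᵥ y')) :=
    tendsto_finsetSum _ fun α _ => ((tendsto_pi_nhds.1 hy) α).const_mul (w α)
  have key : ∀ ε > 0, |w ⬝ᵥ y'| ≤ ε * ∑ α, |y' α| := by
    intro ε hε
    obtain ⟨n₀, hn₀⟩ := hT.exists_forall_abs_sub_lt j hε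
    refine le_of_tendsto_of_tendsto hD.abs (hS.const_mul ε) ?_
    filter_upwards [h n₀] with i hi
    obtain ⟨n, hn, z, hz, hz0⟩ := hi
    have h1 : normalize (seqProd T j n *ᵥ z) ⬝ᵥ y i = 0 := by
      rw [normalize, smul_dotProduct, hz0, smul_zero]
    have h2 : w ⬝ᵥ y i = (w - normalize (seqProd T j n *ᵥ z)) ⬝ᵥ y i := by
      rw [sub_dotProduct, h1, sub_zero]
    rw [h2, Finset.mul_sum]
    refine (Finset.abs_sum_le_sum_abs _ _).trans (Finset.sum_le_sum fun α _ => ?_)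
    rw [abs_mul]
    refine mul_le_mul_of_nonneg_right ?_ (abs_nonneg _)
    have := hn₀ n hn _ _ (hl.pos (j + n)) hz α
    rw [← hl.eq_seqProd] at this
    exact this.le
  have hw0 : w ⬝ᵥ y' = 0 := by
    by_contra hne
    have hS0 : 0 ≤ ∑ α, |y' α| := Finset.sum_nonneg fun α _ => abs_nonneg _
    have h1 := abs_pos.2 hne
    have h2 := key (|w ⬝ᵥ y'| / (2 * (∑ α, |y' α| + 1))) (by positivity)
    have h3 : |w ⬝ᵥ y'| / (2 * (∑ α, |y' α| + 1)) * ∑ α, |y' α| < |w ⬝ᵥ y'| := by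
      rw [div_mul_eq_mul_div, div_lt_iff₀ (by positivity)]
      nlinarith
    linarith
  rw [hw, normalize, smul_dotProduct, smul_eq_mul, mul_eq_zero] at hw0
  exact hw0.resolve_left (inv_pos.2 (sum_pos_of_pos (hl.pos j))).ne'

/-! ### The length functional and boundedness of the cocycle on its kernel -/

namespace CombSeq

variable [Nontrivial A] {c : CombSeq A} {k : ℕ}

/-- A positive orbit of the transposed cocycle: the length vectors of the standard interval
exchange maps with combinatorics `c`. -/
abbrev IsLengthOrbit (c : CombSeq A) (l : ℕ → A → ℝ) : Prop :=
  IsPositiveOrbit (fun n => (c.theta n)ᵀ) l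

lemma transpose_theta_mulVec_sum (c : CombSeq A) (n : ℕ) (z : A → ℝ) :
    ∑ α, ((c.theta n)ᵀ *ᵥ z) α = ∑ α, z α + z (c.loser n) := by
  have e : ∀ α, ((c.theta n)ᵀ *ᵥ z) α = z α + if α = c.winner n then z (c.loser n) else 0 := by
    intro α
    rw [theta, transpose_add, transpose_one, transpose_single, add_mulVec, one_mulVec,
      Pi.add_apply, single_mulVec]
    simp [Function.update_apply]
  simp only [e, Finset.sum_add_distrib, Finset.sum_ite_eq', Finset.mem_univ, if_true]

namespace IsLengthOrbit

variable {l : ℕ → A → ℝ}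

lemma eq_thetaProd (hl : c.IsLengthOrbit l) (j n : ℕ) :
    l j = (c.thetaProd j n)ᵀ *ᵥ l (j + n) := by
  rw [transpose_thetaProd]
  exact hl.eq_seqProd j n

lemma dotProduct_thetaProd (hl : c.IsLengthOrbit l) (j n : ℕ) (x : A → ℝ) :
    l (j + n) ⬝ᵥ (c.thetaProd j n *ᵥ x) = l j ⬝ᵥ x := by
  rw [IsLengthOrbit.eq_thetaProd hl j n, mulVec_transpose, dotProduct_mulVec]

/-- The vectors `Ω l_n` form an orbit of the cocycle which is at most of the size of `l_n`: this is
the contracted direction. -/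
lemma thetaProd_Omega (hl : c.IsLengthOrbit l) (hc : c.Admissible)
    (h : ∀ n, c.winner n ≠ c.loser n) (j n : ℕ) :
    c.thetaProd j n *ᵥ (Omega (c.π j) *ᵥ l j) = Omega (c.π (j + n)) *ᵥ l (j + n) := by
  rw [IsLengthOrbit.eq_thetaProd hl j n, mulVec_mulVec, mulVec_mulVec,
    thetaProd_mul_Omega hc h]

lemma sum_eq (hl : c.IsLengthOrbit l) (n : ℕ) :
    ∑ α, l n α = ∑ α, l (n + 1) α + l (n + 1) (c.loser n) := by
  rw [hl.eq n, transpose_theta_mulVec_sum]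

lemma sum_strictAnti (hl : c.IsLengthOrbit l) :
    StrictAnti fun n => ∑ α, l n α :=
  strictAnti_nat_of_succ_lt fun n => by
    rw [IsLengthOrbit.sum_eq hl n]
    have := hl.pos (n + 1) (c.loser n)
    linarith

end IsLengthOrbit

lemma exists_rotationType (hc : c.Admissible) {a₀ b₀ : ℕ}
    (h₀ : IsRotationType (c.π 0) a₀ b₀) :
    ∃ a b : ℕ → ℕ, (∀ n, IsRotationType (c.π n) (a n) (b n)) ∧
      ∀ n x α, jump (c.π (n + 1)) (a (n + 1)) (b (n + 1)) (c.theta n *ᵥ x) α =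
        jump (c.π n) (a n) (b n) x α := by
  have hex : ∀ n, ∃ a b, IsRotationType (c.π n) a b := by
    intro n
    induction n with
    | zero => exact ⟨_, _, h₀⟩
    | succ n ih =>
      obtain ⟨a, b, hab⟩ := ih
      obtain ⟨a', b', h', -⟩ := hab.exists_move (hc n)
      exact ⟨a', b', h'⟩
  choose a b hab using hex
  refine ⟨a, b, hab, fun n x α => ?_⟩
  obtain ⟨a', b', h', hj⟩ := (hab n).exists_move (hc n)
  obtain ⟨rfl, rfl⟩ := h'.unique (hab (n + 1))
  exact hj x _ (fun α => theta_mulVec c n x α) α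

lemma jump_thetaProd {a b : ℕ → ℕ}
    (hj : ∀ n x α, jump (c.π (n + 1)) (a (n + 1)) (b (n + 1)) (c.theta n *ᵥ x) α =
        jump (c.π n) (a n) (b n) x α) (j n : ℕ) (x : A → ℝ) (α : A) :
    jump (c.π (j + n)) (a (j + n)) (b (j + n)) (c.thetaProd j n *ᵥ x) α =
      jump (c.π j) (a j) (b j) x α := by
  induction n with
  | zero => simp [thetaProd]
  | succ n ih => rw [thetaProd, ← mulVec_mulVec, ← ih]; exact hj (j + n) _ α

/-- A Denjoy–Koksma inequality: in genus one, the cocycle is bounded on the vectors killed by the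
length functional. -/
theorem exists_bound_of_dotProduct_eq_zero (hc : c.Admissible) (hk : c.IsBounded k) {a₀ b₀ : ℕ}
    (h₀ : IsRotationType (c.π 0) a₀ b₀) {l : ℕ → A → ℝ} (hl : c.IsLengthOrbit l) {x : A → ℝ}
    (hx : l 0 ⬝ᵥ x = 0) : ∃ B, ∀ n α, |(c.thetaProd 0 n *ᵥ x) α| ≤ B := by
  have hwl := fun n => winner_ne_loser hc hk n
  obtain ⟨N, m, M, hT⟩ := exists_uniformlyPositive_transpose_theta hc hk
  obtain ⟨a, b, hab, hj⟩ := exists_rotationType hc h₀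
  set d : ℝ := ((Fintype.card A : ℕ) : ℝ) with hd
  set L : ℕ → ℝ := fun n => ∑ α, l n α with hL
  have hL0 : ∀ n, 0 < L n := fun n => sum_pos_of_pos (hl.pos n)
  obtain ⟨c₀, hc₀0, hcomp⟩ : ∃ c₀ > 0, ∀ n α, c₀ * L n ≤ l n α := hl.exists_mul_sum_le hT
  set xs : ℕ → A → ℝ := fun n => c.thetaProd 0 n *ᵥ x with hxs
  have hxs1 : ∀ n, xs (n + 1) = c.theta n *ᵥ xs n := fun n => by
    rw [hxs]; simp only; rw [thetaProd_zero_succ, mulVec_mulVec]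
  have hlx : ∀ n, l n ⬝ᵥ xs n = 0 := fun n => by
    have := IsLengthOrbit.dotProduct_thetaProd hl 0 n x
    rw [zero_add] at this
    rw [this, hx]
  set B₀ := ∑ α, |jump (c.π 0) (a 0) (b 0) x α| with hB₀
  have hB₀0 : 0 ≤ B₀ := Finset.sum_nonneg fun _ _ => abs_nonneg _
  have hB : ∀ n α, |jump (c.π n) (a n) (b n) (xs n) α| ≤ B₀ := by
    intro n α
    have := jump_thetaProd hj 0 n x α
    rw [zero_add] at this
    rw [this]
    exact Finset.single_le_sum (f := fun α => |jump (c.π 0) (a 0) (b 0) x α|)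
      (fun _ _ => abs_nonneg _) (Finset.mem_univ α)
  set E := d * B₀ with hE
  have hE0 : 0 ≤ E := by positivity
  set C := E + E / c₀ with hC
  have hC0 : 0 ≤ C := by positivity
  -- Bounded jumps put `xs n` within `E` of the plane `Im Ω`. Since `l n` kills `xs n`, it nearly
  -- kills the planar part, which is then close to the kernel line, spanned by `Ω l_n`. The error `E
  -- / c₀` comes from dividing by `q ≥ c₀ L`.
  have hτ : ∀ n, ∃ τ : ℝ, ∀ α, |xs n α - τ * (Omega (c.π n) *ᵥ l n) α| ≤ C := by
    intro n
    obtain ⟨s, t, hst⟩ := (hab n).exists_planeVec (hB n)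
    have hΩ := (hab n).Omega_mulVec (l n)
    have hq := (hab n).sum_ge_pos (hl.pos n) (hcomp n)
    have hdot := IsRotationType.dotProduct_planeVec (π := c.π n) (a := a n) (b := b n) (l n) s t
    set q := ∑ β, if a n ≤ ((c.π n).row 0 β : ℕ) then l n β else 0
    set r := ∑ β, if ((c.π n).row 0 β : ℕ) < b n then l n β else 0
    set e : A → ℝ := fun α => xs n α - planeVec (c.π n) (a n) (b n) s t α with he
    have hle : |l n ⬝ᵥ e| ≤ L n * E := by
      rw [hL, Finset.sum_mul]
      refine (Finset.abs_sum_le_sum_abs _ _).trans (Finset.sum_le_sum fun α _ => ?_)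
      rw [abs_mul, abs_of_pos (hl.pos n α)]
      exact mul_le_mul_of_nonneg_left (hst α) (hl.pos n α).le
    have h1 : l n ⬝ᵥ e = -(s * r + t * q) := by
      rw [← hdot, show e = xs n - planeVec (c.π n) (a n) (b n) s t from rfl, dotProduct_sub, hlx,
        zero_sub]
    have hq0 : 0 < q := lt_of_lt_of_le (mul_pos hc₀0 (hL0 n)) hq
    have h2 : |t + s / q * r| ≤ E / c₀ := by
      have : t + s / q * r = -(l n ⬝ᵥ e) / q := by rw [h1]; field_simp; ring
      rw [this, abs_div, abs_neg, abs_of_pos hq0, div_le_div_iff₀ hq0 hc₀0]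
      calc _ ≤ L n * E * c₀ := mul_le_mul_of_nonneg_right hle hc₀0.le
        _ = E * (c₀ * L n) := by ring
        _ ≤ E * q := mul_le_mul_of_nonneg_left hq hE0
    refine ⟨s / q, fun α => ?_⟩
    have h3 : xs n α - s / q * (Omega (c.π n) *ᵥ l n) α =
        e α + if a n ≤ ((c.π n).row 0 α : ℕ) then t + s / q * r else 0 := by
      have hs : s / q * q = s := div_mul_cancel₀ _ hq0.ne'
      rw [hΩ, he]
      simp only [planeVec]
      split_ifs <;> linarith
    rw [h3]
    refine (abs_add_le _ _).trans (add_le_add (hst α) ?_)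
    split_ifs
    · exact h2
    · rw [abs_zero]; positivity
  choose τ hτ using hτ
  -- The two approximations are compared at the first letter of the new first row, where `Ω l_{n+1}`
  -- is at least `c₀ L_{n+1}`. Three errors `C` enter: one at time `n + 1`, and at time `n` one for
  -- the letter and possibly one for the winner.
  have hstep : ∀ n, |τ (n + 1) - τ n| * (c₀ * L (n + 1)) ≤ 3 * C := by
    intro n
    obtain ⟨α, hα⟩ := exists_row_eq (c.π (n + 1)) 0 (Fintype.card_pos (α := A))
    have hΩ := (hab (n + 1)).Omega_mulVec (l (n + 1))
    have hq := (hab (n + 1)).sum_ge_pos (hl.pos (n + 1)) (hcomp (n + 1))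
    have hpos := (hab (n + 1)).pos
    have hle := (hab (n + 1)).le
    have h1 : (Omega (c.π (n + 1)) *ᵥ l (n + 1)) α =
        ∑ β, if a (n + 1) ≤ ((c.π (n + 1)).row 0 β : ℕ) then l (n + 1) β else 0 := by
      rw [hΩ, planeVec, if_pos (by omega), if_neg (by omega), add_zero]
    rw [← h1] at hq
    have h2 : (Omega (c.π (n + 1)) *ᵥ l (n + 1)) α = (Omega (c.π n) *ᵥ l n) α +
        if α = c.loser n then (Omega (c.π n) *ᵥ l n) (c.winner n) else 0 := by
      have := IsLengthOrbit.thetaProd_Omega hl hc hwl n 1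
      rw [← this, thetaProd, thetaProd, mul_one, add_zero, theta_mulVec]
    have h3 := congrFun (hxs1 n) α
    rw [theta_mulVec] at h3
    have e1 := abs_le.1 (hτ (n + 1) α)
    have e2 := abs_le.1 (hτ n α)
    have e3 := abs_le.1 (hτ n (c.winner n))
    have h4 : |(τ (n + 1) - τ n) * (Omega (c.π (n + 1)) *ᵥ l (n + 1)) α| ≤ 3 * C := by
      rw [abs_le, sub_mul]
      have h5 := congrArg (fun z => τ n * z) h2
      simp only [mul_add] at h5
      split_ifs at h3 h5
      · constructor <;> linarith
      · constructor <;> linarith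
    rw [abs_mul] at h4
    exact (mul_le_mul_of_nonneg_left (hq.trans (le_abs_self _)) (abs_nonneg _)).trans h4
  have hLs : ∀ n, (1 + c₀) * L (n + 1) ≤ L n := fun n => by
    have h1 := IsLengthOrbit.sum_eq hl n
    have h2 := hcomp (n + 1) (c.loser n)
    simp only [hL] at h2 ⊢
    rw [h1]
    linarith
  set K := 3 * C / c₀ with hK
  have hK0 : 0 ≤ K := by positivity
  -- Since `L` decreases by the factor `1 + c₀`, the recursion for `|τ n| * L n` preserves the bound
  -- `Y` as soon as `K (1 + c₀) ≤ c₀ Y`.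
  set Y := |τ 0| * L 0 + K * (1 + c₀) / c₀ with hY
  have hY0 : K * (1 + c₀) / c₀ ≤ Y := by
    have := mul_nonneg (abs_nonneg (τ 0)) (hL0 0).le
    linarith
  have hYn : ∀ n, |τ n| * L n ≤ Y := by
    intro n
    induction n with
    | zero => rw [hY]; have : 0 ≤ K * (1 + c₀) / c₀ := by positivity
              linarith
    | succ n ih =>
      have h1 : |τ (n + 1)| ≤ |τ n| + |τ (n + 1) - τ n| := by
        have := abs_add_le (τ n) (τ (n + 1) - τ n)
        rwa [add_sub_cancel] at this
      have h2 : |τ (n + 1) - τ n| * L (n + 1) ≤ K := by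
        rw [hK, le_div_iff₀ hc₀0]
        linarith [hstep n]
      have h3 : (1 + c₀) * (|τ n| * L (n + 1)) ≤ Y := by
        have := mul_le_mul_of_nonneg_left (hLs n) (abs_nonneg (τ n))
        linarith
      have h4 : K * (1 + c₀) ≤ Y * c₀ := by rwa [div_le_iff₀ hc₀0] at hY0
      have h5 := mul_le_mul_of_nonneg_right h1 (hL0 (n + 1)).le
      have h6 : (1 + c₀) * (|τ (n + 1)| * L (n + 1)) ≤ (1 + c₀) * Y := by nlinarith
      exact le_of_mul_le_mul_left h6 (by linarith)
  refine ⟨Y + C, fun n α => ?_⟩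
  have h1 : |(Omega (c.π n) *ᵥ l n) α| ≤ L n := by
    refine (Finset.abs_sum_le_sum_abs _ _).trans (Finset.sum_le_sum fun β _ => ?_)
    rw [abs_mul, abs_of_pos (hl.pos n β)]
    refine mul_le_of_le_one_left (hl.pos n β).le ?_
    change |Omega (c.π n) α β| ≤ 1
    rw [Omega_apply, crossing]
    split_ifs <;> simp
  have h2 : |τ n * (Omega (c.π n) *ᵥ l n) α| ≤ Y := by
    rw [abs_mul]
    exact (mul_le_mul_of_nonneg_left h1 (abs_nonneg _)).trans (hYn n)
  have e1 := abs_le.1 h2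
  have e2 := abs_le.1 (hτ n α)
  change |xs n α| ≤ _
  rw [abs_le]
  constructor <;> linarith

/-! ### The length functional vanishes on the stable and central directions -/

lemma dotProduct_eq_zero_of_mem_stableSpace (hc : c.Admissible) (hk : c.IsBounded k)
    {l : ℕ → A → ℝ} (hl : c.IsLengthOrbit l) {v : A → ℝ} (hv : v ∈ c.stableSpace 0) :
    l 0 ⬝ᵥ v = 0 := by
  have hwl := fun n => winner_ne_loser hc hk n
  obtain ⟨N, m, M, hT⟩ := exists_uniformlyPositive_transpose_theta hc hk
  let g : (A → ℝ) →ₗ[ℝ] ℝ := Fintype.linearCombination ℝ (l 0)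
  have hg : ∀ x, g x = l 0 ⬝ᵥ x := fun x => by
    simp [g, Fintype.linearCombination_apply, dotProduct, mul_comm]
  suffices h : c.stableSpace 0 ≤ LinearMap.ker g by
    rw [← hg]; exact LinearMap.mem_ker.1 (h hv)
  refine Submodule.span_le.2 fun w hw => ?_
  rw [SetLike.mem_coe, LinearMap.mem_ker, hg]
  refine hl.dotProduct_eq_zero_of_tendsto hT (y := fun _ => w) tendsto_const_nhds fun n₀ =>
    Eventually.of_forall fun _ => ⟨n₀ + 1, by omega, ?_⟩
  obtain ⟨_, ⟨z, hz, rfl⟩, hw'⟩ := mem_iInter.1 hw n₀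
  refine ⟨z, hz, ?_⟩
  have hinv := isUnit_det_thetaProd hwl 0 (n₀ + 1)
  -- By invariance of `Ω`, a vector of the pulled-back stable cone is `Ω` applied to a vector of a
  -- deep length cone, and antisymmetry makes the two orthogonal.
  have e : w = Omega (c.π 0) *ᵥ ((c.thetaProd 0 (n₀ + 1))ᵀ *ᵥ z) := by
    rw [← hw']
    have := thetaProd_mul_Omega hc hwl 0 (n₀ + 1)
    rw [add_assoc, ← this]
    rw [mulVec_mulVec, mulVec_mulVec, mul_assoc (c.thetaProd 0 (n₀ + 1)),
      nonsing_inv_mul_cancel_left _ _ hinv]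
  rw [e, transpose_thetaProd]
  exact dotProduct_Omega_self _ _

/-- For a periodic combinatorics of genus one, `v + Ψ_{j,p}(v)` is a fixed vector of the period
matrix, and it is killed by the length functional. -/
lemma dotProduct_psi_eq_zero (hc : c.Admissible) (hk : c.IsBounded k) {a₀ b₀ : ℕ}
    (h₀ : IsRotationType (c.π 0) a₀ b₀) {p : ℕ} (hp : 0 < p)
    (hper : ∀ i, c.π (i + p) = c.π i ∧ c.ε (i + p) = c.ε i) {l : ℕ → A → ℝ}
    (hl : c.IsLengthOrbit l) (j : ℕ) (v : A → ℝ) :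
    l j ⬝ᵥ (v + c.psi p j v) = 0 := by
  have hwl := fun n => winner_ne_loser hc hk n
  obtain ⟨N, m, M', hT⟩ := exists_uniformlyPositive_transpose_theta hc hk
  obtain ⟨a, b, hab, hj⟩ := exists_rotationType hc h₀
  set M := c.thetaProd j p with hM
  have hθ : ∀ i, c.theta (i + p) = c.theta i := fun i => by
    simp [theta, winner, loser, hper i]
  have hl' : c.IsLengthOrbit fun n => l (n + p) :=
    ⟨fun n => hl.pos (n + p), fun n => by
      have := hl.eq (n + p)
      rw [hθ n] at this
      rw [this, add_right_comm]⟩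
  have hsum : ∀ n, 0 < ∑ α, l n α := fun n => sum_pos_of_pos (hl.pos n)
  set ρ := (∑ α, l (j + p) α) * (∑ α, l j α)⁻¹ with hρ
  have hρ1 : ρ < 1 := by
    rw [hρ, ← div_eq_mul_inv, div_lt_one (hsum j)]
    exact IsLengthOrbit.sum_strictAnti hl (show j < j + p by omega)
  -- By periodicity the shifted orbit is another positive orbit, hence proportional to `l`.
  have hlp : l (j + p) = ρ • l j := by
    have h1 := hl.normalize_eq hT hl' j
    rw [hρ, mul_smul]
    change l (j + p) = (∑ α, l (j + p) α) • normalize (l j)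
    rw [h1, normalize, smul_smul, mul_inv_cancel₀ (hsum _).ne', one_smul]
  -- The pairing with `l` is conserved by the cocycle, while over one period `l` is multiplied by `ρ
  -- < 1`.
  have hkill : ∀ x, M *ᵥ x = x → l j ⬝ᵥ x = 0 := by
    intro x hx
    have h1 := IsLengthOrbit.dotProduct_thetaProd hl j p x
    rw [← hM, hx, hlp, smul_dotProduct, smul_eq_mul] at h1
    have h2 : (ρ - 1) * (l j ⬝ᵥ x) = 0 := by linarith
    exact (mul_eq_zero.1 h2).resolve_left (by linarith)
  have hΩ : M *ᵥ (Omega (c.π j) *ᵥ l j) = ρ • (Omega (c.π j) *ᵥ l j) := by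
    rw [hM, IsLengthOrbit.thetaProd_Omega hl hc hwl j p, (hper j).1, hlp, mulVec_smul]
  have hab' : a (j + p) = a j ∧ b (j + p) = b j := by
    have h1 := hab (j + p)
    rw [(hper j).1] at h1
    exact h1.unique (hab j)
  have hjM : ∀ x α, jump (c.π j) (a j) (b j) (M *ᵥ x) α = jump (c.π j) (a j) (b j) x α := by
    intro x α
    have := jump_thetaProd hj j p x α
    rwa [(hper j).1, hab'.1, hab'.2] at this
  have hsubmem : ∀ x, M *ᵥ x - x ∈ range (Omega (c.π j)).mulVec := fun x => by
    rw [(hab j).mem_range_Omega_iff]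
    intro α
    rw [jump_sub, hjM, sub_self]
  let W := LinearMap.range (Omega (c.π j)).mulVecLin
  have hW : ∀ x, x ∈ W ↔ x ∈ range (Omega (c.π j)).mulVec := fun x => by
    simp [W, LinearMap.mem_range]
  let G : W →ₗ[ℝ] W := ((M - 1).mulVecLin.domRestrict W).codRestrict W fun x => by
    rw [hW, LinearMap.domRestrict_apply, mulVecLin_apply, sub_mulVec, one_mulVec]
    exact hsubmem _
  have hG : ∀ x : W, (G x : A → ℝ) = M *ᵥ (x : A → ℝ) - x := fun x => by
    simp [G]
  -- A fixed vector in `Im Ω` is killed by `l j`, hence is a multiple of `Ω l_j`, which `M`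
  -- multiplies by `ρ < 1`; so it vanishes. In finite dimension `M - Id` is then onto `Im Ω`, and
  -- `psi` is a genuine preimage rather than a default value.
  have hinj : Function.Injective G := by
    rw [← LinearMap.ker_eq_bot, LinearMap.ker_eq_bot']
    intro y hy
    have h1 : M *ᵥ (y : A → ℝ) = y := by
      have := congrArg Subtype.val hy
      rw [hG] at this
      exact sub_eq_zero.1 this
    obtain ⟨τ, hτ⟩ := (hab j).exists_smul_of_dotProduct_eq_zero (hl.pos j) ((hW _).1 y.2)
      (hkill _ h1)
    have h2 : ρ • (y : A → ℝ) = y := by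
      conv_rhs => rw [← h1]
      rw [hτ, mulVec_smul, hΩ, smul_comm]
    have h3 : (ρ - 1) • (y : A → ℝ) = 0 := by rw [sub_smul, h2, one_smul, sub_self]
    exact Subtype.ext ((smul_eq_zero.1 h3).resolve_left (by linarith))
  have hsurj : Function.Surjective G := LinearMap.injective_iff_surjective.1 hinj
  have hvM : v - M *ᵥ v ∈ W := by
    rw [← neg_sub]
    exact W.neg_mem ((hW _).2 (hsubmem v))
  obtain ⟨y, hy⟩ := hsurj ⟨_, hvM⟩
  have hex : ∃ w ∈ range (Omega (c.π j)).mulVec, M *ᵥ w - w = v - M *ᵥ v :=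
    ⟨y, (hW _).1 y.2, by rw [← hG, hy]⟩
  have hpsi : M *ᵥ c.psi p j v - c.psi p j v = v - M *ᵥ v :=
    Function.invFunOn_eq (f := fun w : A → ℝ => M *ᵥ w - w) hex
  refine hkill _ ?_
  rw [mulVec_add]
  have : M *ᵥ c.psi p j v = v - M *ᵥ v + c.psi p j v := by rw [← hpsi]; abel
  rw [this]
  abel

/-- Each periodic approximation has its own length orbit, which kills `v + Ψ_{j,p}(v)`. As the
approximation shares its first matrices with `c`, that orbit lies in a deep length cone of `c`, and
the limit is killed by `l j`. -/
lemma dotProduct_eq_zero_of_isCentralDirection (hc : c.Admissible) (hk : c.IsBounded k)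
    {a₀ b₀ : ℕ} (h₀ : IsRotationType (c.π 0) a₀ b₀) {l : ℕ → A → ℝ} (hl : c.IsLengthOrbit l)
    {E : ℕ → Set (A → ℝ)} (hE : c.IsCentralDirection E) {j : ℕ} {w : A → ℝ} (hw : w ∈ E j) :
    l j ⬝ᵥ w = 0 := by
  obtain ⟨N, m, M, hT⟩ := exists_uniformlyPositive_transpose_theta hc hk
  obtain ⟨K, γ, p, φ, ψ, happ, hφ, hψ, hEj⟩ := hE
  rw [hEj j] at hw
  obtain ⟨v, hv, rfl⟩ := hw
  refine hl.dotProduct_eq_zero_of_tendsto hT (j := j) ((hψ j v hv).const_add v) fun n₀ => ?_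
  -- Then `φ i ≥ j + n₀`, so all matrices at times `j, …, j + n₀ - 1` agree.
  filter_upwards [eventually_ge_atTop (j + n₀)] with i hi
  have hi' : j + n₀ ≤ φ i := hi.trans hφ.le_apply
  obtain ⟨N', m', M', hT'⟩ :=
    exists_uniformlyPositive_transpose_theta (happ.admissible (φ i)) (happ.bounded (φ i))
  obtain ⟨l', hl', -⟩ := hT'.exists_orbit
  refine ⟨n₀, le_rfl, l' (j + n₀), hl'.pos _, ?_⟩
  have h₀' : IsRotationType ((γ (φ i)).π 0) a₀ b₀ := by
    rw [(happ.agree (φ i) 0 (Nat.zero_le _)).1]; exact h₀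
  have e : seqProd (fun n => (c.theta n)ᵀ) j n₀ =
      seqProd (fun n => ((γ (φ i)).theta n)ᵀ) j n₀ := by
    refine seqProd_congr fun r hr => ?_
    obtain ⟨h1, h2⟩ := happ.agree (φ i) (j + r) (by omega)
    simp [theta, winner, loser, h1, h2]
  rw [e, ← hl'.eq_seqProd]
  exact dotProduct_psi_eq_zero (happ.admissible (φ i)) (happ.bounded (φ i)) h₀'
    (happ.period_pos (φ i)) (happ.periodic (φ i)) hl' j v

/-- In genus one the slope vectors `ωⁿ` are bounded. -/
theorem exists_bound_of_isCentralLimit (hc : c.Admissible) (hk : c.IsBounded k) {a₀ b₀ : ℕ}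
    (h₀ : IsRotationType (c.π 0) a₀ b₀) {L : ℕ → A → ℝ} {ω₀ v : A → ℝ}
    (hω₀ : c.IsCentralLimit L ω₀) (hv : v ∈ c.stableSpace 0) :
    ∃ B, ∀ n α, |(c.thetaProd 0 n *ᵥ (ω₀ + v)) α| ≤ B := by
  have hwl := fun n => winner_ne_loser hc hk n
  obtain ⟨N, m, M, hT⟩ := exists_uniformlyPositive_transpose_theta hc hk
  obtain ⟨l, hl, -⟩ := hT.exists_orbit
  refine exists_bound_of_dotProduct_eq_zero hc hk h₀ hl ?_
  rw [dotProduct_add, dotProduct_eq_zero_of_mem_stableSpace hc hk hl hv, add_zero]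
  obtain ⟨E, u, Ls, Lc, Lu, hE, -, hdec, hlim⟩ := hω₀
  have h1 : ∀ n, l 0 ⬝ᵥ ((c.thetaProd 0 n)⁻¹ *ᵥ Lc n) = 0 := by
    intro n
    rw [← IsLengthOrbit.dotProduct_thetaProd hl 0 n, mulVec_mulVec,
      mul_nonsing_inv _ (isUnit_det_thetaProd hwl 0 n), one_mulVec, zero_add]
    exact dotProduct_eq_zero_of_isCentralDirection hc hk h₀ hl hE (hdec n).2.2.1
  have h2 : Tendsto (fun n => l 0 ⬝ᵥ ((c.thetaProd 0 n)⁻¹ *ᵥ Lc n)) atTop (𝓝 (l 0 ⬝ᵥ ω₀)) :=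
    tendsto_finsetSum _ fun α _ => ((tendsto_pi_nhds.1 hlim) α).const_mul (l 0 α)
  simp only [h1] at h2
  exact (tendsto_nhds_unique h2 tendsto_const_nhds)

end CombSeq

/-! ### Consecutive intervals -/

/-- The left endpoint of the interval of `α`, when intervals of lengths `μ` are placed from left to
right in the order `r`. -/
noncomputable def offset (r : A ≃ Fin (Fintype.card A)) (μ : A → ℝ) (α : A) : ℝ :=
  ∑ β with r β < r α, μ β

section Offset

variable {r r' : A ≃ Fin (Fintype.card A)} {μ μ' : A → ℝ}

lemma offset_eq_sum (r : A ≃ Fin (Fintype.card A)) (μ : A → ℝ) (α : A) :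
    offset r μ α = ∑ β, if (r β : ℕ) < r α then μ β else 0 := by
  rw [offset, Finset.sum_filter]
  simp only [Fin.lt_def]

lemma offset_nonneg (hμ : ∀ α, 0 < μ α) (α : A) : 0 ≤ offset r μ α :=
  Finset.sum_nonneg fun β _ => (hμ β).le

lemma offset_add_eq_sum (r : A ≃ Fin (Fintype.card A)) (μ : A → ℝ) (α : A) :
    offset r μ α + μ α = ∑ β, if (r β : ℕ) ≤ r α then μ β else 0 := by
  have h : μ α = ∑ β, if β = α then μ β else 0 := by simp
  rw [offset_eq_sum]
  conv_lhs => rw [h]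
  rw [← Finset.sum_add_distrib]
  refine Finset.sum_congr rfl fun β _ => ?_
  by_cases hβ : β = α
  · simp [hβ]
  · have : (r β : ℕ) ≠ r α := fun h' => hβ (r.injective (Fin.ext h'))
    have h2 : (r β : ℕ) ≤ r α ↔ (r β : ℕ) < r α := by omega
    simp [hβ, h2]

lemma offset_add_le (hμ : ∀ α, 0 < μ α) {α β : A} (h : (r α : ℕ) < r β) :
    offset r μ α + μ α ≤ offset r μ β := by
  rw [offset_add_eq_sum, offset_eq_sum]
  refine Finset.sum_le_sum fun γ _ => ?_
  have := (hμ γ).le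
  split_ifs <;> first | omega | linarith

lemma offset_succ {α β : A} (h : (r β : ℕ) = r α + 1) :
    offset r μ β = offset r μ α + μ α := by
  rw [offset_add_eq_sum, offset_eq_sum, h]
  simp only [Nat.lt_succ_iff]

lemma offset_add_le_sum (hμ : ∀ α, 0 < μ α) (α : A) : offset r μ α + μ α ≤ ∑ β, μ β := by
  rw [offset_add_eq_sum]
  refine Finset.sum_le_sum fun γ _ => ?_
  have := (hμ γ).le
  split_ifs <;> linarith

lemma offset_add_of_last {α : A} (h : (r α : ℕ) = Fintype.card A - 1) :
    offset r μ α + μ α = ∑ β, μ β := by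
  rw [offset_add_eq_sum]
  refine Finset.sum_congr rfl fun γ _ => if_pos ?_
  have := (r γ).2
  omega

lemma exists_mem_Ico_offset (r : A ≃ Fin (Fintype.card A)) {x : ℝ}
    (hx : x ∈ Ico 0 (∑ α, μ α)) : ∃ α, x ∈ Ico (offset r μ α) (offset r μ α + μ α) := by
  have hne : Nonempty A := by
    by_contra h
    rw [not_nonempty_iff] at h
    simp at hx
  have hcard := Fintype.card_pos (α := A)
  have h0 : offset r μ (r.symm ⟨0, hcard⟩) = 0 := by
    rw [offset_eq_sum]; simp
  obtain ⟨α, hα, hmax⟩ := Finset.exists_max_image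
    (Finset.univ.filter fun α => offset r μ α ≤ x) (fun α => (r α : ℕ))
    ⟨r.symm ⟨0, hcard⟩, Finset.mem_filter.2 ⟨Finset.mem_univ _, h0.le.trans hx.1⟩⟩
  simp only [Finset.mem_filter, Finset.mem_univ, true_and] at hα hmax
  refine ⟨α, hα, ?_⟩
  by_cases hl : (r α : ℕ) = Fintype.card A - 1
  · rw [offset_add_of_last hl]; exact hx.2
  · have hlt : (r α : ℕ) + 1 < Fintype.card A := by
      have := (r α).2
      omega
    have hs : (r (r.symm ⟨r α + 1, hlt⟩) : ℕ) = r α + 1 := by simp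
    rw [← offset_succ (μ := μ) hs]
    by_contra! hcon
    have := hmax _ hcon
    omega

lemma eq_of_mem_Ico_offset (hμ : ∀ α, 0 < μ α) {x : ℝ} {α β : A}
    (hα : x ∈ Ico (offset r μ α) (offset r μ α + μ α))
    (hβ : x ∈ Ico (offset r μ β) (offset r μ β + μ β)) : α = β := by
  rcases lt_trichotomy (r α : ℕ) (r β) with h | h | h
  · have := offset_add_le (r := r) hμ h
    linarith [hα.2, hβ.1]
  · exact r.injective (Fin.ext h)
  · have := offset_add_le (r := r) hμ h
    linarith [hβ.2, hα.1]

/-- Shortening the last interval does not move the left endpoints. -/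
lemma offset_congr_of_last {w : A} (hw : ∀ α, (r α : ℕ) ≤ r w)
    (hμ : ∀ α, α ≠ w → μ' α = μ α) (α : A) : offset r μ' α = offset r μ α := by
  rw [offset_eq_sum, offset_eq_sum]
  refine Finset.sum_congr rfl fun β _ => ?_
  by_cases hβ : β = w
  · rw [hβ, if_neg (by have := hw α; omega), if_neg (by have := hw α; omega)]
  · rw [hμ β hβ]

section Insert

variable {w l : A} (hwl : w ≠ l) (hl : ∀ α, α ≠ l → (r α : ℕ) < r l)
  (hr' : ∀ α, (r' α : ℕ) = if (r α : ℕ) ≤ r w then (r α : ℕ) else if α = l then (r w : ℕ) + 1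
    else (r α : ℕ) + 1)
  (hμ : ∀ α, α ≠ w → α ≠ l → μ' α = μ α)
include hwl hl hr' hμ

/-- Cutting the interval of `w` in two and giving the right half to `l` does not move the other
left endpoints. -/
lemma offset_insert_of_ne (hμw : μ w = μ' w + μ' l) {α : A} (hα : α ≠ l) :
    offset r' μ' α = offset r μ α := by
  rw [offset_eq_sum, offset_eq_sum]
  have hlα := hl α hα
  have hlw := hl w hwl
  -- The amount `μ' l` is taken from `w` and handed to `l`; in the order `r'` either both letters
  -- precede `α` or `l` does not, so the total is unchanged.
  have e : ∀ β, (if (r' β : ℕ) < r' α then μ' β else 0) =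
      (if (r β : ℕ) < r α then μ β else 0) -
        (if β = w then (if (r w : ℕ) < r α then μ' l else 0) else 0) +
        (if β = l then (if (r w : ℕ) < r α then μ' l else 0) else 0) := by
    intro β
    have h1 := hr' α
    have h2 := hr' β
    rw [if_neg hα] at h1
    by_cases hβ : β = l
    · subst hβ
      rw [if_neg (by omega), if_pos rfl] at h2
      rw [if_neg hwl.symm, if_pos rfl, if_neg (show ¬ (r β : ℕ) < r α by omega)]
      split_ifs at h1 ⊢ <;> first | omega | ring
    · have hlβ := hl β hβ
      rw [if_neg hβ] at h2 ⊢
      have h3 : (r' β : ℕ) < r' α ↔ (r β : ℕ) < r α := by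
        split_ifs at h1 h2 <;> omega
      simp only [h3]
      by_cases hβw : β = w
      · subst hβw
        simp only [if_true, hμw]
        split_ifs <;> ring
      · rw [hμ β hβw hβ, if_neg hβw]
        ring
  simp only [e, Finset.sum_add_distrib, Finset.sum_sub_distrib, Finset.sum_ite_eq',
    Finset.mem_univ, if_true, sub_add_cancel]

lemma offset_insert_self : offset r' μ' l = offset r μ w + μ' w := by
  rw [offset_eq_sum, offset_eq_sum]
  have hlw := hl w hwl
  have e : ∀ β, (if (r' β : ℕ) < r' l then μ' β else 0) =
      (if (r β : ℕ) < r w then μ β else 0) + (if β = w then μ' w else 0) := by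
    intro β
    have h1 := hr' l
    have h2 := hr' β
    rw [if_neg (by omega), if_pos rfl] at h1
    by_cases hβ : β = l
    · subst hβ
      rw [if_neg (lt_irrefl _), if_neg (by omega), if_neg hwl.symm, add_zero]
    · rw [if_neg hβ] at h2
      by_cases hβw : β = w
      · subst hβw
        rw [if_pos le_rfl] at h2
        rw [if_pos (by omega), if_neg (lt_irrefl _), if_pos rfl, zero_add]
      · have h3 : (r β : ℕ) ≠ r w := fun h' => hβw (r.injective (Fin.ext h'))
        have h4 : (r' β : ℕ) < r' l ↔ (r β : ℕ) < r w := by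
          split_ifs at h2 <;> omega
        simp only [h4, if_neg hβw, hμ β hβw hβ, add_zero]
  simp only [e, Finset.sum_add_distrib, Finset.sum_ite_eq', Finset.mem_univ, if_true]

end Insert

end Offset

lemma Ico_eq_Ico_iff_of_lt {a b c d : ℝ} (hab : a < b) (hcd : c < d) (h : Ico a b = Ico c d) :
    a = c ∧ b = d := by
  have h1 : a ∈ Ico c d := h ▸ left_mem_Ico.2 hab
  have h2 : c ∈ Ico a b := h.symm ▸ left_mem_Ico.2 hcd
  obtain rfl : a = c := le_antisymm h2.1 h1.1
  refine ⟨rfl, ?_⟩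
  rcases lt_trichotomy b d with h3 | h3 | h3
  · have : b ∈ Ico a b := h ▸ ⟨hab.le, h3⟩
    exact absurd this.2 (lt_irrefl _)
  · exact h3
  · have : d ∈ Ico a d := h ▸ ⟨hcd.le, h3⟩
    exact absurd this.2 (lt_irrefl _)

/-! ### Generalized interval exchange maps -/

namespace GIET

/-- The left endpoint of `f(I_α)`. -/
noncomputable def imLeft (f : GIET A) (α : A) : ℝ := offset (f.comb.row 1) f.imLen α

variable {f g : GIET A}

lemma left_eq (f : GIET A) (α : A) : f.left α = offset (f.comb.row 0) f.len α := rfl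

lemma left_nonneg (f : GIET A) (α : A) : 0 ≤ f.left α := offset_nonneg f.len_pos α

lemma imLeft_nonneg (f : GIET A) (α : A) : 0 ≤ f.imLeft α := offset_nonneg f.imLen_pos α

lemma sum_imLen_eq_total (f : GIET A) : ∑ α, f.imLen α = f.total := f.sum_imLen

lemma toFun_image (f : GIET A) (α : A) :
    f.toFun '' f.interval α = Ico (f.imLeft α) (f.imLeft α + f.imLen α) := f.image_eq α

lemma toFun_mem (f : GIET A) {α : A} {x : ℝ} (hx : x ∈ f.interval α) :
    f.toFun x ∈ Ico (f.imLeft α) (f.imLeft α + f.imLen α) := by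
  rw [← f.toFun_image]; exact mem_image_of_mem _ hx

lemma exists_mem_interval (f : GIET A) {x : ℝ} (hx : x ∈ Ico 0 f.total) :
    ∃ α, x ∈ f.interval α := exists_mem_Ico_offset (f.comb.row 0) hx

lemma imLeft_add_le_total (f : GIET A) (α : A) : f.imLeft α + f.imLen α ≤ f.total := by
  rw [← f.sum_imLen_eq_total]; exact offset_add_le_sum f.imLen_pos α

lemma interval_subset (f : GIET A) (α : A) : f.interval α ⊆ Ico 0 f.total := fun _ hx =>
  ⟨(f.left_nonneg α).trans hx.1, hx.2.trans_le (offset_add_le_sum f.len_pos α)⟩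

lemma toFun_mem_total (f : GIET A) {α : A} {x : ℝ} (hx : x ∈ f.interval α) :
    f.toFun x ∈ Ico 0 f.total :=
  ⟨(f.imLeft_nonneg α).trans (f.toFun_mem hx).1, (f.toFun_mem hx).2.trans_le
    (f.imLeft_add_le_total α)⟩

lemma interval_injective (f : GIET A) {α : A} {a b : ℝ} (hab : a < b)
    (h : f.interval α = Ico a b) : f.left α = a ∧ f.left α + f.len α = b :=
  Ico_eq_Ico_iff_of_lt (by linarith [f.len_pos α]) hab h

lemma IsFirstReturn.unique {T : ℝ → ℝ} {S : Set ℝ} {x y y' : ℝ} (h : IsFirstReturn T S x y)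
    (h' : IsFirstReturn T S x y') : y = y' := by
  obtain ⟨m, hm, hS, hmin, rfl⟩ := h
  obtain ⟨m', hm', hS', hmin', rfl⟩ := h'
  rcases lt_trichotomy m m' with h | rfl | h
  · exact absurd hS (hmin' m hm h)
  · rfl
  · exact absurd hS' (hmin m' hm' h)

lemma isFirstReturn_one {T : ℝ → ℝ} {S : Set ℝ} {x : ℝ} (h : T x ∈ S) :
    IsFirstReturn T S x (T x) :=
  ⟨1, one_pos, h, fun i h0 h1 => by omega, rfl⟩

lemma isFirstReturn_two {T : ℝ → ℝ} {S : Set ℝ} {x : ℝ} (h : T x ∉ S) (h' : T (T x) ∈ S) :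
    IsFirstReturn T S x (T (T x)) :=
  ⟨2, two_pos, h', fun i h0 h1 => by
    obtain rfl : i = 1 := by omega
    exact h, rfl⟩

/-! ### First returns to `I¹` -/

section Return

variable [Nonempty A]

lemma left_last (f : GIET A) : f.left (f.comb.last 0) + f.len (f.comb.last 0) = f.total :=
  offset_add_of_last (f.comb.row_last 0)

lemma imLeft_last (f : GIET A) : f.imLeft (f.comb.last 1) + f.imLen (f.comb.last 1) = f.total := by
  rw [← f.sum_imLen_eq_total]; exact offset_add_of_last (f.comb.row_last 1)

lemma left_add_le_left_last (f : GIET A) {α : A} (h : α ≠ f.comb.last 0) :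
    f.left α + f.len α ≤ f.left (f.comb.last 0) :=
  offset_add_le f.len_pos (CombData.row_lt_last h)

lemma imLeft_add_le_imLeft_last (f : GIET A) {α : A} (h : α ≠ f.comb.last 1) :
    f.imLeft α + f.imLen α ≤ f.imLeft (f.comb.last 1) :=
  offset_add_le f.imLen_pos (CombData.row_lt_last h)

variable (hwl : f.comb.last 0 ≠ f.comb.last 1)
include hwl

lemma return_zero_of_ne {x : ℝ} {α : A} (hx : x ∈ f.interval α) (hα : α ≠ f.comb.last 1) :
    f.toFun x ∈ Ico 0 (f.total - f.imLen (f.comb.last 1)) := by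
  refine ⟨(f.toFun_mem_total hx).1, (f.toFun_mem hx).2.trans_le ?_⟩
  linarith [f.imLeft_add_le_imLeft_last hα, f.imLeft_last]

/-- The intervals `f(I_{α(1)})` and `I_{α(0)}` both end at the right end of the domain and the first
is shorter, so it lies inside the second. Only `I_{α(1)}` is mapped outside `I¹`, hence the second
iterate is back. -/
lemma return_zero_loser (ht : f.imLen (f.comb.last 1) < f.len (f.comb.last 0)) {x : ℝ}
    (hx : x ∈ f.interval (f.comb.last 1)) :
    f.toFun x ∉ Ico 0 (f.total - f.imLen (f.comb.last 1)) ∧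
      f.toFun x ∈ f.interval (f.comb.last 0) ∧
      f.toFun (f.toFun x) ∈ Ico 0 (f.total - f.imLen (f.comb.last 1)) := by
  have h1 := f.toFun_mem hx
  have h2 := f.imLeft_last
  have h3 := f.left_last
  have h4 : f.toFun x ∈ f.interval (f.comb.last 0) := ⟨by linarith [h1.1], by linarith [h1.2]⟩
  exact ⟨fun h => by linarith [h1.1, h.2], h4, return_zero_of_ne hwl h4 hwl⟩

lemma return_one_of_ne (ht : f.len (f.comb.last 0) < f.imLen (f.comb.last 1)) {x : ℝ} {α : A}
    (hx : x ∈ f.interval α) (hα : α ≠ f.comb.last 1) :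
    f.toFun x ∈ Ico 0 (f.total - f.len (f.comb.last 0)) := by
  refine ⟨(f.toFun_mem_total hx).1, (f.toFun_mem hx).2.trans_le ?_⟩
  linarith [f.imLeft_add_le_imLeft_last hα, f.imLeft_last]

lemma return_one_winner {x : ℝ} (hx : x ∈ f.interval (f.comb.last 1))
    (h : f.toFun x ∉ f.interval (f.comb.last 0)) :
    f.toFun x ∈ Ico 0 (f.total - f.len (f.comb.last 0)) := by
  have h1 := f.toFun_mem_total hx
  have h3 := f.left_last
  refine ⟨h1.1, ?_⟩
  by_contra! hcon
  exact h ⟨by linarith, by linarith [h1.2]⟩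

lemma return_one_loser (ht : f.len (f.comb.last 0) < f.imLen (f.comb.last 1)) {x : ℝ}
    (h : f.toFun x ∈ f.interval (f.comb.last 0)) :
    f.toFun x ∉ Ico 0 (f.total - f.len (f.comb.last 0)) ∧
      f.toFun (f.toFun x) ∈ Ico 0 (f.total - f.len (f.comb.last 0)) := by
  have h3 := f.left_last
  exact ⟨fun h' => by linarith [h.1, h'.2], return_one_of_ne hwl ht h hwl⟩

end Return

/-! ### Affine maps -/

lemma IsAffineWithSlope.formula {ω : A → ℝ} (h : f.IsAffineWithSlope ω) (α : A) :
    f.imLen α = Real.exp (ω α) * f.len α ∧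
      ∀ x ∈ f.interval α, f.toFun x = f.imLeft α + Real.exp (ω α) * (x - f.left α) := by
  obtain ⟨δ, hδ⟩ := h
  have he := Real.exp_pos (ω α)
  have hlen := f.len_pos α
  have h1 : f.toFun '' f.interval α = Ico (Real.exp (ω α) * f.left α + δ α)
      (Real.exp (ω α) * (f.left α + f.len α) + δ α) := by
    rw [image_congr (hδ α)]
    ext y
    constructor
    · rintro ⟨x, hx, rfl⟩
      exact ⟨by have := mul_le_mul_of_nonneg_left hx.1 he.le; linarith,
        by have := mul_lt_mul_of_pos_left hx.2 he; linarith⟩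
    · intro hy
      refine ⟨(y - δ α) / Real.exp (ω α), ⟨?_, ?_⟩, ?_⟩
      · rw [le_div_iff₀ he]; linarith [hy.1]
      · rw [div_lt_iff₀ he]; linarith [hy.2]
      · simp only; field_simp; ring
  rw [f.toFun_image] at h1
  obtain ⟨h2, h3⟩ := Ico_eq_Ico_iff_of_lt (by linarith [f.imLen_pos α]) (by nlinarith) h1
  refine ⟨by linarith, fun x hx => ?_⟩
  rw [hδ α x hx, h2]
  ring

lemma IsAffineWithSlope.of_formula {ω : A → ℝ} (c : A → ℝ)
    (h : ∀ α, ∀ x ∈ f.interval α, f.toFun x = c α + Real.exp (ω α) * x) :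
    f.IsAffineWithSlope ω :=
  ⟨c, fun α x hx => by rw [h α x hx, add_comm]⟩

/-- An affine map is determined by its combinatorial data, its lengths and its slopes. -/
lemma IsAffineWithSlope.ext {ω : A → ℝ} (hf : f.IsAffineWithSlope ω)
    (hg : g.IsAffineWithSlope ω) (hc : f.comb = g.comb) (hl : f.len = g.len) : f = g := by
  have hil : f.imLen = g.imLen := by
    funext α; rw [(hf.formula α).1, (hg.formula α).1, hl]
  have hleft : ∀ α, f.left α = g.left α := fun α => by rw [left_eq, left_eq, hc, hl]
  have hileft : ∀ α, f.imLeft α = g.imLeft α := fun α => by rw [imLeft, imLeft, hc, hil]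
  refine GIET.ext hc hl hil (funext fun x => ?_)
  by_cases hx : x ∈ Ico 0 f.total
  · obtain ⟨α, hα⟩ := f.exists_mem_interval hx
    have hα' : x ∈ g.interval α := by rwa [interval, ← hleft, ← hl]
    rw [(hf.formula α).2 x hα, (hg.formula α).2 x hα', hleft, hileft]
  · rw [f.eq_self x hx, g.eq_self x (by rwa [total, hl] at hx)]

/-- The affine map with given combinatorial data, lengths and slopes. -/
noncomputable def affine (π : CombData A) (len ω : A → ℝ) (hlen : ∀ α, 0 < len α)
    (hsum : ∑ α, Real.exp (ω α) * len α = ∑ α, len α) : GIET A :=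
  have key : ∀ α, ∀ x ∈ Ico (offset (π.row 0) len α) (offset (π.row 0) len α + len α),
      x + ∑ β, (if x ∈ Ico (offset (π.row 0) len β) (offset (π.row 0) len β + len β) then
        offset (π.row 1) (fun γ => Real.exp (ω γ) * len γ) β +
          Real.exp (ω β) * (x - offset (π.row 0) len β) - x else 0) =
      offset (π.row 1) (fun γ => Real.exp (ω γ) * len γ) α +
          Real.exp (ω α) * (x - offset (π.row 0) len α) := by
    intro α x hx
    rw [Finset.sum_eq_single α]
    · rw [if_pos hx]; ring
    · intro β _ hβ
      exact if_neg fun h => hβ (eq_of_mem_Ico_offset hlen h hx)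
    · simp
  { comb := π
    len := len
    imLen := fun α => Real.exp (ω α) * len α
    -- The intervals are disjoint, so at most one term is nonzero, and outside the domain none is:
    -- the map is then the identity there.
    toFun := fun x => x + ∑ β,
      (if x ∈ Ico (offset (π.row 0) len β) (offset (π.row 0) len β + len β) then
        offset (π.row 1) (fun γ => Real.exp (ω γ) * len γ) β +
          Real.exp (ω β) * (x - offset (π.row 0) len β) - x else 0)
    len_pos := hlen
    imLen_pos := fun α => mul_pos (Real.exp_pos _) (hlen α)
    sum_imLen := hsum
    strictMonoOn := fun α x hx y hy hxy => by
      have hx' := key α x hx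
      have hy' := key α y hy
      simp only
      rw [hx', hy']
      have := mul_lt_mul_of_pos_left hxy (Real.exp_pos (ω α))
      linarith
    image_eq := fun α => by
      have he := Real.exp_pos (ω α)
      refine (image_congr (key α)).trans ?_
      ext y
      constructor
      · rintro ⟨x, hx, rfl⟩
        have h1 := mul_le_mul_of_nonneg_left hx.1 he.le
        have h2 := mul_lt_mul_of_pos_left hx.2 he
        exact ⟨by simp only [offset] at *; linarith, by simp only [offset] at *; linarith⟩
      · intro hy
        change y ∈ Ico (offset (π.row 1) (fun γ => Real.exp (ω γ) * len γ) α)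
          (offset (π.row 1) (fun γ => Real.exp (ω γ) * len γ) α + Real.exp (ω α) * len α) at hy
        refine ⟨offset (π.row 0) len α +
          (y - offset (π.row 1) (fun γ => Real.exp (ω γ) * len γ) α) / Real.exp (ω α),
          ⟨?_, ?_⟩, ?_⟩
        · have := div_nonneg (sub_nonneg.2 hy.1) he.le
          exact le_add_of_nonneg_right this
        · have : (y - offset (π.row 1) (fun γ => Real.exp (ω γ) * len γ) α) / Real.exp (ω α) <
              len α := by
            rw [div_lt_iff₀ he]; linarith [hy.2]
          exact (add_lt_add_iff_left _).2 this
        · simp only; field_simp; ring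
    eq_self := fun x hx => by
      rw [Finset.sum_eq_zero, add_zero]
      intro β _
      refine if_neg fun h => hx ⟨(offset_nonneg hlen β).trans h.1,
        h.2.trans_le (offset_add_le_sum hlen β)⟩ }

lemma affine_isAffineWithSlope (π : CombData A) (len ω : A → ℝ) (hlen : ∀ α, 0 < len α)
    (hsum : ∑ α, Real.exp (ω α) * len α = ∑ α, len α) :
    (affine π len ω hlen hsum).IsAffineWithSlope ω := by
  refine IsAffineWithSlope.of_formula (fun α => offset (π.row 1)
    (fun γ => Real.exp (ω γ) * len γ) α - Real.exp (ω α) * offset (π.row 0) len α)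
    fun α x hx => ?_
  change x + _ = _
  rw [Finset.sum_eq_single α]
  · have hx' : x ∈ Ico (offset (π.row 0) len α) (offset (π.row 0) len α + len α) := hx
    rw [if_pos hx']; ring
  · intro β _ hβ
    exact if_neg fun h => hβ (eq_of_mem_Ico_offset hlen h hx)
  · simp

end GIET

namespace GIET

variable [Nonempty A] {f g : GIET A} {ω : A → ℝ}

/-! ### The renormalization of an affine map is affine -/

section StepZero

variable (hs : IsRauzyStep f 0 g) (hwl : f.comb.last 0 ≠ f.comb.last 1)
include hs

lemma IsRauzyStep.total_zero : g.total = f.total - f.imLen (f.comb.last 1) := by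
  rw [hs.total_eq, min_eq_right (hs.type_zero rfl).le]

lemma IsRauzyStep.len_zero : f.len (f.comb.last 0) =
      g.len (f.comb.last 0) + f.imLen (f.comb.last 1) ∧
      ∀ α, α ≠ f.comb.last 0 → f.len α = g.len α := by
  have ht := hs.type_zero rfl
  have hT := hs.total_zero
  have hl := f.left_last
  constructor
  · have h := hs.interval_zero rfl (f.comb.last 0)
    have h' : f.interval (f.comb.last 0) ∩ Ico 0 g.total =
        Ico (f.left (f.comb.last 0)) g.total := by
      ext x
      have := f.left_nonneg (f.comb.last 0)
      have := f.imLen_pos (f.comb.last 1)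
      exact ⟨fun hx => ⟨hx.1.1, hx.2.2⟩, fun hx => ⟨⟨hx.1, by linarith [hx.2]⟩,
        by linarith [hx.1], hx.2⟩⟩
    rw [h'] at h
    obtain ⟨h1, h2⟩ := g.interval_injective (by linarith) h
    linarith
  · intro α hα
    have h := hs.interval_zero rfl α
    have h' : f.interval α ∩ Ico 0 g.total = Ico (f.left α) (f.left α + f.len α) := by
      refine inter_eq_left.2 fun x hx => ⟨(f.left_nonneg α).trans hx.1, hx.2.trans_le ?_⟩
      linarith [f.left_add_le_left_last hα]
    rw [h'] at h
    obtain ⟨h1, h2⟩ := g.interval_injective (by linarith [f.len_pos α]) h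
    linarith

include hwl

/-- On the loser the return map is a second iterate, passing through the winner, so logarithms of
slopes add exactly as under `Θ`; elsewhere it is `f`. -/
lemma IsRauzyStep.affine_zero (hf : f.IsAffineWithSlope ω) : g.IsAffineWithSlope
    fun α => ω α + if α = f.comb.last 1 then ω (f.comb.last 0) else 0 := by
  obtain ⟨δ, hδ⟩ := hf
  refine ⟨fun α => if α = f.comb.last 1 then Real.exp (ω (f.comb.last 0)) * δ α +
    δ (f.comb.last 0) else δ α, fun α x hx => ?_⟩
  have hxT := g.interval_subset α hx
  rw [hs.interval_zero rfl α] at hx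
  have hfr := hs.firstReturn x hxT
  rw [hs.total_zero] at hfr
  by_cases hα : α = f.comb.last 1
  · subst hα
    obtain ⟨h1, h2, h3⟩ := return_zero_loser hwl (hs.type_zero rfl) hx.1
    rw [hfr.unique (isFirstReturn_two h1 h3)]
    simp only [if_true]
    rw [hδ _ _ h2, hδ _ _ hx.1, Real.exp_add]
    ring
  · rw [hfr.unique (isFirstReturn_one (return_zero_of_ne hwl hx.1 hα))]
    simp only [if_neg hα, add_zero]
    exact hδ α x hx.1

end StepZero

section StepOne

/-- Since `f(I_{α(1)})` and `I_{α(0)}` end at the same point, the part of `I_{α(1)}` mapped into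
`I_{α(0)}` is its right end, of length `e^{-ω} |I_{α(0)}|`. For type 1 this is the new interval of
the loser. -/
lemma preimage_last (hf : f.IsAffineWithSlope ω)
    (ht : f.len (f.comb.last 0) < f.imLen (f.comb.last 1)) :
    {x ∈ f.interval (f.comb.last 1) | f.toFun x ∈ f.interval (f.comb.last 0)} =
      Ico (f.left (f.comb.last 1) + f.len (f.comb.last 1) -
        Real.exp (-ω (f.comb.last 1)) * f.len (f.comb.last 0))
        (f.left (f.comb.last 1) + f.len (f.comb.last 1)) ∧
    {x ∈ f.interval (f.comb.last 1) | f.toFun x ∉ f.interval (f.comb.last 0)} =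
      Ico (f.left (f.comb.last 1)) (f.left (f.comb.last 1) + f.len (f.comb.last 1) -
        Real.exp (-ω (f.comb.last 1)) * f.len (f.comb.last 0)) := by
  obtain ⟨h1, h2⟩ := hf.formula (f.comb.last 1)
  have he := Real.exp_pos (ω (f.comb.last 1))
  have hee : Real.exp (ω (f.comb.last 1)) * Real.exp (-ω (f.comb.last 1)) = 1 := by
    rw [← Real.exp_add, add_neg_cancel, Real.exp_zero]
  have hi := f.imLeft_last
  have hl := f.left_last
  set e := Real.exp (ω (f.comb.last 1))
  set e' := Real.exp (-ω (f.comb.last 1))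
  set w := f.comb.last 1
  set l := f.comb.last 0
  have he' : 0 < e' := Real.exp_pos _
  have hlen := f.len_pos l
  have hiff : ∀ x ∈ f.interval w, (f.toFun x ∈ f.interval l ↔
      f.left w + f.len w - e' * f.len l ≤ x) := by
    intro x hx
    have h3 := h2 x hx
    have h4 := f.toFun_mem_total hx
    have h5 : f.toFun x - f.left l = e * (x - (f.left w + f.len w - e' * f.len l)) := by
      rw [h3]
      have : e * (e' * f.len l) = f.len l := by rw [← mul_assoc, hee, one_mul]
      linarith
    constructor
    · intro h
      have h6 := h.1
      have : 0 ≤ e * (x - (f.left w + f.len w - e' * f.len l)) := by linarith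
      have := nonneg_of_mul_nonneg_right this he
      linarith
    · intro h
      have : 0 ≤ e * (x - (f.left w + f.len w - e' * f.len l)) :=
        mul_nonneg he.le (by linarith)
      exact ⟨by linarith, by rw [hl]; exact h4.2⟩
  have hlt : e' * f.len l < f.len w := by
    have : e' * f.len l < e' * (e * f.len w) := mul_lt_mul_of_pos_left (by linarith) he'
    rwa [← mul_assoc, mul_comm e' e, hee, one_mul] at this
  have hpos : 0 < e' * f.len l := mul_pos he' hlen
  constructor
  · ext x
    constructor
    · rintro ⟨hx, hx'⟩
      exact ⟨(hiff x hx).1 hx', hx.2⟩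
    · intro hx
      have hxw : x ∈ f.interval w := ⟨by linarith [hx.1], hx.2⟩
      exact ⟨hxw, (hiff x hxw).2 hx.1⟩
  · ext x
    constructor
    · rintro ⟨hx, hx'⟩
      exact ⟨hx.1, not_le.1 fun h => hx' ((hiff x hx).2 h)⟩
    · intro hx
      have hxw : x ∈ f.interval w := ⟨hx.1, by linarith [hx.2]⟩
      exact ⟨hxw, fun h => by linarith [(hiff x hxw).1 h, hx.2]⟩

variable (hs : IsRauzyStep f 1 g) (hwl : f.comb.last 0 ≠ f.comb.last 1)
include hs

lemma IsRauzyStep.total_one : g.total = f.total - f.len (f.comb.last 0) := by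
  rw [hs.total_eq, min_eq_left (hs.type_one rfl).le]

include hwl

lemma IsRauzyStep.len_one (hf : f.IsAffineWithSlope ω) :
    f.len (f.comb.last 1) = g.len (f.comb.last 1) + g.len (f.comb.last 0) ∧
      f.len (f.comb.last 0) = Real.exp (ω (f.comb.last 1)) * g.len (f.comb.last 0) ∧
      ∀ α, α ≠ f.comb.last 0 → α ≠ f.comb.last 1 → f.len α = g.len α := by
  have ht := hs.type_one rfl
  obtain ⟨h1, h2⟩ := preimage_last hf ht
  have hee : Real.exp (ω (f.comb.last 1)) * Real.exp (-ω (f.comb.last 1)) = 1 := by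
    rw [← Real.exp_add, add_neg_cancel, Real.exp_zero]
  have he' := Real.exp_pos (-ω (f.comb.last 1))
  have hpos := mul_pos he' (f.len_pos (f.comb.last 0))
  have hlt : Real.exp (-ω (f.comb.last 1)) * f.len (f.comb.last 0) < f.len (f.comb.last 1) := by
    rw [(hf.formula _).1] at ht
    have := mul_lt_mul_of_pos_left ht he'
    rwa [← mul_assoc, mul_comm (Real.exp (-ω (f.comb.last 1))) (Real.exp _), hee, one_mul] at this
  have hl := hs.interval_one rfl (f.comb.last 0)
  rw [if_pos rfl, h1] at hl
  obtain ⟨h3, h4⟩ := g.interval_injective (by linarith) hl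
  have hw := hs.interval_one rfl (f.comb.last 1)
  rw [if_neg hwl.symm, if_pos rfl, h2] at hw
  obtain ⟨h5, h6⟩ := g.interval_injective (by linarith) hw
  have h7 : g.len (f.comb.last 0) =
      Real.exp (-ω (f.comb.last 1)) * f.len (f.comb.last 0) := by linarith
  refine ⟨by linarith, by rw [h7, ← mul_assoc, hee, one_mul], fun α h8 h9 => ?_⟩
  have hα := hs.interval_one rfl α
  rw [if_neg h8, if_neg h9] at hα
  obtain ⟨h10, h11⟩ := g.interval_injective (by linarith [f.len_pos α]) hα
  linarith

lemma IsRauzyStep.affine_one (hf : f.IsAffineWithSlope ω) : g.IsAffineWithSlope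
    fun α => ω α + if α = f.comb.last 0 then ω (f.comb.last 1) else 0 := by
  have ht := hs.type_one rfl
  obtain ⟨δ, hδ⟩ := hf
  refine ⟨fun α => if α = f.comb.last 0 then Real.exp (ω α) * δ (f.comb.last 1) +
    δ α else δ α, fun α x hx => ?_⟩
  have hxT := g.interval_subset α hx
  rw [hs.interval_one rfl α] at hx
  have hfr := hs.firstReturn x hxT
  rw [hs.total_one] at hfr
  by_cases hα : α = f.comb.last 0
  · subst hα
    rw [if_pos rfl] at hx
    obtain ⟨h1, h2⟩ := return_one_loser hwl ht hx.2
    rw [hfr.unique (isFirstReturn_two h1 h2)]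
    simp only [if_true]
    rw [hδ _ _ hx.2, hδ _ _ hx.1, Real.exp_add]
    ring
  · simp only [if_neg hα, add_zero]
    rw [if_neg hα] at hx
    by_cases hα' : α = f.comb.last 1
    · subst hα'
      rw [if_pos rfl] at hx
      rw [hfr.unique (isFirstReturn_one (return_one_winner hwl hx.1 hx.2))]
      exact hδ _ x hx.1
    · rw [if_neg hα'] at hx
      rw [hfr.unique (isFirstReturn_one (return_one_of_ne hwl ht hx hα'))]
      exact hδ _ x hx

end StepOne

/-! ### Affine maps with related lengths and slopes are renormalizations of each other -/

lemma isRauzyStep_zero_of_affine {ω' : A → ℝ} (hwl : f.comb.last 0 ≠ f.comb.last 1)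
    (hm : IsRauzyMove f.comb 0 g.comb) (hf : f.IsAffineWithSlope ω)
    (hg : g.IsAffineWithSlope ω')
    (hω : ∀ α, ω' α = ω α + if α = f.comb.last 1 then ω (f.comb.last 0) else 0)
    (hw : f.len (f.comb.last 0) = g.len (f.comb.last 0) +
      Real.exp (ω (f.comb.last 1)) * g.len (f.comb.last 1))
    (hlen : ∀ α, α ≠ f.comb.last 0 → f.len α = g.len α) : IsRauzyStep f 0 g := by
  have hrow : g.comb.row 0 = f.comb.row 0 := hm.1
  have hil := (hf.formula (f.comb.last 1)).1
  rw [hlen _ hwl.symm] at hil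
  have ht : f.imLen (f.comb.last 1) < f.len (f.comb.last 0) := by
    rw [hil, hw]; linarith [g.len_pos (f.comb.last 0)]
  have hleft : ∀ α, g.left α = f.left α := fun α => by
    rw [left_eq, left_eq, hrow]
    exact offset_congr_of_last (f.comb.row_le_last 0) (fun β hβ => (hlen β hβ).symm) α
  have hT : g.total = f.total - f.imLen (f.comb.last 1) := by
    have h1 := g.left_last
    have h2 := f.left_last
    have h3 : g.comb.last 0 = f.comb.last 0 := hm.last_eq
    rw [h3, hleft] at h1
    linarith
  have hslope : ∀ α, α ≠ f.comb.last 1 → ω' α = ω α := fun α hα => by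
    rw [hω, if_neg hα, add_zero]
  have him : ∀ α, α ≠ f.comb.last 0 → α ≠ f.comb.last 1 → g.imLen α = f.imLen α :=
    fun α h1 h2 => by rw [(hg.formula α).1, (hf.formula α).1, hlen α h1, hslope α h2]
  -- The image of the winner is cut in two, its right part being the image of the loser under two
  -- iterates. In the image row this is the insertion of the loser just after the winner.
  have himw : f.imLen (f.comb.last 0) = g.imLen (f.comb.last 0) + g.imLen (f.comb.last 1) := by
    rw [(hg.formula _).1, (hg.formula _).1, (hf.formula _).1, hw, hslope _ hwl, hω, if_pos rfl,
      Real.exp_add]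
    ring
  have hrow' := hm.2
  simp only [sub_zero, Fin.le_def] at hrow'
  have hileft : ∀ α, α ≠ f.comb.last 1 → g.imLeft α = f.imLeft α := fun α hα =>
    offset_insert_of_ne hwl (fun β hβ => CombData.row_lt_last hβ) hrow' him himw hα
  have hileft' : g.imLeft (f.comb.last 1) = f.imLeft (f.comb.last 0) + g.imLen (f.comb.last 0) :=
    offset_insert_self hwl (fun β hβ => CombData.row_lt_last hβ) hrow' him
  have hint : ∀ α, g.interval α = f.interval α ∩ Ico 0 g.total := by
    intro α
    have hl := f.left_last
    by_cases hα : α = f.comb.last 0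
    · subst hα
      have := f.left_nonneg (f.comb.last 0)
      ext x
      rw [interval, interval, hleft]
      constructor
      · intro hx
        exact ⟨⟨hx.1, by linarith [hx.2, f.imLen_pos (f.comb.last 1)]⟩,
          by linarith [hx.1], by linarith [hx.2]⟩
      · intro hx
        exact ⟨hx.1.1, by linarith [hx.2.2]⟩
    · rw [inter_eq_left.2, interval, interval, hleft, hlen α hα]
      intro x hx
      exact ⟨(f.left_nonneg α).trans hx.1, hx.2.trans_le
        (by linarith [f.left_add_le_left_last hα])⟩
  refine ⟨fun _ => ht, fun h => by simp at h, hm, by rw [hT, min_eq_right ht.le],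
    fun _ => hint, fun h => by simp at h, fun x hx => ?_⟩
  obtain ⟨α, hα⟩ := g.exists_mem_interval hx
  have hα' := hα
  rw [hint] at hα'
  have hgx := (hg.formula α).2 x hα
  rw [hleft] at hgx
  rw [hT]
  by_cases hl : α = f.comb.last 1
  · subst hl
    obtain ⟨h1, h2, h3⟩ := return_zero_loser hwl ht hα'.1
    convert isFirstReturn_two h1 h3 using 1
    rw [hgx, (hf.formula _).2 _ h2, (hf.formula _).2 _ hα'.1, hileft', hω, if_pos rfl,
      Real.exp_add, (hg.formula (f.comb.last 0)).1, hslope _ hwl]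
    have e1 := f.imLeft_last
    have e2 := f.left_last
    have e3 : f.imLeft (f.comb.last 1) - f.left (f.comb.last 0) = g.len (f.comb.last 0) := by
      linarith
    rw [← e3]
    ring
  · convert isFirstReturn_one (return_zero_of_ne hwl hα'.1 hl) using 1
    rw [hgx, (hf.formula α).2 x hα'.1, hileft α hl, hslope α hl]

/-- Domain and image exchange roles with respect to type 0: the images keep their left endpoints,
and the interval of the winner is cut in two, its right part going to the loser. -/
lemma isRauzyStep_one_of_affine {ω' : A → ℝ} (hwl : f.comb.last 0 ≠ f.comb.last 1)
    (hm : IsRauzyMove f.comb 1 g.comb) (hf : f.IsAffineWithSlope ω)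
    (hg : g.IsAffineWithSlope ω')
    (hω : ∀ α, ω' α = ω α + if α = f.comb.last 0 then ω (f.comb.last 1) else 0)
    (hw : f.len (f.comb.last 1) = g.len (f.comb.last 1) + g.len (f.comb.last 0))
    (hl : f.len (f.comb.last 0) = Real.exp (ω (f.comb.last 1)) * g.len (f.comb.last 0))
    (hlen : ∀ α, α ≠ f.comb.last 1 → α ≠ f.comb.last 0 → g.len α = f.len α) :
    IsRauzyStep f 1 g := by
  have hrow : g.comb.row 1 = f.comb.row 1 := hm.1
  have hiw := (hf.formula (f.comb.last 1)).1
  have he := Real.exp_pos (ω (f.comb.last 1))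
  have ht : f.len (f.comb.last 0) < f.imLen (f.comb.last 1) := by
    rw [hiw, hl, hw]
    exact mul_lt_mul_of_pos_left (by linarith [g.len_pos (f.comb.last 1)]) he
  have hslope : ∀ α, α ≠ f.comb.last 0 → ω' α = ω α := fun α hα => by
    rw [hω, if_neg hα, add_zero]
  have him : ∀ α, α ≠ f.comb.last 1 → g.imLen α = f.imLen α := by
    intro α h1
    rw [(hg.formula α).1, (hf.formula α).1]
    by_cases h2 : α = f.comb.last 0
    · subst h2
      rw [hω, if_pos rfl, hl, Real.exp_add]
      ring
    · rw [hlen α h1 h2, hslope α h2]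
  have hileft : ∀ α, g.imLeft α = f.imLeft α := fun α => by
    rw [imLeft, imLeft, hrow]
    exact offset_congr_of_last (f.comb.row_le_last 1) him α
  have himw : g.imLen (f.comb.last 1) = f.imLen (f.comb.last 1) - f.len (f.comb.last 0) := by
    rw [(hg.formula _).1, hiw, hl, hw, hslope _ hwl.symm]
    ring
  have hT : g.total = f.total - f.len (f.comb.last 0) := by
    have h1 := g.imLeft_last
    have h2 := f.imLeft_last
    have h3 : g.comb.last 1 = f.comb.last 1 := hm.last_eq
    rw [h3, hileft] at h1
    linarith
  have hrow' := hm.2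
  simp only [sub_self, Fin.le_def] at hrow'
  have hleft : ∀ α, α ≠ f.comb.last 0 → g.left α = f.left α := fun α hα =>
    offset_insert_of_ne hwl.symm (fun β hβ => CombData.row_lt_last hβ) hrow' hlen hw hα
  have hleft' : g.left (f.comb.last 0) = f.left (f.comb.last 1) + g.len (f.comb.last 1) :=
    offset_insert_self hwl.symm (fun β hβ => CombData.row_lt_last hβ) hrow' hlen
  have hgl : Real.exp (-ω (f.comb.last 1)) * f.len (f.comb.last 0) = g.len (f.comb.last 0) := by
    rw [hl, ← mul_assoc, ← Real.exp_add, neg_add_cancel, Real.exp_zero, one_mul]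
  obtain ⟨hp1, hp2⟩ := preimage_last hf ht
  rw [hgl] at hp1 hp2
  have hint : ∀ α, g.interval α =
      if α = f.comb.last 0 then
        {x ∈ f.interval (f.comb.last 1) | f.toFun x ∈ f.interval (f.comb.last 0)}
      else if α = f.comb.last 1 then
        {x ∈ f.interval (f.comb.last 1) | f.toFun x ∉ f.interval (f.comb.last 0)}
      else f.interval α := by
    intro α
    split_ifs with h1 h2
    · subst h1
      rw [hp1, interval, hleft']
      congr 1 <;> linarith
    · subst h2
      rw [hp2, interval, hleft _ h1]
      congr 1; linarith
    · rw [interval, interval, hleft α h1, hlen α h2 h1]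
  refine ⟨fun h => by simp at h, fun _ => ht, hm, by rw [hT, min_eq_left ht.le],
    fun h => by simp at h, fun _ => hint, fun x hx => ?_⟩
  obtain ⟨α, hα⟩ := g.exists_mem_interval hx
  have hα' := hα
  rw [hint] at hα'
  have hgx := (hg.formula α).2 x hα
  rw [hT]
  by_cases h1 : α = f.comb.last 0
  · subst h1
    rw [if_pos rfl] at hα'
    obtain ⟨h2, h3⟩ := return_one_loser hwl ht hα'.2
    convert isFirstReturn_two h2 h3 using 1
    rw [hgx, (hf.formula _).2 _ hα'.2, (hf.formula _).2 _ hα'.1, hileft, hω, if_pos rfl,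
      Real.exp_add, hleft']
    have e1 := f.imLeft_last
    have e2 := f.left_last
    have e3 : f.imLeft (f.comb.last 1) - f.left (f.comb.last 0) =
        -(Real.exp (ω (f.comb.last 1)) * g.len (f.comb.last 1)) := by
      rw [hiw, hw] at e1
      rw [hl] at e2
      linarith
    have e4 : f.imLeft (f.comb.last 1) = f.left (f.comb.last 0) -
        Real.exp (ω (f.comb.last 1)) * g.len (f.comb.last 1) := by linarith
    rw [e4]
    ring
  · rw [if_neg h1] at hα'
    rw [hleft α h1] at hgx
    by_cases h2 : α = f.comb.last 1
    · subst h2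
      rw [if_pos rfl] at hα'
      convert isFirstReturn_one (return_one_winner hwl hα'.1 hα'.2) using 1
      rw [hgx, (hf.formula _).2 x hα'.1, hileft, hslope _ h1]
    · rw [if_neg h2] at hα'
      convert isFirstReturn_one (return_one_of_ne hwl ht hα' h2) using 1
      rw [hgx, (hf.formula _).2 x hα', hileft, hslope _ h1]

end GIET

/-! ### Genus one implies rotation type -/

/-- Two blocks on which `G` is a translation have disjoint images. -/
lemma block_disjoint {d : ℕ} {G : ℕ → ℕ} (hinj : ∀ i < d, ∀ j < d, G i = G j → i = j)
    {i j m n p q : ℕ} (hm : 0 < m) (hn : 0 < n) (hij : i + m ≤ j) (hjd : j + n ≤ d)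
    (hi : ∀ u < m, G (i + u) = p + u) (hj : ∀ u < n, G (j + u) = q + u) :
    p + m ≤ q ∨ q + n ≤ p := by
  by_contra! h
  rcases le_total p q with hpq | hpq
  · have h1 := hi (q - p) (by omega)
    have h2 := hj 0 hn
    have := hinj (i + (q - p)) (by omega) (j + 0) (by omega) (by omega)
    omega
  · have h1 := hi 0 hm
    have h2 := hj (p - q) (by omega)
    have := hinj (i + 0) (by omega) (j + (p - q)) (by omega) (by omega)
    omega

/-- An irreducible permutation which is a translation on three consecutive blocks exchanges two
blocks, or three blocks `XYZ ↦ ZYX`. -/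
lemma exists_three_blocks {d s t : ℕ} {G : ℕ → ℕ} (hlt : ∀ i < d, G i < d)
    (hinj : ∀ i < d, ∀ j < d, G i = G j → i = j) (hs : 1 ≤ s) (hst : s ≤ t) (htd : t < d)
    (hG : ∀ i, 1 ≤ i → i < d → i ≠ s → i ≠ t → G i = G (i - 1) + 1)
    (hirr : ∀ r, 1 ≤ r → r + 1 ≤ d → ∃ i < d, ¬ (i < r ↔ G i < r)) :
    ∃ a b, 0 < a ∧ a ≤ b ∧ b < d ∧ ∀ i < d, G i =
      if i < a then i + (d - a) else if i < b then i + d - a - b else i - b := by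
  have b0 : ∀ u < s, G (0 + u) = G 0 + u := by
    intro u
    induction u with
    | zero => intro _; rfl
    | succ u ih =>
      intro hu
      have h1 := hG (0 + (u + 1)) (by omega) (by omega) (by omega) (by omega)
      have h2 := ih (by omega)
      rw [show 0 + (u + 1) - 1 = 0 + u by omega] at h1
      omega
  have b1 : ∀ u < t - s, G (s + u) = G s + u := by
    intro u
    induction u with
    | zero => intro _; rfl
    | succ u ih =>
      intro hu
      have h1 := hG (s + (u + 1)) (by omega) (by omega) (by omega) (by omega)
      have h2 := ih (by omega)
      rw [show s + (u + 1) - 1 = s + u by omega] at h1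
      omega
  have b2 : ∀ u < d - t, G (t + u) = G t + u := by
    intro u
    induction u with
    | zero => intro _; rfl
    | succ u ih =>
      intro hu
      have h1 := hG (t + (u + 1)) (by omega) (by omega) (by omega) (by omega)
      have h2 := ih (by omega)
      rw [show t + (u + 1) - 1 = t + u by omega] at h1
      omega
  have e0 := b0 (s - 1) (by omega)
  have f0 := hlt (0 + (s - 1)) (by omega)
  have e2 := b2 (d - t - 1) (by omega)
  have f2 := hlt (t + (d - t - 1)) (by omega)
  have d02 := block_disjoint hinj (show 0 < s by omega) (show 0 < d - t by omega)
    (by omega) (by omega) b0 b2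
  have hform : ∀ i < d, (i < s ∧ G i = G 0 + i) ∨ (s ≤ i ∧ i < t ∧ G i = G s + (i - s)) ∨
      (t ≤ i ∧ G i = G t + (i - t)) := by
    intro i hi
    by_cases h1 : i < s
    · have := b0 i h1
      rw [zero_add] at this
      exact Or.inl ⟨h1, this⟩
    · by_cases h2 : i < t
      · have := b1 (i - s) (by omega)
        rw [show s + (i - s) = i by omega] at this
        exact Or.inr (Or.inl ⟨by omega, h2, this⟩)
      · have := b2 (i - t) (by omega)
        rw [show t + (i - t) = i by omega] at this
        exact Or.inr (Or.inr ⟨by omega, this⟩)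
  -- Irreducibility at `s` and `t` excludes the image orders in which `X` comes first or `Z` comes
  -- last. There remain `ZYX`, and `YZX` and `ZXY`, which are exchanges of two blocks.
  obtain ⟨i₁, hi₁, hr₁⟩ := hirr s hs (by omega)
  obtain ⟨i₂, hi₂, hr₂⟩ := hirr t (by omega) (by omega)
  have g₁ := hform i₁ hi₁
  have g₂ := hform i₂ hi₂
  rcases eq_or_lt_of_le hst with rfl | hst'
  · refine ⟨s, s, by omega, le_rfl, htd, fun i hi => ?_⟩
    have := hform i hi
    split_ifs <;> omega
  · have e1 := b1 (t - s - 1) (by omega)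
    have f1 := hlt (s + (t - s - 1)) (by omega)
    have d01 := block_disjoint hinj (show 0 < s by omega) (show 0 < t - s by omega)
      (by omega) (by omega) b0 b1
    have d12 := block_disjoint hinj (show 0 < t - s by omega) (show 0 < d - t by omega)
      (by omega) (by omega) b1 b2
    by_cases hzx : G t + (d - t) ≤ G 0
    · by_cases hyx : G s + (t - s) ≤ G 0
      · by_cases hzy : G t + (d - t) ≤ G s
        · refine ⟨s, t, by omega, hst, htd, fun i hi => ?_⟩
          have := hform i hi
          split_ifs <;> omega
        · refine ⟨s, s, by omega, le_rfl, by omega, fun i hi => ?_⟩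
          have := hform i hi
          split_ifs <;> omega
      · refine ⟨t, t, by omega, le_rfl, by omega, fun i hi => ?_⟩
        have := hform i hi
        split_ifs <;> omega
    · by_cases hyx : G s + (t - s) ≤ G 0
      · omega
      · omega

namespace GIET

variable {f : GIET A}

/-- The left limit is the right endpoint of `f(I_β)` and the value is the left endpoint of `f(I_α)`;
they agree only if `f(I_α)` comes immediately after `f(I_β)`. -/
lemma not_continuousWithinAt_left {α β : A} (h0 : (f.comb.row 0 α : ℕ) = f.comb.row 0 β + 1)
    (h1 : (f.comb.row 1 α : ℕ) ≠ f.comb.row 1 β + 1) :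
    ¬ ContinuousWithinAt f.toFun (Ico 0 f.total) (f.left α) := by
  intro hcont
  have hleft : f.left α = f.left β + f.len β := offset_succ h0
  have hβ : f.left β < f.left α := by rw [hleft]; linarith [f.len_pos β]
  have hIβ : f.interval β = Ico (f.left β) (f.left α) := by rw [interval, hleft]
  have hlim : Tendsto f.toFun (𝓝[<] (f.left α)) (𝓝 (f.toFun (f.left α))) := by
    refine hcont.mono_left ?_
    rw [nhdsWithin, nhdsWithin]
    refine le_inf inf_le_left ?_
    rw [← nhdsWithin, le_principal_iff]
    have h2 : Ico (f.left β) (f.left α) ∈ 𝓝[<] (f.left α) := Ico_mem_nhdsLT hβ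
    exact mem_of_superset h2 (hIβ ▸ f.interval_subset β)
  have hlim' : Tendsto f.toFun (𝓝[<] (f.left α)) (𝓝 (f.imLeft β + f.imLen β)) := by
    rw [tendsto_order]
    constructor
    · intro y hy
      obtain ⟨z, hz1, hz2⟩ : ∃ z ∈ f.interval β, y < f.toFun z := by
        have hz : max ((y + (f.imLeft β + f.imLen β)) / 2) (f.imLeft β) ∈
            Ico (f.imLeft β) (f.imLeft β + f.imLen β) :=
          ⟨le_max_right _ _, max_lt (by linarith) (by linarith [f.imLen_pos β])⟩
        rw [← f.toFun_image] at hz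
        obtain ⟨z, hz1, hz2⟩ := hz
        refine ⟨z, hz1, ?_⟩
        rw [hz2]
        exact lt_of_lt_of_le (by linarith) (le_max_left _ _)
      rw [hIβ] at hz1
      filter_upwards [Ico_mem_nhdsLT hz1.2] with x hx
      refine lt_of_lt_of_le hz2 ?_
      have hzx : z ∈ f.interval β := hIβ ▸ hz1
      have hxx : x ∈ f.interval β := hIβ ▸ ⟨hz1.1.trans hx.1, hx.2⟩
      exact (f.strictMonoOn β).monotoneOn hzx hxx hx.1
    · intro y hy
      filter_upwards [Ico_mem_nhdsLT hβ] with x hx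
      have hxx : x ∈ f.interval β := hIβ ▸ hx
      exact (f.toFun_mem hxx).2.trans hy
  have heq := tendsto_nhds_unique hlim hlim'
  have hα : f.left α ∈ f.interval α := ⟨le_rfl, by linarith [f.len_pos α]⟩
  have him : f.toFun (f.left α) = f.imLeft α := by
    refine le_antisymm ?_ (f.toFun_mem hα).1
    have : f.imLeft α ∈ f.toFun '' f.interval α := by
      rw [f.toFun_image]; exact ⟨le_rfl, by linarith [f.imLen_pos α]⟩
    obtain ⟨z, hz, hz'⟩ := this
    rw [← hz']
    exact (f.strictMonoOn α).monotoneOn hα hz hz.1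
  rw [him] at heq
  have hne : α ≠ β := fun h => by rw [h] at h0; omega
  rcases lt_trichotomy (f.comb.row 1 α : ℕ) (f.comb.row 1 β + 1) with h | h | h
  · have h2 : (f.comb.row 1 α : ℕ) < f.comb.row 1 β := by
      have : (f.comb.row 1 α : ℕ) ≠ f.comb.row 1 β := fun h' => hne (CombData.eq_of_row_eq h')
      omega
    have h3 : f.imLeft α + f.imLen α ≤ f.imLeft β := offset_add_le f.imLen_pos h2
    linarith [f.imLen_pos α, f.imLen_pos β]
  · exact h1 h
  · obtain ⟨δ, hδ⟩ := exists_row_eq f.comb 1 (show (f.comb.row 1 β : ℕ) + 1 < Fintype.card A by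
      have := (f.comb.row 1 α).2
      omega)
    have h3 : f.imLeft δ + f.imLen δ ≤ f.imLeft α :=
      offset_add_le (r := f.comb.row 1) f.imLen_pos (by omega)
    have h4 : f.imLeft δ = f.imLeft β + f.imLen β := offset_succ hδ
    linarith [f.imLen_pos δ]

lemma left_injective (f : GIET A) : Function.Injective f.left := by
  intro α β h
  refine eq_of_mem_Ico_offset (r := f.comb.row 0) f.len_pos (x := f.left α) ?_ ?_
  · exact ⟨le_rfl, by rw [← left_eq]; linarith [f.len_pos α]⟩
  · rw [h]; exact ⟨le_rfl, by rw [← left_eq]; linarith [f.len_pos β]⟩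

/-- Every place where neighbours in the first row are not consecutive in the second is a
discontinuity. With at most two of them the permutation is a translation on at most three blocks,
and `exists_three_blocks` applies. -/
theorem exists_isRotationType [Nontrivial A] (hirr : f.comb.Irreducible) (hg : f.IsGenusOne) :
    ∃ a b, IsRotationType f.comb a b := by
  set d := Fintype.card A with hd
  have hd2 : 1 < d := Fintype.one_lt_card
  set G : ℕ → ℕ := fun i => if h : i < d then f.comb.row 1 ((f.comb.row 0).symm ⟨i, h⟩) else 0
    with hGdef
  have hGrow : ∀ α, G (f.comb.row 0 α) = f.comb.row 1 α := fun α => by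
    simp [hGdef, hd]
  have hlt : ∀ i < d, G i < d := fun i hi => by
    obtain ⟨α, rfl⟩ := exists_row_eq f.comb 0 hi
    rw [hGrow]; exact (f.comb.row 1 α).2
  have hinj : ∀ i < d, ∀ j < d, G i = G j → i = j := fun i hi j hj h => by
    obtain ⟨α, rfl⟩ := exists_row_eq f.comb 0 hi
    obtain ⟨β, rfl⟩ := exists_row_eq f.comb 0 hj
    rw [hGrow, hGrow] at h
    rw [CombData.eq_of_row_eq h]
  have hirr' : ∀ r, 1 ≤ r → r + 1 ≤ d → ∃ i < d, ¬ (i < r ↔ G i < r) := by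
    intro r h1 h2
    by_contra! hcon
    refine hirr r h1 h2 (Set.ext fun α => ?_)
    have := hcon (f.comb.row 0 α) (f.comb.row 0 α).2
    rwa [hGrow] at this
  set S : Finset A := Finset.univ.filter fun α => 1 ≤ (f.comb.row 0 α : ℕ) ∧
    G (f.comb.row 0 α) ≠ G (f.comb.row 0 α - 1) + 1 with hS
  have hScard : S.card ≤ 2 := by
    have hsub : f.left '' (S : Set A) ⊆
        {x ∈ Ico 0 f.total | ¬ ContinuousWithinAt f.toFun (Ico 0 f.total) x} := by
      rintro _ ⟨α, hα, rfl⟩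
      simp only [hS, Finset.coe_filter, Finset.mem_univ, true_and, mem_ofPred_eq] at hα
      refine ⟨f.interval_subset α ⟨le_rfl, by linarith [f.len_pos α]⟩, ?_⟩
      obtain ⟨β, hβ⟩ := exists_row_eq f.comb 0 (show (f.comb.row 0 α : ℕ) - 1 < d by
        have := (f.comb.row 0 α).2
        omega)
      refine not_continuousWithinAt_left (β := β) (by omega) ?_
      rw [← hGrow, ← hGrow, hβ]
      exact hα.2
    have h1 := (encard_le_encard hsub).trans hg
    rw [f.left_injective.encard_image, encard_coe_eq_coe_finsetCard] at h1
    exact_mod_cast h1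
  -- The break points `s` and `t` need not be true discontinuities: with fewer than two of them, `s
  -- = t` is chosen.
  have hex : ∃ s t, 1 ≤ s ∧ s ≤ t ∧ t < d ∧
      ∀ i, 1 ≤ i → i < d → i ≠ s → i ≠ t → G i = G (i - 1) + 1 := by
    have hmem : ∀ i, 1 ≤ i → i < d → G i ≠ G (i - 1) + 1 →
        ∃ α ∈ S, (f.comb.row 0 α : ℕ) = i := by
      intro i h1 h2 h3
      obtain ⟨α, rfl⟩ := exists_row_eq f.comb 0 h2
      exact ⟨α, by simp [hS, h1, h3], rfl⟩
    have hpos : ∀ α ∈ S, 1 ≤ (f.comb.row 0 α : ℕ) ∧ (f.comb.row 0 α : ℕ) < d := fun α hα => by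
      simp only [hS, Finset.mem_filter] at hα
      exact ⟨hα.2.1, (f.comb.row 0 α).2⟩
    have hcases : S.card = 0 ∨ S.card = 1 ∨ S.card = 2 := by omega
    rcases hcases with h | h | h
    · rw [Finset.card_eq_zero] at h
      refine ⟨1, 1, le_rfl, le_rfl, hd2, fun i h1 h2 _ _ => ?_⟩
      by_contra h3
      obtain ⟨α, hα, -⟩ := hmem i h1 h2 h3
      rw [h] at hα
      simp at hα
    · obtain ⟨α, hα⟩ := Finset.card_eq_one.1 h
      have hp := hpos α (by simp [hα])
      refine ⟨f.comb.row 0 α, f.comb.row 0 α, hp.1, le_rfl, hp.2, fun i h1 h2 h4 _ => ?_⟩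
      by_contra h3
      obtain ⟨β, hβ, rfl⟩ := hmem i h1 h2 h3
      rw [hα, Finset.mem_singleton] at hβ
      exact h4 (by rw [hβ])
    · obtain ⟨α, β, -, hαβ⟩ := Finset.card_eq_two.1 h
      have hp := hpos α (by simp [hαβ])
      have hq := hpos β (by simp [hαβ])
      have hall : ∀ i, 1 ≤ i → i < d → i ≠ f.comb.row 0 α → i ≠ f.comb.row 0 β →
          G i = G (i - 1) + 1 := by
        intro i h1 h2 h4 h5
        by_contra h3
        obtain ⟨γ, hγ, rfl⟩ := hmem i h1 h2 h3
        rw [hαβ, Finset.mem_insert, Finset.mem_singleton] at hγ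
        rcases hγ with rfl | rfl
        · exact h4 rfl
        · exact h5 rfl
      rcases le_total (f.comb.row 0 α : ℕ) (f.comb.row 0 β) with hle | hle
      · exact ⟨_, _, hp.1, hle, hq.2, hall⟩
      · exact ⟨_, _, hq.1, hle, hp.2, fun i h1 h2 h3 h4 => hall i h1 h2 h4 h3⟩
  obtain ⟨s, t, hs, hst, htd, hG⟩ := hex
  obtain ⟨a, b, ha, hab, hb, hform⟩ := exists_three_blocks hlt hinj hs hst htd hG hirr'
  exact ⟨a, b, ha, hab, hb, fun α => by rw [← hGrow]; exact hform _ (f.comb.row 0 α).2⟩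

end GIET

namespace CombSeq

variable [Nontrivial A] {c : CombSeq A} {ω : A → ℝ} {N : ℕ} {m M : ℝ}

/-! ### The normalized operators -/

/-- Intermediate normalizations only change the scale, so a single one at the end suffices. -/
lemma partitionComp_eq (hT : UniformlyPositive (c.partitionMatrix ω) N m M) (j n : ℕ) {x : A → ℝ}
    (hx : x ∈ simplex A) :
    c.partitionComp ω j n x = normalize (seqProd (c.partitionMatrix ω) j n *ᵥ x) := by
  induction n generalizing x with
  | zero => simp [partitionComp, seqProd, normalize_of_mem_simplex hx]
  | succ n ih =>
    have hpos := hT.mulVec_pos (j + n) hx.1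
    change c.partitionComp ω j n (normalize (c.partitionMatrix ω (j + n) *ᵥ x)) = _
    rw [ih (normalize_mem_simplex hpos), seqProd, ← mulVec_mulVec]
    conv_lhs => rw [normalize.eq_1 (c.partitionMatrix ω (j + n) *ᵥ x), mulVec_smul]
    rw [normalize_smul (inv_pos.2 (sum_pos_of_pos hpos)).ne']

lemma partitionMap_mem_simplex (hT : UniformlyPositive (c.partitionMatrix ω) N m M) (n : ℕ)
    {x : A → ℝ} (hx : x ∈ simplex A) : c.partitionMap ω n x ∈ simplex A :=
  normalize_mem_simplex (hT.mulVec_pos n hx.1)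

lemma partitionComp_image_subset (hT : UniformlyPositive (c.partitionMatrix ω) N m M) (j n : ℕ) :
    c.partitionComp ω j (n + 1) '' simplex A ⊆ c.partitionComp ω j n '' simplex A := by
  rintro _ ⟨x, hx, rfl⟩
  exact ⟨_, partitionMap_mem_simplex hT (j + n) hx, rfl⟩

lemma projDist_partitionComp_le (hT : UniformlyPositive (c.partitionMatrix ω) N m M) (j : ℕ)
    {x y : A → ℝ} (hx : x ∈ simplex A) (hy : y ∈ simplex A) :
    projDist (c.partitionComp ω j N x) (c.partitionComp ω j N y) ≤
      (1 - (m / M) ^ 2) * projDist x y := by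
  rw [partitionComp_eq hT j N hx, partitionComp_eq hT j N hy, projDist_normalize
    (hT.seqProd_mulVec_pos _ _ hx.1) (hT.seqProd_mulVec_pos _ _ hy.1)]
  exact projDist_mulVec_le hT.pos (hT.lower j) (hT.upper j) hx.1 hy.1

/-- The nested intersection is the initial point of any positive orbit. -/
lemma iInter_partitionComp (hT : UniformlyPositive (c.partitionMatrix ω) N m M)
    {l : ℕ → A → ℝ} (hl : IsPositiveOrbit (c.partitionMatrix ω) l) (hl1 : ∑ α, l 0 α = 1) :
    (⋂ n : ℕ, c.partitionComp ω 0 (n + 1) '' simplex A) = {l 0} := by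
  have hl0 : l 0 ∈ simplex A := ⟨hl.pos 0, hl1⟩
  refine Subset.antisymm (fun x hx => ?_) (singleton_subset_iff.2 (mem_iInter.2 fun n => ?_))
  · refine mem_singleton_iff.2 (funext fun i => eq_of_abs_sub_le_all fun ε hε => ?_)
    obtain ⟨n₀, hn₀⟩ := hT.exists_forall_abs_sub_lt 0 hε
    obtain ⟨z, hz, rfl⟩ := mem_iInter.1 hx n₀
    rw [partitionComp_eq hT _ _ hz, ← normalize_of_mem_simplex hl0,
      hl.eq_seqProd 0 (n₀ + 1)]
    exact (hn₀ (n₀ + 1) (by omega) _ _ hz.1 (hl.pos _) i).le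
  · refine ⟨normalize (l (0 + (n + 1))), normalize_mem_simplex (hl.pos _), ?_⟩
    rw [partitionComp_eq hT _ _ (normalize_mem_simplex (hl.pos _))]
    conv_lhs => rw [normalize.eq_1 (l (0 + (n + 1))), mulVec_smul]
    rw [normalize_smul (inv_pos.2 (sum_pos_of_pos (hl.pos _))).ne', ← hl.eq_seqProd,
      normalize_of_mem_simplex hl0]

/-! ### Affine maps and positive orbits -/

lemma partitionMatrix_mulVec_zero {n : ℕ} (h : c.winner n ≠ c.loser n) (hε : c.ε n = 0)
    (z : A → ℝ) (α : A) : (c.partitionMatrix ω n *ᵥ z) α = z α + if α = (c.π n).last 0 then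
      Real.exp ((c.thetaProd 0 n *ᵥ ω) ((c.π n).last 1)) * z ((c.π n).last 1) else 0 := by
  rw [partitionMatrix_mulVec h]
  simp only [winner, loser, hε, sub_zero, Fin.val_zero, Nat.cast_zero, zero_mul,
    Real.exp_zero, one_mul]
  split_ifs <;> simp

lemma partitionMatrix_mulVec_one {n : ℕ} (h : c.winner n ≠ c.loser n) (hε : c.ε n = 1)
    (z : A → ℝ) (α : A) : (c.partitionMatrix ω n *ᵥ z) α =
      if α = (c.π n).last 1 then z α + z ((c.π n).last 0)
      else if α = (c.π n).last 0 then
        Real.exp ((c.thetaProd 0 n *ᵥ ω) ((c.π n).last 1)) * z α else z α := by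
  rw [partitionMatrix_mulVec h]
  simp only [winner, loser, hε, sub_self, Fin.val_one, Nat.cast_one, zero_mul,
    Real.exp_zero, one_mul]

lemma thetaProd_succ_apply (c : CombSeq A) (ω : A → ℝ) (n : ℕ) (α : A) :
    (c.thetaProd 0 (n + 1) *ᵥ ω) α = (c.thetaProd 0 n *ᵥ ω) α +
      if α = c.loser n then (c.thetaProd 0 n *ᵥ ω) (c.winner n) else 0 := by
  rw [thetaProd_zero_succ, ← mulVec_mulVec, theta_mulVec]

lemma last_zero_ne_last_one {n : ℕ} (h : c.winner n ≠ c.loser n) :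
    (c.π n).last 0 ≠ (c.π n).last 1 := by
  unfold winner loser at h
  rcases fin_two_cases (c.ε n) with hε | hε
  · rw [hε, sub_zero] at h; exact h
  · rw [hε, sub_self] at h; exact h.symm

/-- The partition vectors of the renormalizations of an affine map form a positive orbit. -/
lemma exists_orbit_of_affine (hwl : ∀ n, c.winner n ≠ c.loser n) {g : GIET A}
    (hg : g.HasCombinatorics c) (hω : g.IsAffineWithSlope ω) :
    ∃ l, IsPositiveOrbit (c.partitionMatrix ω) l ∧ l 0 = g.len := by
  obtain ⟨G, hG⟩ := hg
  have hne : ∀ n, (G n).comb.last 0 ≠ (G n).comb.last 1 := fun n => by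
    rw [hG.comb n]; exact last_zero_ne_last_one (hwl n)
  have haff : ∀ n, (G n).IsAffineWithSlope (c.thetaProd 0 n *ᵥ ω) := by
    intro n
    induction n with
    | zero => rw [hG.zero]; simpa [thetaProd] using hω
    | succ n ih =>
      have hs := hG.step n
      have e : c.thetaProd 0 (n + 1) *ᵥ ω = fun α => (c.thetaProd 0 n *ᵥ ω) α +
          if α = c.loser n then (c.thetaProd 0 n *ᵥ ω) (c.winner n) else 0 :=
        funext fun α => thetaProd_succ_apply c ω n α
      rw [e]
      unfold winner loser
      rw [← hG.comb n]
      rcases fin_two_cases (c.ε n) with hε | hε <;> rw [hε] at hs ⊢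
      · exact hs.affine_zero (hne n) ih
      · exact hs.affine_one (hne n) ih
  refine ⟨fun n => (G n).len, ⟨fun n => (G n).len_pos, fun n => funext fun α => ?_⟩, by
    simp only [hG.zero]⟩
  have hs := hG.step n
  rcases fin_two_cases (c.ε n) with hε | hε
  · rw [hε] at hs
    rw [partitionMatrix_mulVec_zero (hwl n) hε, ← hG.comb n]
    obtain ⟨h1, h2⟩ := hs.len_zero
    by_cases hα : α = (G n).comb.last 0
    · rw [if_pos hα, hα, h1, ((haff n).formula _).1, h2 _ (hne n).symm]
    · rw [if_neg hα, h2 α hα, add_zero]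
  · rw [hε] at hs
    rw [partitionMatrix_mulVec_one (hwl n) hε, ← hG.comb n]
    obtain ⟨h1, h2, h3⟩ := hs.len_one (hne n) (haff n)
    split_ifs with h4 h5
    · rw [h4, h1]
    · rw [h5, h2]
    · exact h3 α h5 h4

lemma sum_sub_sum_of_eq_off {x y : A → ℝ} {w l : A} (hwl : w ≠ l)
    (h : ∀ α, α ≠ w → α ≠ l → x α = y α) :
    ∑ α, x α - ∑ α, y α = (x w - y w) + (x l - y l) := by
  rw [← Finset.sum_sub_distrib]
  have e : ∀ α, x α - y α = (if α = w then x w - y w else 0) +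
      (if α = l then x l - y l else 0) := by
    intro α
    by_cases h1 : α = w
    · subst h1; simp [hwl]
    · by_cases h2 : α = l
      · subst h2; simp [h1]
      · simp [h1, h2, h α h1 h2]
  rw [Finset.sum_congr rfl fun α _ => e α]
  simp only [Finset.sum_add_distrib, Finset.sum_ite_eq', Finset.mem_univ, if_true]

/-- The total length decreases by the same amount on both sides of an affine map. -/
lemma sum_orbit_succ (hwl : ∀ n, c.winner n ≠ c.loser n) {l : ℕ → A → ℝ}
    (hl : IsPositiveOrbit (c.partitionMatrix ω) l) (n : ℕ) :
    ∑ α, l n α - ∑ α, l (n + 1) α = Real.exp ((c.thetaProd 0 n *ᵥ ω) ((c.π n).last 1)) *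
        l (n + 1) (c.loser n) ∧
    ∑ α, Real.exp ((c.thetaProd 0 n *ᵥ ω) α) * l n α -
      ∑ α, Real.exp ((c.thetaProd 0 (n + 1) *ᵥ ω) α) * l (n + 1) α =
        Real.exp ((c.thetaProd 0 n *ᵥ ω) ((c.π n).last 1)) * l (n + 1) (c.loser n) := by
  have hne := last_zero_ne_last_one (hwl n)
  have hθ := thetaProd_succ_apply c ω n
  rcases fin_two_cases (c.ε n) with hε | hε
  · have hln := fun α => (congrFun (hl.eq n) α).trans
        (partitionMatrix_mulVec_zero (hwl n) hε _ α)
    simp only [winner, loser, hε, sub_zero] at hθ ⊢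
    have hw := hln ((c.π n).last 0)
    have hlo := hln ((c.π n).last 1)
    have hθw := hθ ((c.π n).last 0)
    have hθl := hθ ((c.π n).last 1)
    rw [if_pos rfl] at hw hθl
    rw [if_neg hne, add_zero] at hθw
    rw [if_neg hne.symm, add_zero] at hlo
    constructor
    · rw [sum_sub_sum_of_eq_off hne fun α h1 h2 => by rw [hln α, if_neg h1, add_zero], hw, hlo]
      ring
    · rw [sum_sub_sum_of_eq_off hne fun α h1 h2 => by
        rw [hln α, if_neg h1, add_zero, hθ α, if_neg h2, add_zero], hw, hlo, hθw, hθl,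
        Real.exp_add]
      ring
  · have hln := fun α => (congrFun (hl.eq n) α).trans
        (partitionMatrix_mulVec_one (hwl n) hε _ α)
    simp only [winner, loser, hε, sub_self] at hθ ⊢
    have hw := hln ((c.π n).last 1)
    have hlo := hln ((c.π n).last 0)
    have hθw := hθ ((c.π n).last 1)
    have hθl := hθ ((c.π n).last 0)
    rw [if_pos rfl] at hw hθl
    rw [if_neg hne.symm, add_zero] at hθw
    rw [if_neg hne, if_pos rfl] at hlo
    constructor
    · rw [sum_sub_sum_of_eq_off hne.symm fun α h1 h2 => by rw [hln α, if_neg h1, if_neg h2], hw,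
        hlo]
      ring
    · rw [sum_sub_sum_of_eq_off hne.symm fun α h1 h2 => by
        rw [hln α, if_neg h1, if_neg h2, hθ α, if_neg h2, add_zero], hw, hlo, hθw, hθl,
        Real.exp_add]
      ring

/-- The condition that the images fill the domain. By `sum_orbit_succ` the difference `D n` is
constant; it is at most `(e^B + 1) L_n`, and `L_n` decays geometrically because the loser carries a
definite share of the length. Hence `D` is zero. -/
lemma sum_exp_orbit_eq (hwl : ∀ n, c.winner n ≠ c.loser n)
    (hT : UniformlyPositive (c.partitionMatrix ω) N m M) {B : ℝ}
    (hB : ∀ n α, |(c.thetaProd 0 n *ᵥ ω) α| ≤ B) {l : ℕ → A → ℝ}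
    (hl : IsPositiveOrbit (c.partitionMatrix ω) l) (n : ℕ) :
    ∑ α, Real.exp ((c.thetaProd 0 n *ᵥ ω) α) * l n α = ∑ α, l n α := by
  obtain ⟨c₀, hc₀, hcomp⟩ := hl.exists_mul_sum_le hT
  set L : ℕ → ℝ := fun n => ∑ α, l n α with hL
  have hL0 : ∀ n, 0 < L n := fun n => sum_pos_of_pos (hl.pos n)
  set D : ℕ → ℝ := fun n => ∑ α, Real.exp ((c.thetaProd 0 n *ᵥ ω) α) * l n α - L n with hD
  have hDs : ∀ n, D (n + 1) = D n := fun n => by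
    obtain ⟨h1, h2⟩ := sum_orbit_succ hwl hl n
    simp only [hD, hL]
    linarith
  have hDc : ∀ n, D n = D 0 := fun n => by
    induction n with
    | zero => rfl
    | succ n ih => rw [hDs, ih]
  have hexp : ∀ n α, Real.exp (-B) ≤ Real.exp ((c.thetaProd 0 n *ᵥ ω) α) ∧
      Real.exp ((c.thetaProd 0 n *ᵥ ω) α) ≤ Real.exp B := fun n α => by
    rw [Real.exp_le_exp, Real.exp_le_exp]
    exact abs_le.1 (hB n α)
  set η := Real.exp (-B) * c₀ with hη
  have hη0 : 0 < η := mul_pos (Real.exp_pos _) hc₀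
  have hLs : ∀ n, L (n + 1) ≤ (1 + η)⁻¹ * L n := fun n => by
    have h1 := (sum_orbit_succ hwl hl n).1
    have h2 : η * L (n + 1) ≤ Real.exp ((c.thetaProd 0 n *ᵥ ω) ((c.π n).last 1)) *
        l (n + 1) (c.loser n) := by
      rw [hη, mul_assoc]
      exact mul_le_mul (hexp n _).1 (hcomp _ _) (mul_pos hc₀ (hL0 _)).le (Real.exp_pos _).le
    rw [inv_mul_eq_div, le_div_iff₀ (by linarith)]
    simp only [hL] at h2 ⊢
    linarith
  have hLn : ∀ n, L n ≤ (1 + η)⁻¹ ^ n * L 0 := fun n => by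
    induction n with
    | zero => simp
    | succ n ih =>
      rw [pow_succ', mul_assoc]
      exact (hLs n).trans (mul_le_mul_of_nonneg_left ih (by positivity))
  have hlim : Tendsto (fun n => (Real.exp B + 1) * ((1 + η)⁻¹ ^ n * L 0)) atTop (𝓝 0) := by
    have := ((tendsto_pow_atTop_nhds_zero_of_lt_one (r := (1 + η)⁻¹) (by positivity)
      (inv_lt_one_of_one_lt₀ (by linarith))).mul_const (L 0)).const_mul (Real.exp B + 1)
    simpa using this
  have hDle : ∀ n, |D 0| ≤ (Real.exp B + 1) * ((1 + η)⁻¹ ^ n * L 0) := fun n => by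
    rw [← hDc n]
    refine le_trans ?_ (mul_le_mul_of_nonneg_left (hLn n) (by positivity))
    have h1 : ∑ α, Real.exp ((c.thetaProd 0 n *ᵥ ω) α) * l n α ≤ Real.exp B * L n := by
      rw [hL, Finset.mul_sum]
      exact Finset.sum_le_sum fun α _ => mul_le_mul_of_nonneg_right (hexp n α).2 (hl.pos n α).le
    have h2 : 0 ≤ ∑ α, Real.exp ((c.thetaProd 0 n *ᵥ ω) α) * l n α :=
      Finset.sum_nonneg fun α _ => mul_nonneg (Real.exp_pos _).le (hl.pos n α).le
    have h3 := hL0 n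
    have h4 := mul_pos (Real.exp_pos B) h3
    rw [abs_le]
    constructor <;> simp only [hD] <;> linarith
  have h0 : |D 0| ≤ 0 := ge_of_tendsto' hlim hDle
  have := hDc n
  rw [abs_nonpos_iff.1 h0] at this
  simp only [hD, hL] at this
  linarith

/-- A positive orbit gives an affine map. -/
lemma exists_affine_of_orbit (hc : c.Admissible) (hwl : ∀ n, c.winner n ≠ c.loser n)
    {l : ℕ → A → ℝ} (hl : IsPositiveOrbit (c.partitionMatrix ω) l)
    (hsum : ∀ n, ∑ α, Real.exp ((c.thetaProd 0 n *ᵥ ω) α) * l n α = ∑ α, l n α) :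
    ∃ g : GIET A, g.len = l 0 ∧ g.HasCombinatorics c ∧ g.IsAffineWithSlope ω := by
  set G : ℕ → GIET A := fun n =>
    GIET.affine (c.π n) (l n) (c.thetaProd 0 n *ᵥ ω) (hl.pos n) (hsum n)
  have haff : ∀ n, (G n).IsAffineWithSlope (c.thetaProd 0 n *ᵥ ω) := fun n =>
    GIET.affine_isAffineWithSlope _ _ _ _ _
  have hcomb : ∀ n, (G n).comb = c.π n := fun _ => rfl
  have hlen : ∀ n, (G n).len = l n := fun _ => rfl
  refine ⟨G 0, hlen 0, ⟨G, rfl, fun n => ?_, hcomb⟩, by simpa [thetaProd] using haff 0⟩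
  have hne : (G n).comb.last 0 ≠ (G n).comb.last 1 := last_zero_ne_last_one (hwl n)
  have hθ := thetaProd_succ_apply c ω n
  have hm : IsRauzyMove (G n).comb (c.ε n) (G (n + 1)).comb := hc n
  rcases fin_two_cases (c.ε n) with hε | hε
  · have hln := fun α => (congrFun (hl.eq n) α).trans
        (partitionMatrix_mulVec_zero (hwl n) hε _ α)
    simp only [winner, loser, hε, sub_zero] at hθ
    rw [hε] at hm ⊢
    refine GIET.isRauzyStep_zero_of_affine hne hm (haff n) (haff (n + 1)) hθ ?_ fun α hα => ?_
    · simp only [hlen, hcomb]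
      rw [hln, if_pos rfl]
    · simp only [hlen, hcomb] at hα ⊢
      rw [hln, if_neg hα, add_zero]
  · have hln := fun α => (congrFun (hl.eq n) α).trans
        (partitionMatrix_mulVec_one (hwl n) hε _ α)
    simp only [winner, loser, hε, sub_self] at hθ
    rw [hε] at hm ⊢
    refine GIET.isRauzyStep_one_of_affine hne hm (haff n) (haff (n + 1)) hθ ?_ ?_
      fun α hα hα' => ?_
    · simp only [hlen, hcomb]
      rw [hln, if_pos rfl]
    · simp only [hlen, hcomb] at hne ⊢
      rw [hln, if_neg hne, if_pos rfl]
    · simp only [hlen, hcomb] at hα hα' ⊢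
      rw [hln, if_neg hα, if_neg hα']

end CombSeq

/-! ### Conclusion -/

lemma GIET.HasCombinatorics.admissible [Nonempty A] {f : GIET A} {c : CombSeq A}
    (hf : f.HasCombinatorics c) : c.Admissible := by
  obtain ⟨F, hF⟩ := hf
  intro n
  rw [← hF.comb n, ← hF.comb (n + 1)]
  exact (hF.step n).comb_eq

lemma GIET.HasCombinatorics.comb_eq [Nonempty A] {f : GIET A} {c : CombSeq A}
    (hf : f.HasCombinatorics c) : f.comb = c.π 0 := by
  obtain ⟨F, hF⟩ := hf
  rw [← hF.comb 0, hF.zero]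

end RauzyVeech

open RauzyVeech
theorem mainTheorem8 {A : Type*} [Fintype A] [DecidableEq A] [Nontrivial A]
    (k : ℕ) (ν : ℝ≥0) (hν : 0 < ν)
    (f : GIET A) (c : CombSeq A) (hf : f.InClassB k ν c)
    (hmean : ∫ x in (0 : ℝ)..1, deriv (deriv f.toFun) x / deriv f.toFun x = 0)
    (F : ℕ → GIET A) (hF : f.IsRenormalization c F)
    (ω₀ : A → ℝ) (hω₀ : c.IsCentralLimit (fun n => (F n).meanLogDeriv) ω₀)
    (v : A → ℝ) (hv : v ∈ c.stableSpace 0)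
    (ω : A → ℝ) (hω : ω = ω₀ + v) :
    (∃! g : GIET A, g.total = 1 ∧ g.HasCombinatorics c ∧ g.IsAffineWithSlope ω) ∧
    (∀ g : GIET A, g.total = 1 → g.HasCombinatorics c → g.IsAffineWithSlope ω →
      (⋂ n : ℕ, c.partitionComp ω 0 (n + 1) '' simplex A) = {g.len}) ∧
    (∀ j n : ℕ, c.partitionComp ω j (n + 1) '' simplex A ⊆
      c.partitionComp ω j n '' simplex A) ∧
    (∃ N : ℕ, ∃ κ : ℝ, 0 < N ∧ 0 ≤ κ ∧ κ < 1 ∧ ∀ j : ℕ, ∀ x ∈ simplex A, ∀ y ∈ simplex A,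
      projDist (c.partitionComp ω j N x) (c.partitionComp ω j N y) ≤ κ * projDist x y) := by
  have hc := hf.combinatorics.admissible
  have hk := hf.bounded
  have hwl := fun n => CombSeq.winner_ne_loser hc hk n
  obtain ⟨a, b, hab⟩ := GIET.exists_isRotationType hf.irreducible hf.genusOne
  rw [hf.combinatorics.comb_eq] at hab
  -- Rotation type and the choice of `ω` bound the slopes `ωⁿ`, hence the entries of the `T̃_n`; the
  -- rest is projective contraction.
  obtain ⟨B, hB⟩ := CombSeq.exists_bound_of_isCentralLimit hc hk hab hω₀ hv
  rw [← hω] at hB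
  obtain ⟨N, m, M, hN, hT⟩ := CombSeq.exists_uniformlyPositive hc hk hB
  have hinter : ∀ g : GIET A, g.total = 1 → g.HasCombinatorics c → g.IsAffineWithSlope ω →
      (⋂ n : ℕ, c.partitionComp ω 0 (n + 1) '' simplex A) = {g.len} := by
    intro g hg1 hgc hgω
    obtain ⟨l, hl, hl0⟩ := CombSeq.exists_orbit_of_affine hwl hgc hgω
    rw [← hl0]
    exact CombSeq.iInter_partitionComp hT hl (by rw [hl0]; exact hg1)
  refine ⟨?_, hinter, CombSeq.partitionComp_image_subset hT, N, 1 - (m / M) ^ 2, hN,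
    hT.contraction_nonneg, hT.contraction_lt_one, fun j x hx y hy =>
      CombSeq.projDist_partitionComp_le hT j hx hy⟩
  obtain ⟨l, hl, hl1⟩ := hT.exists_orbit
  obtain ⟨g, hgl, hgc, hgω⟩ := CombSeq.exists_affine_of_orbit hc hwl hl
    (CombSeq.sum_exp_orbit_eq hwl hT hB hl)
  have hg1 : g.total = 1 := by rw [GIET.total, hgl, hl1]
  refine ⟨g, ⟨hg1, hgc, hgω⟩, fun g' ⟨hg1', hgc', hgω'⟩ => ?_⟩
  -- Both partition vectors are the only point of the nested intersection, and an affine map is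
  -- determined by its combinatorial data, lengths and slopes.
  refine hgω'.ext hgω (hgc'.comb_eq.trans hgc.comb_eq.symm) ?_
  exact singleton_injective ((hinter g' hg1' hgc' hgω').symm.trans (hinter g hg1 hgc hgω))
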